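/- Let $d\ge 2$, $\nu\in\{1,2,3,\dots\}$, $\mu\in\mathbb R\setminus\{0\}$, $\eta_1,\dots,\eta_d\in\{1,-1\}$ and let $s<-\frac{1}{1+2\nu}$. Put $\Delta_\eta=\sum_{j=1}^d\eta_j\partial_{x_j}^2$ and consider the Cauchy problem $$ i\partial_t\psi+\tfrac12\Delta_\eta\psi=\mu|\psi|^{2\nu}\psi,\quad x\in\mathbb R^d,\qquad \psi|_{t=0}=\varphi. \tag{1}$$ For $\sigma\in\mathbb R$ let $\|f\|_{H^\sigma}=\|(1+|\xi|^2)^{\sigma/2}\widehat f\,\|_{L^2(\mathbb R^d)}$, where $\widehat f(\xi)=(2\pi)^{-d/2}\int_{\mathbb R^d} f(x)e^{-ix\cdot\xi}\,dx$. Then there exist a sequence of initial data $\varphi_n\in\mathcal S(\mathbb R^d)$ with $$\|\varphi_n\|_{H^s(\mathbb R^d)}\to 0\quad (n\to\infty)$$ and times $t_n>0$ with $t_n\to0$ such that, for every $n$, (1) with $\varphi=\varphi_n$ has a unique solution (in the sense of distributions) $\psi_n\in C([0,t_n];L^2\cap L^\infty(\mathbb R^d))$, its value $\psi_n(t_n)$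 belongs to $H^\sigma(\mathbb R^d)$ for every $\sigma\in\mathbb R$, and $$\|\psi_n(t_n)\|_{H^\sigma(\mathbb R^d)}\to+\infty\quad (n\to\infty)\qquad\text{for all }\sigma\in\mathbb R.$$ -/

import Mathlib

open MeasureTheory Filter Topology
open scoped FourierTransform SchwartzMap LineDeriv ENNReal

noncomputable section

namespace NLS

/-- The space `ℝᵈ` with its Euclidean structure and Lebesgue measure. -/
abbrev Space (d : ℕ) : Type := EuclideanSpace ℝ (Fin d)

/-- The space `L²(ℝᵈ; ℂ)` of classes of square integrable functions. -/
abbrev L2 (d : ℕ) : Type := Lp (α := Space d) ℂ 2 (volume : Measure (Space d))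

/-- The `H^σ(ℝᵈ)` norm of `f ∈ L²(ℝᵈ)`, with value `∞` when `f ∉ H^σ(ℝᵈ)`:
`‖f‖² = ∫ ⟨ξ⟩^(2σ) |f̂(ξ)|² dξ` with `⟨ξ⟩ = (1 + |ξ|²)^(1/2)` and
`f̂(ξ) = (2π)^(-d/2) ∫ f(x) e^(-i x·ξ) dx`.  Mathlib's Fourier transform `𝓕 f` on `L²` has the
kernel `e^(-2πi x·ζ)`, so that the change of variables `ξ = 2πζ` gives
`‖f‖² = ∫ ⟨2πζ⟩^(2σ) |𝓕 f(ζ)|² dζ`. -/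
def sobolevNorm {d : ℕ} (σ : ℝ) (f : L2 d) : ℝ≥0∞ :=
  eLpNorm (fun ζ : Space d =>
    (((1 + ‖(2 * Real.pi) • ζ‖ ^ 2) ^ (σ / 2) : ℝ) : ℂ) * (𝓕 f : L2 d) ζ) 2 volume

/-- The constant coefficient operator `Δ_η θ = ∑ j, η j ∂_j² θ` on Schwartz functions. -/
def etaLaplacian {d : ℕ} (η : Fin d → ℝ) (θ : 𝓢(Space d, ℂ)) : 𝓢(Space d, ℂ) :=
  ∑ j : Fin d, (η j : ℂ) •
    ∂_{(EuclideanSpace.single j 1 : Space d)} (∂_{(EuclideanSpace.single j 1 : Space d)} θ)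

/-- `ψ` is a solution on the time interval `[0, T]`, in the class `C([0,T]; L² ∩ L^∞)`, of
`i ∂_t ψ + ½ Δ_η ψ = μ |ψ|^(2ν) ψ`, `ψ(0) = φ`.  The equation holds in the sense of
distributions: since `ψ` and `|ψ|^(2ν) ψ` are continuous in time with values in `L²`, this means
that for every test function `θ` the pairing `∫ ψ(t,x) θ(x) dx` is differentiable in `t ∈ [0,T]`
(one-sidedly at the end points), with derivative
`(i/2) ∫ ψ(t,x) Δ_η θ(x) dx - i μ ∫ |ψ(t,x)|^(2ν) ψ(t,x) θ(x) dx`. -/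
structure IsSolution {d : ℕ} (η : Fin d → ℝ) (ν : ℕ) (μ : ℝ) (φ : 𝓢(Space d, ℂ)) (T : ℝ)
    (ψ : ℝ → L2 d) : Prop where
  continuous_L2 : ContinuousOn ψ (Set.Icc 0 T)
  mem_Linfty : ∀ t ∈ Set.Icc 0 T, MemLp (ψ t : Space d → ℂ) ∞ volume
  continuous_Linfty : ∀ t ∈ Set.Icc 0 T,
    Tendsto (fun r : ℝ => eLpNorm ((ψ r - ψ t : L2 d) : Space d → ℂ) ∞ volume)
      (𝓝[Set.Icc 0 T] t) (𝓝 0)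
  initial : ψ 0 = φ.toLp 2 volume
  equation : ∀ θ : 𝓢(Space d, ℂ), ∀ t ∈ Set.Icc 0 T,
    HasDerivWithinAt (fun r : ℝ => ∫ x, (ψ r : Space d → ℂ) x * θ x)
      (Complex.I / 2 * (∫ x, (ψ t : Space d → ℂ) x * etaLaplacian η θ x)
        - Complex.I * (μ : ℂ) *
          ∫ x, ((‖(ψ t : Space d → ℂ) x‖ ^ (2 * ν) : ℝ) : ℂ) * (ψ t : Space d → ℂ) x * θ x)
      (Set.Icc 0 T) t

end NLS

end

/-!
The inflation mechanism is a transfer of mass from high frequencies to low ones: every Sobolev norm,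
of whatever order `σ`, controls the Fourier transform on the unit ball, so that it suffices to make
the Fourier transform of `ψ_n(t_n)` large there.  This is `exists_enorm_localIntegral_le`.

The Fourier transform of the initial data consists of three bumps of height `A` at the frequencies
`N e₁`, `N (e₁ + e₂)` and `N e₂`, which are three vertices of a rectangle whose fourth vertex is the
origin.  For `s < 0` the `H^s` norm of these data is of size `A N^s`.  The power nonlinearity is, on
the Fourier side, an iterated convolution (`powFun`); since `k₁ - k₂ + k₃ = 0` for these three
frequencies, it creates a bump at the origin, and as all functions involved are nonnegative, nothing
can cancel it: `IsBump.realPow_le_realPow_succ`.  After a time `T` the mass near the origin is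
therefore about `A^{2ν+1} T`, up to errors which come from the dispersion and from the iteration of
the nonlinearity.

The equation is solved for the profile `v(t) = e^{i t Λ} ψ̂(t)`, `Λ` being the symbol of `-½ Δ_η`:
the profile obeys an ordinary differential equation with vector field `field` in the space
`L¹ ∩ L²`, to which the Picard-Lindelöf theorem applies because this space is an algebra for the
convolution.  The same holds with a submultiplicative weight `w`; with `w(ζ) = e^{|ζ|/N}` the data
still have size `A`, whereas the solution has exponentially decaying Fourier transform and so
belongs to all Sobolev spaces.  Elements `F` of `L¹ ∩ L²` stand for `F / w` throughout, so that the
function space does not depend on `N`.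

The error from the dispersion looks as if it were of relative size `T N²`, because `Λ` is of size
`N²` at the frequencies of the data.  However, the nonlinearity commutes with multiplication by
`e^{i b}` for additive `b` (a translation in physical space), so that only `Λ` modulo additive
functions matters (`field_sub_additive`).  The rectangle is resonant: for
`b(ζ) = 2π² ∑ η_j p_j ζ_j` with `p = N (e₁ + e₂)`, the symbol `Λ - b = 2π² ∑ η_j ζ_j (ζ_j - p_j)`
vanishes at all four vertices and is of size `N` near them.  The relative errors are thus `T N` and
`T A^{2ν}` (`norm_localIntegral_profile_le`).

With `A = N^a` and `T = N^{-b}`, what is needed is `a + s < 0`, `(2ν + 1) a > b > 1` and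
`2ν a < b`.  Such exponents exist precisely because `s < -1/(2ν + 1)` (`exists_exponent`).

Uniqueness in `C([0,T]; L² ∩ L^∞)` (`IsSolution.unique`) follows from Grönwall's inequality: testing
the difference of two solutions against the free evolution of a test function removes the dispersive
term, and the nonlinearity is Lipschitz in `L²` on bounded subsets of `L^∞`.
-/

noncomputable section

set_option linter.unusedSectionVars false

open scoped Convolution ComplexConjugate

namespace NLS

section

variable {V : Type*} [NormedAddCommGroup V] [InnerProductSpace ℝ V] [FiniteDimensional ℝ V]
  [MeasurableSpace V] [BorelSpace V]

/-! ### The Banach space `L¹ ∩ L²` -/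

variable (V) in
/-- The space `L¹ ∩ L²`, realised as the closed subspace of `L¹ × L²` of the pairs whose two
components agree almost everywhere; its norm is `max ‖f‖₁ ‖f‖₂`. -/
def L1L2 : Submodule ℂ (Lp (α := V) ℂ 1 (volume : Measure V) × Lp (α := V) ℂ 2 (volume : Measure V))
    where
  carrier := {p | (p.1 : V → ℂ) =ᵐ[volume] (p.2 : V → ℂ)}
  add_mem' := by
    intro a b ha hb
    have h1 := Lp.coeFn_add a.1 b.1
    have h2 := Lp.coeFn_add a.2 b.2
    change ((a.1 + b.1 : Lp (α := V) ℂ 1 volume) : V → ℂ) =ᵐ[volume]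
      ((a.2 + b.2 : Lp (α := V) ℂ 2 volume) : V → ℂ)
    filter_upwards [h1, h2, ha, hb] with x e1 e2 e3 e4
    rw [e1, e2, Pi.add_apply, Pi.add_apply, e3, e4]
  zero_mem' := by
    change ((0 : Lp (α := V) ℂ 1 volume) : V → ℂ) =ᵐ[volume] ((0 : Lp (α := V) ℂ 2 volume) : V → ℂ)
    exact (Lp.coeFn_zero ..).trans (Lp.coeFn_zero ..).symm
  smul_mem' := by
    intro c a ha
    have h1 := Lp.coeFn_smul c a.1
    have h2 := Lp.coeFn_smul c a.2
    change ((c • a.1 : Lp (α := V) ℂ 1 volume) : V → ℂ) =ᵐ[volume]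
      ((c • a.2 : Lp (α := V) ℂ 2 volume) : V → ℂ)
    filter_upwards [h1, h2, ha] with x e1 e2 e3
    rw [e1, e2, Pi.smul_apply, Pi.smul_apply, e3]

namespace L1L2

theorem isClosed : IsClosed (L1L2 V : Set (Lp (α := V) ℂ 1 (volume : Measure V) ×
    Lp (α := V) ℂ 2 (volume : Measure V))) := by
  refine isClosed_of_closure_subset fun p hp => ?_
  obtain ⟨u, hu, hlim⟩ := mem_closure_iff_seq_limit.mp hp
  have h1 := tendstoInMeasure_of_tendsto_Lp ((continuous_fst.tendsto p).comp hlim)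
  have h2 := tendstoInMeasure_of_tendsto_Lp ((continuous_snd.tendsto p).comp hlim)
  refine tendstoInMeasure_ae_unique (h1.congr_left ?_) h2
  intro n
  exact hu n

instance : CompleteSpace (L1L2 V) := isClosed.completeSpace_coe

/-- The function underlying an element of `L¹ ∩ L²` is the representative of its `L¹` component. -/
instance : CoeFun (L1L2 V) (fun _ => V → ℂ) := ⟨fun F => (F.1.1 : V → ℂ)⟩

/-- The `L²` component of an element of `L¹ ∩ L²`. -/
def toL2 : L1L2 V →L[ℂ] Lp (α := V) ℂ 2 (volume : Measure V) :=
  (ContinuousLinearMap.snd ℂ _ _).comp (L1L2 V).subtypeL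

theorem coe_toL2 (F : L1L2 V) : (toL2 F : V → ℂ) =ᵐ[volume] F :=
  Filter.EventuallyEq.symm (show (F.1.1 : V → ℂ) =ᵐ[volume] (F.1.2 : V → ℂ) from F.2)

theorem memLp_one (F : L1L2 V) : MemLp F 1 volume := Lp.memLp F.1.1

theorem memLp_two (F : L1L2 V) : MemLp F 2 volume :=
  (Lp.memLp (toL2 F)).ae_eq (coe_toL2 F)

theorem integrable (F : L1L2 V) : Integrable F volume := memLp_one_iff_integrable.mp (memLp_one F)

theorem aesm (F : L1L2 V) : AEStronglyMeasurable F volume := (memLp_one F).1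

theorem norm_eq (F : L1L2 V) :
    ‖F‖ = max (eLpNorm F 1 volume).toReal (eLpNorm F 2 volume).toReal := by
  rw [← eLpNorm_congr_ae (p := 2) (coe_toL2 F)]
  rfl

theorem ext_ae {F G : L1L2 V} (h : (F : V → ℂ) =ᵐ[volume] G) : F = G := by
  apply Subtype.ext
  apply Prod.ext
  · exact Lp.ext h
  · exact Lp.ext (((coe_toL2 F).trans h).trans (coe_toL2 G).symm)

theorem coe_add (F G : L1L2 V) : ((F + G : L1L2 V) : V → ℂ) =ᵐ[volume] fun x => F x + G x :=
  Lp.coeFn_add F.1.1 G.1.1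

theorem coe_sub (F G : L1L2 V) : ((F - G : L1L2 V) : V → ℂ) =ᵐ[volume] fun x => F x - G x :=
  Lp.coeFn_sub F.1.1 G.1.1

theorem coe_smul (c : ℂ) (F : L1L2 V) : ((c • F : L1L2 V) : V → ℂ) =ᵐ[volume] fun x => c * F x :=
  Lp.coeFn_smul c F.1.1

/-- The element of `L¹ ∩ L²` represented by a function. -/
def ofFun (f : V → ℂ) (h1 : MemLp f 1 volume) (h2 : MemLp f 2 volume) : L1L2 V :=
  ⟨(h1.toLp f, h2.toLp f), h1.coeFn_toLp.trans h2.coeFn_toLp.symm⟩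

theorem coe_ofFun (f : V → ℂ) (h1 : MemLp f 1 volume) (h2 : MemLp f 2 volume) :
    (ofFun f h1 h2 : V → ℂ) =ᵐ[volume] f := h1.coeFn_toLp

theorem eLpNorm_one_le (F : L1L2 V) : eLpNorm F 1 volume ≤ ENNReal.ofReal ‖F‖ := by
  rw [norm_eq]
  nth_rw 1 [← ENNReal.ofReal_toReal (memLp_one F).2.ne]
  exact ENNReal.ofReal_le_ofReal (by simp)

theorem eLpNorm_two_le (F : L1L2 V) : eLpNorm F 2 volume ≤ ENNReal.ofReal ‖F‖ := by
  rw [norm_eq]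
  nth_rw 1 [← ENNReal.ofReal_toReal (memLp_two F).2.ne]
  exact ENNReal.ofReal_le_ofReal (by simp)

theorem norm_le_of_eLpNorm_le {F : L1L2 V} {C : ℝ} (hC : 0 ≤ C)
    (h1 : eLpNorm F 1 volume ≤ ENNReal.ofReal C) (h2 : eLpNorm F 2 volume ≤ ENNReal.ofReal C) :
    ‖F‖ ≤ C := by
  rw [norm_eq]
  exact max_le (ENNReal.toReal_le_of_le_ofReal hC h1) (ENNReal.toReal_le_of_le_ofReal hC h2)

theorem norm_le_of_ae_le {F G : L1L2 V} {c : ℝ} (hc : 0 ≤ c)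
    (h : ∀ᵐ x ∂volume, ‖F x‖ ≤ c * ‖G x‖) : ‖F‖ ≤ c * ‖G‖ := by
  have hp : ∀ p : ℝ≥0∞, eLpNorm F p volume ≤ ENNReal.ofReal c * eLpNorm G p volume := fun p =>
    eLpNorm_le_mul_eLpNorm_of_ae_le_mul h p
  refine norm_le_of_eLpNorm_le (by positivity) ?_ ?_ <;> rw [ENNReal.ofReal_mul hc]
  · exact (hp 1).trans (by gcongr; exact (eLpNorm_one_le G))
  · exact (hp 2).trans (by gcongr; exact (eLpNorm_two_le G))

theorem norm_eq_of_ae_eq {F G : L1L2 V} (h : ∀ᵐ x ∂volume, ‖F x‖ = ‖G x‖) : ‖F‖ = ‖G‖ := by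
  rw [norm_eq, norm_eq, eLpNorm_congr_norm_ae h, eLpNorm_congr_norm_ae h]

theorem integral_norm_le (F : L1L2 V) : ∫ x, ‖F x‖ ≤ ‖F‖ := by
  rw [integral_norm_eq_lintegral_enorm (aesm F)]
  refine ENNReal.toReal_le_of_le_ofReal (norm_nonneg _) ?_
  rw [← eLpNorm_one_eq_lintegral_enorm]
  exact (eLpNorm_one_le F)

variable (V) in
/-- Continuous real symbols `h`, which act through the unimodular functions `e^{i h}`.  The
abbreviation makes sure that the topology of `V` is the one of its norm. -/
abbrev _root_.NLS.Symbol : Type _ := C(V, ℝ)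

/-! ### Multiplication by phases, and the involution -/

theorem norm_phase (r : ℝ) : ‖Complex.exp (Complex.I * r)‖ = 1 := by
  rw [mul_comm]; exact Complex.norm_exp_ofReal_mul_I r

theorem aesm_phase (h : Symbol V) :
    AEStronglyMeasurable (fun x => Complex.exp (Complex.I * h x)) (volume : Measure V) := by
  have : Continuous fun x => Complex.exp (Complex.I * (h x : ℂ)) := by fun_prop
  exact this.aestronglyMeasurable

theorem memLp_phase_mul (h : Symbol V) {f : V → ℂ} {p : ℝ≥0∞} (hf : MemLp f p volume) :
    MemLp (fun x => Complex.exp (Complex.I * h x) * f x) p volume :=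
  hf.of_le ((aesm_phase h).mul hf.1) (Eventually.of_forall fun x => by
    rw [norm_mul, norm_phase, one_mul])

/-- Multiplication by the unimodular function `e^{i h}`. -/
def phase (h : Symbol V) (F : L1L2 V) : L1L2 V :=
  ofFun (fun x => Complex.exp (Complex.I * h x) * F x) (memLp_phase_mul h (memLp_one F))
    (memLp_phase_mul h (memLp_two F))

theorem coe_phase (h : Symbol V) (F : L1L2 V) :
    (phase h F : V → ℂ) =ᵐ[volume] fun x => Complex.exp (Complex.I * h x) * F x := coe_ofFun ..

@[simp]
theorem norm_phase_apply (h : Symbol V) (F : L1L2 V) : ‖phase h F‖ = ‖F‖ := by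
  apply norm_eq_of_ae_eq
  filter_upwards [coe_phase h F] with x hx
  rw [hx, norm_mul, norm_phase, one_mul]

theorem phase_sub (h : Symbol V) (F G : L1L2 V) : phase h (F - G) = phase h F - phase h G := by
  apply ext_ae
  filter_upwards [coe_phase h (F - G), coe_phase h F, coe_phase h G, coe_sub F G,
    coe_sub (phase h F) (phase h G)] with x e1 e2 e3 e4 e5
  rw [e1, e4, e5, e2, e3, mul_sub]

theorem phase_smul (h : Symbol V) (c : ℂ) (F : L1L2 V) : phase h (c • F) = c • phase h F := by
  apply ext_ae
  filter_upwards [coe_phase h (c • F), coe_phase h F, coe_smul c F, coe_smul c (phase h F)]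
    with x e1 e2 e3 e4
  rw [e1, e3, e4, e2, mul_left_comm]

theorem phase_phase (h k : Symbol V) (F : L1L2 V) : phase h (phase k F) = phase (h + k) F := by
  apply ext_ae
  filter_upwards [coe_phase h (phase k F), coe_phase k F, coe_phase (h + k) F] with x e1 e2 e3
  rw [e1, e2, e3, ← mul_assoc, ← Complex.exp_add]
  congr 2
  simp [mul_add]

@[simp]
theorem phase_zero (F : L1L2 V) : phase 0 F = F := by
  apply ext_ae
  filter_upwards [coe_phase 0 F] with x e1
  simp [e1]

theorem dist_phase_phase (h : Symbol V) (F G : L1L2 V) :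
    dist (phase h F) (phase h G) = dist F G := by
  rw [dist_eq_norm, dist_eq_norm, ← phase_sub, norm_phase_apply]

/-- Dominated convergence for bounded multipliers that tend to `0` pointwise. -/
theorem tendsto_eLpNorm_mul_zero {ι : Type*} {l : Filter ι} [l.IsCountablyGenerated]
    {p : ℝ≥0∞} (hp0 : p ≠ 0) (hpt : p ≠ ∞) {f : V → ℂ} (hf : MemLp f p volume) {m : ι → V → ℂ}
    (hm : ∀ t, AEStronglyMeasurable (m t) volume) {C : ℝ} (hb : ∀ t x, ‖m t x‖ ≤ C)
    (hlim : ∀ x, Tendsto (fun t => m t x) l (𝓝 0)) :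
    Tendsto (fun t => eLpNorm (fun x => m t x * f x) p volume) l (𝓝 0) := by
  have hp : 0 < p.toReal := ENNReal.toReal_pos hp0 hpt
  simp_rw [eLpNorm_eq_lintegral_rpow_enorm_toReal hp0 hpt]
  have key : Tendsto (fun t => ∫⁻ x, ‖m t x * f x‖ₑ ^ p.toReal) l (𝓝 (∫⁻ _ : V, 0)) := by
    refine tendsto_lintegral_filter_of_dominated_convergence'
      (fun x => ENNReal.ofReal C ^ p.toReal * ‖f x‖ₑ ^ p.toReal) ?_ ?_ ?_ ?_
    · exact Eventually.of_forall fun t => ((hm t).mul hf.1).enorm.pow_const _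
    · refine Eventually.of_forall fun t => Eventually.of_forall fun x => ?_
      rw [← ENNReal.mul_rpow_of_nonneg _ _ hp.le]
      gcongr
      rw [enorm_mul]
      gcongr
      rw [← ofReal_norm]
      exact ENNReal.ofReal_le_ofReal (hb t x)
    · rw [lintegral_const_mul'' _ (hf.1.enorm.pow_const _)]
      refine (ENNReal.mul_lt_top ?_ ?_).ne
      · exact ENNReal.rpow_lt_top_of_nonneg hp.le ENNReal.ofReal_ne_top
      · exact lintegral_rpow_enorm_lt_top_of_eLpNorm_lt_top hp0 hpt hf.2
    · refine Eventually.of_forall fun x => ?_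
      have h1 : Tendsto (fun t => ‖m t x * f x‖ₑ) l (𝓝 0) := by
        have h2 : Tendsto (fun t => m t x * f x) l (𝓝 0) := by
          simpa using (hlim x).mul_const (f x)
        simpa using h2.enorm
      have := (ENNReal.continuous_rpow_const (y := p.toReal)).tendsto 0 |>.comp h1
      rwa [ENNReal.zero_rpow_of_pos hp] at this
  rw [lintegral_zero] at key
  have := (ENNReal.continuous_rpow_const (y := 1 / p.toReal)).tendsto 0 |>.comp key
  rwa [ENNReal.zero_rpow_of_pos (by positivity)] at this

theorem tendsto_zero_of_eLpNorm {ι : Type*} {l : Filter ι} {u : ι → L1L2 V}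
    (h1 : Tendsto (fun t => eLpNorm (u t) 1 volume) l (𝓝 0))
    (h2 : Tendsto (fun t => eLpNorm (u t) 2 volume) l (𝓝 0)) : Tendsto u l (𝓝 0) := by
  rw [tendsto_zero_iff_norm_tendsto_zero]
  simp_rw [norm_eq]
  have a1 := (ENNReal.tendsto_toReal ENNReal.zero_ne_top).comp h1
  have a2 := (ENNReal.tendsto_toReal ENNReal.zero_ne_top).comp h2
  simpa using a1.max a2

/-- The unitary group `t ↦ e^{i t h}` is strongly continuous on `L¹ ∩ L²`. -/
theorem continuous_phase_smul (h : Symbol V) (F : L1L2 V) :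
    Continuous fun t : ℝ => phase (t • h) F := by
  rw [continuous_iff_continuousAt]
  intro t₀
  rw [ContinuousAt, tendsto_iff_norm_sub_tendsto_zero, ← tendsto_zero_iff_norm_tendsto_zero]
  have hae : ∀ t : ℝ, ((phase (t • h) F - phase (t₀ • h) F : L1L2 V) : V → ℂ) =ᵐ[volume] fun x =>
      (Complex.exp (Complex.I * (t • h) x) - Complex.exp (Complex.I * (t₀ • h) x)) * F x := by
    intro t
    filter_upwards [coe_phase (t • h) F, coe_phase (t₀ • h) F,
      coe_sub (phase (t • h) F) (phase (t₀ • h) F)] with x e1 e2 e3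
    rw [e3, e1, e2, sub_mul]
  have hb : ∀ (t : ℝ) (x : V),
      ‖Complex.exp (Complex.I * (t • h) x) - Complex.exp (Complex.I * (t₀ • h) x)‖ ≤ 2 := by
    intro t x
    refine (norm_sub_le _ _).trans ?_
    rw [norm_phase, norm_phase]; norm_num
  have hlim : ∀ x, Tendsto (fun t : ℝ =>
      Complex.exp (Complex.I * (t • h) x) - Complex.exp (Complex.I * (t₀ • h) x)) (𝓝 t₀) (𝓝 0) := by
    intro x
    have : Continuous fun t : ℝ =>
        Complex.exp (Complex.I * ((t * h x : ℝ) : ℂ)) - Complex.exp (Complex.I * (t₀ • h) x) := by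
      fun_prop
    simpa using this.tendsto t₀
  refine tendsto_zero_of_eLpNorm ?_ ?_
  · simp_rw [eLpNorm_congr_ae (hae _)]
    exact tendsto_eLpNorm_mul_zero (by norm_num) (by norm_num) (memLp_one F)
      (fun t => (aesm_phase _).sub (aesm_phase _)) hb hlim
  · simp_rw [eLpNorm_congr_ae (hae _)]
    exact tendsto_eLpNorm_mul_zero (by norm_num) (by norm_num) (memLp_two F)
      (fun t => (aesm_phase _).sub (aesm_phase _)) hb hlim

theorem memLp_reflect {f : V → ℂ} {p : ℝ≥0∞} (hf : MemLp f p volume) :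
    MemLp (fun x => starRingEnd ℂ (f (-x))) p volume :=
  (hf.comp_measurePreserving (Measure.measurePreserving_neg volume)).star

/-- The involution `F ↦ conj F(-·)`, which is complex conjugation on the physical side. -/
def reflect (F : L1L2 V) : L1L2 V :=
  ofFun (fun x => starRingEnd ℂ (F (-x))) (memLp_reflect (memLp_one F)) (memLp_reflect (memLp_two F))

theorem coe_reflect (F : L1L2 V) :
    (reflect F : V → ℂ) =ᵐ[volume] fun x => starRingEnd ℂ (F (-x)) := coe_ofFun ..

theorem ae_neg {P : V → Prop} (h : ∀ᵐ x ∂(volume : Measure V), P x) :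
    ∀ᵐ x ∂(volume : Measure V), P (-x) :=
  (Measure.measurePreserving_neg (volume : Measure V)).quasiMeasurePreserving.ae h

@[simp]
theorem norm_reflect (F : L1L2 V) : ‖reflect F‖ = ‖F‖ := by
  have hp : ∀ p : ℝ≥0∞, eLpNorm (reflect F) p volume = eLpNorm F p volume := by
    intro p
    rw [eLpNorm_congr_ae (coe_reflect F)]
    have := eLpNorm_comp_measurePreserving (p := p) (aesm F) (Measure.measurePreserving_neg volume)
    rw [← this]
    exact eLpNorm_congr_norm_ae (Eventually.of_forall fun x => by simp)
  rw [norm_eq, norm_eq, hp, hp]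

theorem reflect_sub (F G : L1L2 V) : reflect (F - G) = reflect F - reflect G := by
  apply ext_ae
  filter_upwards [coe_reflect (F - G), coe_reflect F, coe_reflect G, ae_neg (coe_sub F G),
    coe_sub (reflect F) (reflect G)] with x e1 e2 e3 e4 e5
  rw [e1, e4, e5, e2, e3, map_sub]

/-- An odd phase commutes with the involution. -/
theorem reflect_phase {h : Symbol V} (hh : ∀ x, h (-x) = -h x) (F : L1L2 V) :
    reflect (phase h F) = phase h (reflect F) := by
  apply ext_ae
  filter_upwards [coe_reflect (phase h F), coe_reflect F, coe_phase h (reflect F),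
    ae_neg (coe_phase h F)] with x e1 e2 e3 e4
  rw [e1, e4, e3, e2, map_mul, ← Complex.exp_conj, hh]
  simp

end L1L2

end

section

variable {V : Type*} [NormedAddCommGroup V] [InnerProductSpace ℝ V] [FiniteDimensional ℝ V]
  [MeasurableSpace V] [BorelSpace V]

/-! ### Young's inequality for the convolution -/

/-- The convolution `∫ f(t) g(x - t) dt` of complex functions. -/
def cconv (f g : V → ℂ) : V → ℂ := f ⋆[ContinuousLinearMap.mul ℂ ℂ, volume] g

theorem cconv_apply (f g : V → ℂ) (x : V) : cconv f g x = ∫ t, f t * g (x - t) := rfl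

theorem cconv_congr {f f' g g' : V → ℂ} (h1 : f =ᵐ[volume] f') (h2 : g =ᵐ[volume] g') :
    cconv f g = cconv f' g' := convolution_congr _ h1 h2

theorem integrable_cconv {f g : V → ℂ} (hf : Integrable f) (hg : Integrable g) :
    Integrable (cconv f g) := hf.integrable_convolution _ hg

theorem ae_integrable_cconv {f g : V → ℂ} (hf : Integrable f) (hg : Integrable g) :
    ∀ᵐ x : V, Integrable fun t => f t * g (x - t) :=
  hf.ae_convolution_exists (ContinuousLinearMap.mul ℂ ℂ) hg

theorem aemeasurable_comp_sub {b : V → ℝ≥0∞} (hb : AEMeasurable b volume) (x : V) :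
    AEMeasurable (fun t => b (x - t)) volume :=
  hb.comp_quasiMeasurePreserving (quasiMeasurePreserving_sub_left_of_right_invariant volume x)

theorem lintegral_lintegral_mul_sub {a b : V → ℝ≥0∞} (ha : AEMeasurable a volume)
    (hb : AEMeasurable b volume) :
    ∫⁻ x : V, ∫⁻ t, a t * b (x - t) = (∫⁻ t, a t) * ∫⁻ t, b t := by
  rw [lintegral_lintegral_swap]
  · have : ∀ t : V, ∫⁻ x : V, a t * b (x - t) = a t * ∫⁻ x, b x := by
      intro t
      rw [lintegral_const_mul'']
      · rw [lintegral_sub_right_eq_self b t]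
      · exact hb.comp_quasiMeasurePreserving
          (measurePreserving_sub_right volume t).quasiMeasurePreserving
    simp_rw [this]
    rw [lintegral_mul_const'' _ ha]
  · refine (ha.comp_quasiMeasurePreserving Measure.quasiMeasurePreserving_snd).mul ?_
    exact hb.comp_quasiMeasurePreserving
      (quasiMeasurePreserving_sub_of_right_invariant volume volume)

/-- The Cauchy-Schwarz inequality for the measure with density `a`. -/
theorem sq_lintegral_mul_le {a b : V → ℝ≥0∞} (ha : AEMeasurable a volume)
    (hb : AEMeasurable b volume) :
    (∫⁻ t, a t * b t) ^ 2 ≤ (∫⁻ t, a t) * ∫⁻ t, a t * b t ^ 2 := by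
  have key := ENNReal.lintegral_mul_le_Lp_mul_Lq (volume : Measure V) Real.HolderConjugate.two_two
    (f := fun t => a t ^ (1 / 2 : ℝ)) (g := fun t => a t ^ (1 / 2 : ℝ) * b t)
    (ha.pow_const _) ((ha.pow_const _).mul hb)
  have e0 : ∀ c : ℝ≥0∞, c ^ (1 / 2 : ℝ) * c ^ (1 / 2 : ℝ) = c := by
    intro c
    rw [← ENNReal.rpow_add_of_nonneg _ _ (by norm_num) (by norm_num)]
    norm_num
  have e2 : ∀ c : ℝ≥0∞, (c ^ (1 / 2 : ℝ)) ^ (2 : ℝ) = c := by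
    intro c
    rw [← ENNReal.rpow_mul]; norm_num
  have e1 : ∀ t, ((fun t => a t ^ (1 / 2 : ℝ)) * (fun t => a t ^ (1 / 2 : ℝ) * b t)) t
      = a t * b t := by
    intro t
    rw [Pi.mul_apply, ← mul_assoc, e0]
  have e3 : ∀ t, (a t ^ (1 / 2 : ℝ) * b t) ^ (2 : ℝ) = a t * b t ^ 2 := by
    intro t
    rw [ENNReal.mul_rpow_of_nonneg _ _ (by norm_num), e2, ENNReal.rpow_two]
  simp_rw [e1, e2, e3] at key
  calc (∫⁻ t, a t * b t) ^ 2
      ≤ ((∫⁻ t, a t) ^ (1 / 2 : ℝ) * (∫⁻ t, a t * b t ^ 2) ^ (1 / 2 : ℝ)) ^ 2 := by gcongr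
    _ = _ := by rw [mul_pow, ← ENNReal.rpow_two, ← ENNReal.rpow_two, e2, e2]

/-- Young's inequality `L¹ * L² ⊆ L²`. -/
theorem lintegral_sq_lintegral_mul_sub_le {a b : V → ℝ≥0∞} (ha : AEMeasurable a volume)
    (hb : AEMeasurable b volume) :
    ∫⁻ x : V, (∫⁻ t, a t * b (x - t)) ^ 2 ≤ (∫⁻ t, a t) ^ 2 * ∫⁻ t, b t ^ 2 := by
  calc ∫⁻ x : V, (∫⁻ t, a t * b (x - t)) ^ 2
      ≤ ∫⁻ x : V, (∫⁻ t, a t) * ∫⁻ t, a t * b (x - t) ^ 2 :=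
        lintegral_mono fun x => sq_lintegral_mul_le ha (aemeasurable_comp_sub hb x)
    _ = (∫⁻ t, a t) * ∫⁻ x : V, ∫⁻ t, a t * b (x - t) ^ 2 := by
        rw [lintegral_const_mul'']
        refine AEMeasurable.lintegral_prod_right' (f := fun p : V × V => a p.2 * b (p.1 - p.2) ^ 2) ?_
        refine (ha.comp_quasiMeasurePreserving Measure.quasiMeasurePreserving_snd).mul ?_
        exact ((hb.comp_quasiMeasurePreserving
          (quasiMeasurePreserving_sub_of_right_invariant volume volume)).pow_const 2)
    _ = _ := by
        rw [lintegral_lintegral_mul_sub ha (hb.pow_const 2), sq, mul_assoc]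

/-! ### The weighted convolution algebra -/

variable (V) in
/-- An even submultiplicative weight, bounded below by `1`. -/
structure Weight where
  /-- The weight function. -/
  toFun : V → ℝ
  continuous' : Continuous toFun
  one_le : ∀ x, 1 ≤ toFun x
  add_le : ∀ x y, toFun (x + y) ≤ toFun x * toFun y
  neg : ∀ x, toFun (-x) = toFun x

namespace Weight

instance : CoeFun (Weight V) (fun _ => V → ℝ) := ⟨Weight.toFun⟩

theorem pos (w : Weight V) (x : V) : 0 < w x := one_pos.trans_le (w.one_le x)

theorem cont (w : Weight V) : Continuous w := w.continuous'

/-- Removal of the weight: an element `F` of `L¹ ∩ L²` stands for the function `F / w`, so that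
the norm of `F` is the weighted norm of `F / w`. -/
def base (w : Weight V) (F : V → ℂ) : V → ℂ := fun x => ((w x)⁻¹ : ℝ) * F x

theorem cont_inv (w : Weight V) : Continuous fun x => (((w x)⁻¹ : ℝ) : ℂ) :=
  Complex.continuous_ofReal.comp (w.cont.inv₀ fun x => (w.pos x).ne')

theorem norm_inv_le (w : Weight V) (x : V) : ‖(((w x)⁻¹ : ℝ) : ℂ)‖ ≤ 1 := by
  rw [Complex.norm_real, Real.norm_of_nonneg (inv_nonneg.mpr (w.pos x).le)]
  exact inv_le_one_of_one_le₀ (w.one_le x)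

theorem norm_base_le (w : Weight V) (F : V → ℂ) (x : V) : ‖w.base F x‖ ≤ ‖F x‖ := by
  rw [base, norm_mul]
  exact mul_le_of_le_one_left (norm_nonneg _) (w.norm_inv_le x)

theorem memLp_base (w : Weight V) {F : V → ℂ} {p : ℝ≥0∞} (hF : MemLp F p volume) :
    MemLp (w.base F) p volume :=
  hF.of_le (w.cont_inv.aestronglyMeasurable.mul hF.1) (Eventually.of_forall fun x =>
    w.norm_base_le F x)

theorem integrable_base (w : Weight V) (F : L1L2 V) : Integrable (w.base F) :=
  memLp_one_iff_integrable.mp (w.memLp_base (L1L2.memLp_one F))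

theorem base_congr (w : Weight V) {F G : V → ℂ} (h : F =ᵐ[volume] G) :
    w.base F =ᵐ[volume] w.base G := by
  filter_upwards [h] with x hx
  rw [base, base, hx]

theorem base_mul (w : Weight V) (f : V → ℂ) : w.base (fun x => (w x : ℂ) * f x) = f := by
  funext x
  rw [base, ← mul_assoc, ← Complex.ofReal_mul, inv_mul_cancel₀ (w.pos x).ne']
  simp

/-- The convolution conjugated by the weight, `w ((F / w) ⋆ (G / w))`. -/
def convFun (w : Weight V) (F G : V → ℂ) : V → ℂ :=
  fun x => (w x : ℂ) * cconv (w.base F) (w.base G) x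

/-- Submultiplicativity of the weight: the conjugated convolution is dominated by the convolution of
the moduli. -/
theorem enorm_convFun_le (w : Weight V) (F G : V → ℂ) (x : V) :
    ‖w.convFun F G x‖ₑ ≤ ∫⁻ t, ‖F t‖ₑ * ‖G (x - t)‖ₑ := by
  rw [convFun, cconv_apply, ← integral_const_mul]
  refine (enorm_integral_le_lintegral_enorm _).trans (lintegral_mono fun t => ?_)
  rw [← enorm_mul, enorm_le_iff_norm_le]
  have h1 := w.pos t
  have h2 := w.pos (x - t)
  have h3 : w x ≤ w t * w (x - t) := by simpa using w.add_le t (x - t)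
  rw [base, base, norm_mul, norm_mul, norm_mul, norm_mul, norm_mul, Complex.norm_real,
    Complex.norm_real, Complex.norm_real, Real.norm_of_nonneg (w.pos x).le,
    Real.norm_of_nonneg (inv_nonneg.mpr h1.le), Real.norm_of_nonneg (inv_nonneg.mpr h2.le)]
  calc w x * ((w t)⁻¹ * ‖F t‖ * ((w (x - t))⁻¹ * ‖G (x - t)‖))
      = (w x * (w t * w (x - t))⁻¹) * (‖F t‖ * ‖G (x - t)‖) := by
        rw [mul_inv]; ring
    _ ≤ 1 * (‖F t‖ * ‖G (x - t)‖) := by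
        gcongr
        rw [← div_eq_mul_inv]
        exact (div_le_one (by positivity)).mpr h3
    _ = _ := one_mul _

theorem aesm_convFun (w : Weight V) {F G : V → ℂ} (hF : MemLp F 1 volume) (hG : MemLp G 1 volume) :
    AEStronglyMeasurable (w.convFun F G) volume := by
  refine AEStronglyMeasurable.mul ?_ (integrable_cconv
    (memLp_one_iff_integrable.mp (w.memLp_base hF)) (memLp_one_iff_integrable.mp (w.memLp_base hG))).1
  exact (Complex.continuous_ofReal.comp w.cont).aestronglyMeasurable

theorem eLpNorm_one_convFun_le (w : Weight V) {F G : V → ℂ} (hF : MemLp F 1 volume)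
    (hG : MemLp G 1 volume) :
    eLpNorm (w.convFun F G) 1 volume ≤ eLpNorm F 1 volume * eLpNorm G 1 volume := by
  rw [eLpNorm_one_eq_lintegral_enorm, eLpNorm_one_eq_lintegral_enorm,
    eLpNorm_one_eq_lintegral_enorm, ← lintegral_lintegral_mul_sub hF.1.enorm hG.1.enorm]
  exact lintegral_mono fun x => w.enorm_convFun_le F G x

theorem eLpNorm_two_sq (f : V → ℂ) : eLpNorm f 2 volume ^ 2 = ∫⁻ x, ‖f x‖ₑ ^ 2 := by
  rw [eLpNorm_eq_lintegral_rpow_enorm_toReal (by norm_num) (by norm_num), ← ENNReal.rpow_two,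
    ← ENNReal.rpow_mul]
  norm_num

theorem eLpNorm_two_convFun_le (w : Weight V) {F G : V → ℂ} (hF : MemLp F 1 volume)
    (hG : MemLp G 2 volume) :
    eLpNorm (w.convFun F G) 2 volume ≤ eLpNorm F 1 volume * eLpNorm G 2 volume := by
  rw [← ENNReal.pow_le_pow_left_iff (n := 2) (by norm_num), mul_pow, eLpNorm_two_sq, eLpNorm_two_sq,
    eLpNorm_one_eq_lintegral_enorm]
  refine le_trans (lintegral_mono fun x => ?_)
    (lintegral_sq_lintegral_mul_sub_le hF.1.enorm hG.1.enorm)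
  gcongr
  exact w.enorm_convFun_le F G x

/-- The conjugated convolution as a product on `L¹ ∩ L²`. -/
def conv (w : Weight V) (F G : L1L2 V) : L1L2 V :=
  L1L2.ofFun (w.convFun F G)
    ⟨w.aesm_convFun (L1L2.memLp_one F) (L1L2.memLp_one G),
      (w.eLpNorm_one_convFun_le (L1L2.memLp_one F) (L1L2.memLp_one G)).trans_lt
        (ENNReal.mul_lt_top (L1L2.memLp_one F).2 (L1L2.memLp_one G).2)⟩
    ⟨w.aesm_convFun (L1L2.memLp_one F) (L1L2.memLp_one G),
      (w.eLpNorm_two_convFun_le (L1L2.memLp_one F) (L1L2.memLp_two G)).trans_lt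
        (ENNReal.mul_lt_top (L1L2.memLp_one F).2 (L1L2.memLp_two G).2)⟩

theorem coe_conv (w : Weight V) (F G : L1L2 V) :
    (w.conv F G : V → ℂ) =ᵐ[volume] w.convFun F G := L1L2.coe_ofFun ..

theorem base_conv (w : Weight V) (F G : L1L2 V) :
    w.base (w.conv F G) =ᵐ[volume] cconv (w.base F) (w.base G) := by
  refine (w.base_congr (w.coe_conv F G)).trans ?_
  unfold convFun
  rw [base_mul]

theorem norm_conv_le (w : Weight V) (F G : L1L2 V) : ‖w.conv F G‖ ≤ ‖F‖ * ‖G‖ := by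
  refine L1L2.norm_le_of_eLpNorm_le (by positivity) ?_ ?_ <;>
    rw [eLpNorm_congr_ae (w.coe_conv F G), ENNReal.ofReal_mul (norm_nonneg _)]
  · exact (w.eLpNorm_one_convFun_le (L1L2.memLp_one F) (L1L2.memLp_one G)).trans
      (mul_le_mul' (L1L2.eLpNorm_one_le F) (L1L2.eLpNorm_one_le G))
  · exact (w.eLpNorm_two_convFun_le (L1L2.memLp_one F) (L1L2.memLp_two G)).trans
      (mul_le_mul' (L1L2.eLpNorm_one_le F) (L1L2.eLpNorm_two_le G))

theorem conv_sub_left (w : Weight V) (F F' G : L1L2 V) :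
    w.conv (F - F') G = w.conv F G - w.conv F' G := by
  apply L1L2.ext_ae
  filter_upwards [w.coe_conv (F - F') G, w.coe_conv F G, w.coe_conv F' G,
    L1L2.coe_sub (w.conv F G) (w.conv F' G),
    ae_integrable_cconv (w.integrable_base F) (w.integrable_base G),
    ae_integrable_cconv (w.integrable_base F') (w.integrable_base G)] with x e1 e2 e3 e4 i1 i2
  rw [e1, e4, e2, e3]
  simp only [convFun]
  rw [cconv_congr (w.base_congr (L1L2.coe_sub F F')) EventuallyEq.rfl, ← mul_sub, cconv_apply,
    cconv_apply, cconv_apply, ← integral_sub i1 i2]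
  congr 2
  funext t
  simp only [base]
  ring

theorem conv_sub_right (w : Weight V) (F G G' : L1L2 V) :
    w.conv F (G - G') = w.conv F G - w.conv F G' := by
  apply L1L2.ext_ae
  filter_upwards [w.coe_conv F (G - G'), w.coe_conv F G, w.coe_conv F G',
    L1L2.coe_sub (w.conv F G) (w.conv F G'),
    ae_integrable_cconv (w.integrable_base F) (w.integrable_base G),
    ae_integrable_cconv (w.integrable_base F) (w.integrable_base G')] with x e1 e2 e3 e4 i1 i2
  rw [e1, e4, e2, e3]
  simp only [convFun]
  rw [cconv_congr EventuallyEq.rfl (w.base_congr (L1L2.coe_sub G G')), ← mul_sub, cconv_apply,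
    cconv_apply, cconv_apply, ← integral_sub i1 i2]
  congr 2
  funext t
  simp only [base]
  ring

theorem base_phase (w : Weight V) (h : Symbol V) (F : L1L2 V) :
    w.base (L1L2.phase h F) =ᵐ[volume] fun x => Complex.exp (Complex.I * h x) * w.base F x := by
  refine (w.base_congr (L1L2.coe_phase h F)).trans (Eventually.of_forall fun x => ?_)
  simp only [base]
  ring

/-- An additive phase is a character, and so commutes with the convolution. -/
theorem conv_phase (w : Weight V) {h : Symbol V} (hh : ∀ x y, h (x + y) = h x + h y)
    (F G : L1L2 V) :
    w.conv (L1L2.phase h F) (L1L2.phase h G) = L1L2.phase h (w.conv F G) := by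
  apply L1L2.ext_ae
  filter_upwards [w.coe_conv (L1L2.phase h F) (L1L2.phase h G), w.coe_conv F G,
    L1L2.coe_phase h (w.conv F G)] with x e1 e2 e3
  rw [e1, e3, e2]
  simp only [convFun]
  rw [cconv_congr (w.base_phase h F) (w.base_phase h G), cconv_apply, cconv_apply, mul_left_comm,
    ← integral_const_mul (Complex.exp (Complex.I * h x))]
  congr 2
  funext t
  have : h x = h t + h (x - t) := by rw [← hh]; simp
  rw [this, Complex.ofReal_add, mul_add, Complex.exp_add]
  ring

end Weight

/-! ### The power nonlinearity on the Fourier side -/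

/-- The function `conj f(-·)`. -/
def conjNeg (f : V → ℂ) : V → ℂ := fun x => conj (f (-x))

/-- The Fourier side of `u ↦ |u|^(2k) u`: products become convolutions, and complex conjugation
becomes `conjNeg`. -/
def powFun : ℕ → (V → ℂ) → V → ℂ
  | 0, f => f
  | k + 1, f => cconv (cconv f (conjNeg f)) (powFun k f)

theorem integrable_conjNeg {f : V → ℂ} (hf : Integrable f) : Integrable (conjNeg f) :=
  memLp_one_iff_integrable.mp (L1L2.memLp_reflect (memLp_one_iff_integrable.mpr hf))

theorem integrable_powFun {f : V → ℂ} (hf : Integrable f) (k : ℕ) : Integrable (powFun k f) := by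
  induction k with
  | zero => exact hf
  | succ k ih => exact integrable_cconv (integrable_cconv hf (integrable_conjNeg hf)) ih

namespace Weight

/-- The operator `powFun` conjugated by the weight, acting on `L¹ ∩ L²`. -/
def pow (w : Weight V) : ℕ → L1L2 V → L1L2 V
  | 0, F => F
  | k + 1, F => w.conv (w.conv F (L1L2.reflect F)) (w.pow k F)

theorem base_reflect (w : Weight V) (F : L1L2 V) :
    w.base (L1L2.reflect F) =ᵐ[volume] conjNeg (w.base F) := by
  refine (w.base_congr (L1L2.coe_reflect F)).trans (Eventually.of_forall fun x => ?_)
  simp only [base, conjNeg, w.neg, map_mul, Complex.conj_ofReal]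

theorem base_pow (w : Weight V) (k : ℕ) (F : L1L2 V) :
    w.base (w.pow k F) =ᵐ[volume] powFun k (w.base F) := by
  induction k with
  | zero => exact EventuallyEq.rfl
  | succ k ih =>
    refine (w.base_conv _ _).trans (Eventually.of_forall fun x => ?_)
    rw [powFun, cconv_congr (w.base_conv _ _) ih,
      cconv_congr (f := w.base F) EventuallyEq.rfl (w.base_reflect F)]

theorem norm_pow_le (w : Weight V) (k : ℕ) (F : L1L2 V) : ‖w.pow k F‖ ≤ ‖F‖ ^ (2 * k + 1) := by
  induction k with
  | zero => simp [pow]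
  | succ k ih =>
    calc ‖w.pow (k + 1) F‖ ≤ ‖w.conv F (L1L2.reflect F)‖ * ‖w.pow k F‖ := w.norm_conv_le _ _
      _ ≤ (‖F‖ * ‖F‖) * ‖F‖ ^ (2 * k + 1) := by
        gcongr
        exact (w.norm_conv_le _ _).trans_eq (by rw [L1L2.norm_reflect])
      _ = _ := by ring

theorem norm_pow_sub_pow_le (w : Weight V) (k : ℕ) {R : ℝ} {F G : L1L2 V} (hF : ‖F‖ ≤ R)
    (hG : ‖G‖ ≤ R) : ‖w.pow k F - w.pow k G‖ ≤ (2 * k + 1) * R ^ (2 * k) * ‖F - G‖ := by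
  have hR : 0 ≤ R := (norm_nonneg _).trans hF
  induction k with
  | zero => simp [pow]
  | succ k ih =>
    have hQ : ‖w.conv F (L1L2.reflect F) - w.conv G (L1L2.reflect G)‖ ≤ 2 * R * ‖F - G‖ := by
      have : w.conv F (L1L2.reflect F) - w.conv G (L1L2.reflect G)
          = w.conv (F - G) (L1L2.reflect F) + w.conv G (L1L2.reflect (F - G)) := by
        rw [L1L2.reflect_sub, w.conv_sub_left, w.conv_sub_right]; abel
      rw [this]
      calc _ ≤ ‖w.conv (F - G) (L1L2.reflect F)‖ + ‖w.conv G (L1L2.reflect (F - G))‖ :=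
            norm_add_le _ _
        _ ≤ ‖F - G‖ * R + R * ‖F - G‖ := by
            gcongr
            · exact (w.norm_conv_le _ _).trans (by rw [L1L2.norm_reflect]; gcongr)
            · exact (w.norm_conv_le _ _).trans (by rw [L1L2.norm_reflect]; gcongr)
        _ = _ := by ring
    have hG2 : ‖w.conv G (L1L2.reflect G)‖ ≤ R * R :=
      (w.norm_conv_le _ _).trans (by rw [L1L2.norm_reflect]; gcongr)
    have hP : ‖w.pow k F‖ ≤ R ^ (2 * k + 1) := (w.norm_pow_le k F).trans (by gcongr)
    have : w.pow (k + 1) F - w.pow (k + 1) G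
        = w.conv (w.conv F (L1L2.reflect F) - w.conv G (L1L2.reflect G)) (w.pow k F)
          + w.conv (w.conv G (L1L2.reflect G)) (w.pow k F - w.pow k G) := by
      rw [w.conv_sub_left, w.conv_sub_right, pow, pow]; abel
    rw [this]
    calc _ ≤ _ := norm_add_le _ _
      _ ≤ (2 * R * ‖F - G‖) * R ^ (2 * k + 1)
          + (R * R) * ((2 * k + 1) * R ^ (2 * k) * ‖F - G‖) := by
        gcongr
        · exact (w.norm_conv_le _ _).trans (by gcongr)
        · exact (w.norm_conv_le _ _).trans (by gcongr)
      _ = _ := by push_cast; ring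

/-- Gauge by a character (a translation on the physical side) commutes with the nonlinearity. -/
theorem pow_phase (w : Weight V) {h : Symbol V} (hh : ∀ x y, h (x + y) = h x + h y) (k : ℕ)
    (F : L1L2 V) : w.pow k (L1L2.phase h F) = L1L2.phase h (w.pow k F) := by
  have hodd : ∀ x, h (-x) = -h x := by
    intro x
    have h0 : h 0 = 0 := by simpa using hh 0 0
    have := hh x (-x)
    rw [add_neg_cancel, h0] at this
    linarith
  induction k with
  | zero => rfl
  | succ k ih =>
    rw [pow, pow, ih, L1L2.reflect_phase hodd, w.conv_phase hh, w.conv_phase hh]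

end Weight

/-! ### The physical side of the nonlinearity -/

theorem fourierInv_cconv {f g : V → ℂ} (hf : Integrable f) (hg : Integrable g) (x : V) :
    𝓕⁻ (cconv f g) x = 𝓕⁻ f x * 𝓕⁻ g x := by
  rw [Real.fourierInv_eq_fourier_neg, Real.fourierInv_eq_fourier_neg,
    Real.fourierInv_eq_fourier_neg]
  exact Real.fourier_mul_convolution_eq hf hg (-x)

theorem fourierInv_conjNeg (f : V → ℂ) (x : V) : 𝓕⁻ (conjNeg f) x = conj (𝓕⁻ f x) := by
  rw [Real.fourierInv_eq', Real.fourierInv_eq', ← integral_conj, ← integral_neg_eq_self]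
  congr 1
  funext v
  simp only [conjNeg, neg_neg, smul_eq_mul, map_mul, ← Complex.exp_conj]
  congr 2
  simp [map_ofNat]

/-- `powFun k` is the nonlinearity `u ↦ |u|^(2k) u` on the Fourier side. -/
theorem fourierInv_powFun {f : V → ℂ} (hf : Integrable f) (k : ℕ) (x : V) :
    𝓕⁻ (powFun k f) x = ((‖𝓕⁻ f x‖ ^ (2 * k) : ℝ) : ℂ) * 𝓕⁻ f x := by
  induction k with
  | zero => simp [powFun]
  | succ k ih =>
    rw [powFun, fourierInv_cconv (integrable_cconv hf (integrable_conjNeg hf))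
      (integrable_powFun hf k), fourierInv_cconv hf (integrable_conjNeg hf), fourierInv_conjNeg, ih,
      Complex.mul_conj']
    push_cast
    ring

end

section

variable {V : Type*} [NormedAddCommGroup V] [InnerProductSpace ℝ V] [FiniteDimensional ℝ V]
  [MeasurableSpace V] [BorelSpace V]

/-! ### The Fourier transform on `L²` and the bilinear pairing -/

variable (V) in
/-- The bilinear pairing `(f, g) ↦ ∫ f g` on `L²`. -/
def pairing : Lp (α := V) ℂ 2 (volume : Measure V) →L[ℂ]
    Lp (α := V) ℂ 2 (volume : Measure V) →L[ℂ] ℂ :=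
  (ContinuousLinearMap.mul ℂ ℂ).lpPairing volume 2 2

theorem pairing_eq (f g : Lp (α := V) ℂ 2 (volume : Measure V)) :
    pairing V f g = ∫ x, f x * g x :=
  ContinuousLinearMap.lpPairing_eq_integral ..

theorem pairing_toLp (f : Lp (α := V) ℂ 2 (volume : Measure V)) (g : 𝓢(V, ℂ)) :
    pairing V f (g.toLp 2 volume) = ∫ x, f x * g x := by
  rw [pairing_eq]
  refine integral_congr_ae ?_
  filter_upwards [g.coeFn_toLp 2 volume] with x hx
  rw [hx]

theorem pairing_sub_left (f g h : Lp (α := V) ℂ 2 (volume : Measure V)) :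
    pairing V (f - g) h = pairing V f h - pairing V g h := by
  rw [map_sub]; rfl

theorem norm_star_L2 (f : Lp (α := V) ℂ 2 (volume : Measure V)) : ‖star f‖ = ‖f‖ := by
  rw [Lp.norm_def, Lp.norm_def, eLpNorm_congr_ae (Lp.coeFn_star f)]
  congr 1
  exact eLpNorm_congr_norm_ae (Eventually.of_forall fun x => by simp)

theorem norm_pairing_le (f g : Lp (α := V) ℂ 2 (volume : Measure V)) :
    ‖pairing V f g‖ ≤ ‖f‖ * ‖g‖ := by
  have h1 : pairing V f g = inner ℂ (star f) g := by
    rw [pairing_eq, L2.inner_def]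
    refine integral_congr_ae ?_
    filter_upwards [Lp.coeFn_star f] with x hx
    rw [hx]
    simp [mul_comm]
  rw [h1, ← norm_star_L2 f]
  exact norm_inner_le_norm _ _

theorem integral_fourierInv_mul (f : Lp (α := V) ℂ 2 (volume : Measure V)) (g : 𝓢(V, ℂ)) :
    ∫ x, (𝓕⁻ f : Lp (α := V) ℂ 2 (volume : Measure V)) x * g x = ∫ x, f x * (𝓕⁻ g) x := by
  have h := congrArg (fun T : TemperedDistribution V ℂ => T g)
    (Lp.fourierInv_toTemperedDistribution_eq f)
  simp only [TemperedDistribution.fourierInv_apply, Lp.toTemperedDistribution_apply,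
    smul_eq_mul] at h
  simp_rw [mul_comm _ (g _), mul_comm _ ((𝓕⁻ g) _)]
  exact h.symm

theorem continuous_fourierInv {f : V → ℂ} (hf : Integrable f) : Continuous (𝓕⁻ f) :=
  VectorFourier.fourierIntegral_continuous Real.continuous_fourierChar
    (by exact (continuous_inner (𝕜 := ℝ)).neg) hf

theorem norm_fourierInv_le (f : V → ℂ) (x : V) : ‖𝓕⁻ f x‖ ≤ ∫ v, ‖f v‖ :=
  VectorFourier.norm_fourierIntegral_le_integral_norm _ _ _ _ _

theorem integral_fourierInv_mul_schwartz {f : V → ℂ} (hf : Integrable f) (g : 𝓢(V, ℂ)) :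
    ∫ x, 𝓕⁻ f x * g x = ∫ x, f x * (𝓕⁻ g) x := by
  have := VectorFourier.integral_fourierIntegral_smul_eq_flip (μ := (volume : Measure V))
    (ν := (volume : Measure V)) (L := -innerₗ V) Real.continuous_fourierChar
    (by exact (continuous_inner (𝕜 := ℝ)).neg) hf g.integrable
  simp only [smul_eq_mul] at this
  refine this.trans ?_
  congr 1
  funext x
  congr 1
  rw [SchwartzMap.fourierInv_coe]
  simp only [VectorFourier.fourierIntegral, Real.fourierInv_eq]
  congr 1
  funext v
  simp [real_inner_comm]

/-- On `L¹ ∩ L²` the inverse Fourier transform of `L²` is given by the integral. -/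
theorem coe_fourierInv_toL2 {f : V → ℂ} (hf : Integrable f)
    (F : Lp (α := V) ℂ 2 (volume : Measure V)) (hF : (F : V → ℂ) =ᵐ[volume] f) :
    ((𝓕⁻ F : Lp (α := V) ℂ 2 (volume : Measure V)) : V → ℂ) =ᵐ[volume] 𝓕⁻ f := by
  refine ae_eq_of_integral_contDiff_smul_eq ?_ ?_ ?_
  · exact (Lp.memLp _).locallyIntegrable (by norm_num)
  · exact (continuous_fourierInv hf).locallyIntegrable
  · intro g hg hgs
    let G : 𝓢(V, ℂ) := HasCompactSupport.toSchwartzMap (f := fun x => (g x : ℂ))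
      (hgs.comp_left (g := Complex.ofReal) Complex.ofReal_zero) (Complex.ofRealCLM.contDiff.comp hg)
    have hG : ∀ x, G x = (g x : ℂ) := fun x => rfl
    have h1 := integral_fourierInv_mul F G
    have h2 := integral_fourierInv_mul_schwartz hf G
    have h3 : ∫ x, F x * (𝓕⁻ G) x = ∫ x, f x * (𝓕⁻ G) x := by
      refine integral_congr_ae ?_
      filter_upwards [hF] with x hx
      rw [hx]
    simp_rw [Complex.real_smul, ← hG, mul_comm (G _)]
    rw [h1, h3, h2]

/-! ### Unimodular multipliers on `L²` -/

/-- Multiplication by the unimodular function `e^{i h}` on `L²`. -/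
def phaseL2 (h : Symbol V) (F : Lp (α := V) ℂ 2 (volume : Measure V)) :
    Lp (α := V) ℂ 2 (volume : Measure V) :=
  (L1L2.memLp_phase_mul h (Lp.memLp F)).toLp _

theorem coe_phaseL2 (h : Symbol V) (F : Lp (α := V) ℂ 2 (volume : Measure V)) :
    (phaseL2 h F : V → ℂ) =ᵐ[volume] fun x => Complex.exp (Complex.I * h x) * F x :=
  MemLp.coeFn_toLp _

@[simp]
theorem norm_phaseL2 (h : Symbol V) (F : Lp (α := V) ℂ 2 (volume : Measure V)) :
    ‖phaseL2 h F‖ = ‖F‖ := by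
  rw [Lp.norm_def, Lp.norm_def]
  congr 1
  refine eLpNorm_congr_norm_ae ?_
  filter_upwards [coe_phaseL2 h F] with x hx
  rw [hx, norm_mul, L1L2.norm_phase, one_mul]

theorem pairing_phaseL2 (h : Symbol V) (F G : Lp (α := V) ℂ 2 (volume : Measure V)) :
    pairing V (phaseL2 h F) G = pairing V F (phaseL2 h G) := by
  rw [pairing_eq, pairing_eq]
  refine integral_congr_ae ?_
  filter_upwards [coe_phaseL2 h F, coe_phaseL2 h G] with x h1 h2
  rw [h1, h2]; ring

theorem norm_exp_sub_one_sub_le (x : ℝ) :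
    ‖Complex.exp (Complex.I * x) - 1 - Complex.I * x‖ ≤ 3 * x ^ 2 := by
  have hn : ‖Complex.I * (x : ℂ)‖ = |x| := by simp
  rcases le_or_gt |x| 1 with h | h
  · have := Complex.norm_exp_sub_one_sub_id_le (x := Complex.I * x) (by rw [hn]; exact h)
    rw [hn, sq_abs] at this
    nlinarith [sq_nonneg x]
  · calc _ ≤ ‖Complex.exp (Complex.I * x) - 1‖ + ‖Complex.I * (x : ℂ)‖ := norm_sub_le _ _
      _ ≤ |x| + |x| := by
        rw [hn]
        gcongr
        exact Real.norm_exp_I_mul_ofReal_sub_one_le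
      _ ≤ 3 * x ^ 2 := by
        rw [← sq_abs]; nlinarith

/-- For `g` in the domain of multiplication by `Λ²`, the orbit `t ↦ e^{i t Λ} g` is differentiable
in `L²`. -/
theorem hasDerivAt_phaseL2 {Λ : Symbol V} {g g₁ g₂ : Lp (α := V) ℂ 2 (volume : Measure V)}
    (h₁ : (g₁ : V → ℂ) =ᵐ[volume] fun x => Λ x * g x)
    (h₂ : (g₂ : V → ℂ) =ᵐ[volume] fun x => (Λ x : ℂ) ^ 2 * g x) (t : ℝ) :
    HasDerivAt (fun r : ℝ => phaseL2 (r • Λ) g) (Complex.I • phaseL2 (t • Λ) g₁) t := by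
  rw [hasDerivAt_iff_isLittleO]
  refine Asymptotics.IsBigO.trans_isLittleO (g := fun r : ℝ => ‖r - t‖ ^ 2) ?_
    (Asymptotics.isLittleO_pow_sub_sub t one_lt_two)
  refine Asymptotics.IsBigO.of_bound (3 * ‖g₂‖) (Eventually.of_forall fun r => ?_)
  have key : ‖phaseL2 (r • Λ) g - phaseL2 (t • Λ) g - (r - t) • Complex.I • phaseL2 (t • Λ) g₁‖
      ≤ (3 * (r - t) ^ 2) * ‖g₂‖ := by
    refine Lp.norm_le_mul_norm_of_ae_le_mul ?_
    filter_upwards [coe_phaseL2 (r • Λ) g, coe_phaseL2 (t • Λ) g, coe_phaseL2 (t • Λ) g₁, h₁, h₂,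
      Lp.coeFn_sub (phaseL2 (r • Λ) g - phaseL2 (t • Λ) g) ((r - t) • Complex.I • phaseL2 (t • Λ) g₁),
      Lp.coeFn_sub (phaseL2 (r • Λ) g) (phaseL2 (t • Λ) g),
      Lp.coeFn_smul (r - t) (Complex.I • phaseL2 (t • Λ) g₁),
      Lp.coeFn_smul Complex.I (phaseL2 (t • Λ) g₁)] with x e1 e2 e3 e4 e5 e6 e7 e8 e9
    rw [e6, Pi.sub_apply, e7, Pi.sub_apply, e8, Pi.smul_apply, e9, Pi.smul_apply, e1, e2, e3, e4, e5]
    have hx : Complex.exp (Complex.I * ((r • Λ) x : ℝ)) * g x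
        - Complex.exp (Complex.I * ((t • Λ) x : ℝ)) * g x
        - (r - t) • Complex.I • (Complex.exp (Complex.I * ((t • Λ) x : ℝ)) * (Λ x * g x))
        = Complex.exp (Complex.I * ((t • Λ) x : ℝ)) * g x *
          (Complex.exp (Complex.I * (((r - t) * Λ x : ℝ) : ℂ)) - 1
            - Complex.I * (((r - t) * Λ x : ℝ) : ℂ)) := by
      have : Complex.exp (Complex.I * ((r • Λ) x : ℝ)) = Complex.exp (Complex.I * ((t • Λ) x : ℝ))
          * Complex.exp (Complex.I * (((r - t) * Λ x : ℝ) : ℂ)) := by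
        rw [← Complex.exp_add]
        congr 1
        simp only [ContinuousMap.smul_apply, smul_eq_mul]
        push_cast
        ring
      rw [this, Complex.real_smul, smul_eq_mul]
      push_cast
      ring
    rw [hx, norm_mul, norm_mul, L1L2.norm_phase, one_mul, norm_mul, norm_pow, Complex.norm_real,
      Real.norm_eq_abs, sq_abs]
    calc ‖g x‖ * _ ≤ ‖g x‖ * (3 * ((r - t) * Λ x) ^ 2) := by
          gcongr
          exact norm_exp_sub_one_sub_le _
      _ = _ := by ring
  rw [Real.norm_of_nonneg (by positivity), Real.norm_eq_abs, sq_abs]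
  linarith

/-! ### The symbol of the operator `Δ_η` -/

variable {d : ℕ}

/-- The symbol `Λ(ζ) = 2π² ∑ η_j ζ_j²` of `-½ Δ_η` for the Fourier kernel `e^{-2πi x·ζ}`. -/
def symbol (η : Fin d → ℝ) : Symbol (Space d) :=
  ⟨fun ζ => 2 * Real.pi ^ 2 * ∑ j, η j * ζ j ^ 2, by fun_prop⟩

theorem symbol_apply (η : Fin d → ℝ) (ζ : Space d) :
    symbol η ζ = 2 * Real.pi ^ 2 * ∑ j, η j * ζ j ^ 2 := rfl

theorem fourierInv_lineDeriv_apply (θ : 𝓢(Space d, ℂ)) (m ζ : Space d) :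
    (𝓕⁻ (∂_{m} θ) : 𝓢(Space d, ℂ)) ζ
      = -(2 * Real.pi * Complex.I) * (inner ℝ ζ m : ℝ) * (𝓕⁻ θ : 𝓢(Space d, ℂ)) ζ := by
  have h : (fun x : Space d => inner ℝ x m).HasTemperateGrowth := by fun_prop
  rw [SchwartzMap.fourierInv_lineDerivOp_eq, smul_apply,
    SchwartzMap.smulLeftCLM_apply_apply h, smul_eq_mul, Complex.real_smul]
  ring

theorem fourierInv_etaLaplacian_apply (η : Fin d → ℝ) (θ : 𝓢(Space d, ℂ)) (ζ : Space d) :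
    (𝓕⁻ (etaLaplacian η θ) : 𝓢(Space d, ℂ)) ζ
      = -2 * (symbol η ζ : ℂ) * (𝓕⁻ θ : 𝓢(Space d, ℂ)) ζ := by
  have h : (𝓕⁻ (etaLaplacian η θ) : 𝓢(Space d, ℂ)) = ∑ j : Fin d, (η j : ℂ) •
      (𝓕⁻ (∂_{(EuclideanSpace.single j 1 : Space d)} (∂_{(EuclideanSpace.single j 1 : Space d)} θ))
        : 𝓢(Space d, ℂ)) := by
    simp [etaLaplacian, FourierTransform.fourierInv_smul]
  rw [h, sum_apply]
  simp_rw [smul_apply, fourierInv_lineDeriv_apply, smul_eq_mul]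
  rw [symbol_apply]
  push_cast
  rw [Finset.mul_sum, Finset.mul_sum, Finset.sum_mul]
  refine Finset.sum_congr rfl fun j _ => ?_
  rw [EuclideanSpace.inner_single_right]
  simp
  linear_combination (4 * (Real.pi : ℂ) ^ 2 * (η j) * (ζ j) ^ 2 * (𝓕⁻ θ : 𝓢(Space d, ℂ)) ζ)
    * Complex.I_sq

end

section

variable {V : Type*} [NormedAddCommGroup V] [InnerProductSpace ℝ V] [FiniteDimensional ℝ V]
  [MeasurableSpace V] [BorelSpace V]

/-! ### Uniqueness -/

theorem norm_power_mul (k : ℕ) (a : ℂ) : ‖((‖a‖ ^ (2 * k) : ℝ) : ℂ) * a‖ = ‖a‖ ^ (2 * k) * ‖a‖ := by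
  rw [norm_mul, Complex.norm_real, Real.norm_of_nonneg (by positivity)]

theorem norm_power_mul_sub_le (k : ℕ) {M : ℝ} {a b : ℂ} (ha : ‖a‖ ≤ M) (hb : ‖b‖ ≤ M) :
    ‖((‖a‖ ^ (2 * k) : ℝ) : ℂ) * a - ((‖b‖ ^ (2 * k) : ℝ) : ℂ) * b‖
      ≤ (2 * k + 1) * M ^ (2 * k) * ‖a - b‖ := by
  have hM : 0 ≤ M := (norm_nonneg _).trans ha
  induction k with
  | zero => simp
  | succ k ih =>
    have e : ((‖a‖ ^ (2 * (k + 1)) : ℝ) : ℂ) * a - ((‖b‖ ^ (2 * (k + 1)) : ℝ) : ℂ) * b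
        = ((‖a‖ ^ 2 - ‖b‖ ^ 2 : ℝ) : ℂ) * (((‖a‖ ^ (2 * k) : ℝ) : ℂ) * a)
          + ((‖b‖ ^ 2 : ℝ) : ℂ) * (((‖a‖ ^ (2 * k) : ℝ) : ℂ) * a - ((‖b‖ ^ (2 * k) : ℝ) : ℂ) * b) := by
      push_cast; ring
    have h1 : |‖a‖ ^ 2 - ‖b‖ ^ 2| ≤ ‖a - b‖ * (M + M) := by
      rw [sq_sub_sq, abs_mul, mul_comm, abs_of_nonneg (by positivity : 0 ≤ ‖a‖ + ‖b‖)]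
      gcongr
      exact abs_norm_sub_norm_le a b
    rw [e]
    calc _ ≤ _ := norm_add_le _ _
      _ ≤ ‖a - b‖ * (M + M) * (M ^ (2 * k) * M)
          + M ^ 2 * ((2 * k + 1) * M ^ (2 * k) * ‖a - b‖) := by
        rw [norm_mul _ (_ * a), norm_mul _ (_ - _), norm_power_mul, Complex.norm_real,
          Complex.norm_real, Real.norm_eq_abs, Real.norm_of_nonneg (sq_nonneg ‖b‖)]
        gcongr
      _ = _ := by push_cast; ring

theorem memLp_power_mul {f : V → ℂ} (k : ℕ) (hf : MemLp f 2 volume) {M : ℝ}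
    (hM : ∀ᵐ x ∂(volume : Measure V), ‖f x‖ ≤ M) :
    MemLp (fun x => ((‖f x‖ ^ (2 * k) : ℝ) : ℂ) * f x) 2 volume := by
  refine hf.of_le_mul (c := M ^ (2 * k)) ?_ ?_
  · refine AEStronglyMeasurable.mul ?_ hf.1
    exact Complex.continuous_ofReal.comp_aestronglyMeasurable (hf.1.norm.pow _)
  · filter_upwards [hM] with x hx
    rw [norm_power_mul]
    gcongr

/-- A product rule in which the first factor is only differentiable when tested against the value
of the second factor. -/
theorem hasDerivWithinAt_bilin {E F : Type*} [NormedAddCommGroup E] [NormedSpace ℂ E]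
    [NormedAddCommGroup F] [NormedSpace ℂ F] (B : E →L[ℂ] F →L[ℂ] ℂ) {y : ℝ → E} {G : ℝ → F}
    {G' : F} {c : ℂ} {s : Set ℝ} {t : ℝ} (hy : ContinuousWithinAt y s t) (hG : HasDerivAt G G' t)
    (h : HasDerivWithinAt (fun r => B (y r) (G t)) c s t) :
    HasDerivWithinAt (fun r => B (y r) (G r)) (c + B (y t) G') s t := by
  have h2 : HasDerivWithinAt (fun r => B (y r) (G r - G t)) (B (y t) G') s t := by
    rw [hasDerivWithinAt_iff_tendsto_slope]
    have hs : Tendsto (slope G t) (𝓝[s \ {t}] t) (𝓝 G') :=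
      hG.tendsto_slope.mono_left (nhdsWithin_mono _ fun x hx => hx.2)
    have hy' : Tendsto y (𝓝[s \ {t}] t) (𝓝 (y t)) :=
      hy.tendsto.mono_left (nhdsWithin_mono _ Set.sdiff_subset)
    have hp : Tendsto (fun r => B (y r) (slope G t r)) (𝓝[s \ {t}] t) (𝓝 (B (y t) G')) :=
      (B.isBoundedBilinearMap.continuous.tendsto (y t, G')).comp (hy'.prodMk_nhds hs)
    refine hp.congr fun r => ?_
    simp only [slope_def_module, sub_self, map_zero, sub_zero]
    rw [← Complex.coe_smul, ← Complex.coe_smul, map_smul]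
  refine (h.add h2).congr_of_eventuallyEq (Eventually.of_forall fun r => ?_) ?_
  · simp [map_sub]
  · simp [map_sub]

/-- By density, the `L²` norm is controlled by pairing with smooth compactly supported functions. -/
theorem norm_le_of_pairing_le (f : Lp (α := V) ℂ 2 (volume : Measure V)) {C : ℝ} (hC : 0 ≤ C)
    (h : ∀ g : 𝓢(V, ℂ), HasCompactSupport g →
      ‖pairing V f (g.toLp 2 volume)‖ ≤ C * ‖g.toLp 2 volume‖) : ‖f‖ ≤ C := by
  have hall : ∀ G : Lp (α := V) ℂ 2 (volume : Measure V), ‖pairing V f G‖ ≤ C * ‖G‖ := by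
    intro G
    have hcl : IsClosed {G : Lp (α := V) ℂ 2 (volume : Measure V) | ‖pairing V f G‖ ≤ C * ‖G‖} :=
      isClosed_le (pairing V f).continuous.norm (continuous_const.mul continuous_norm)
    refine hcl.closure_subset ((mem_closure_iff_nhds_basis Metric.nhds_basis_closedBall).2
      fun ε hε => ?_)
    obtain ⟨g, hg₁, hg₂, hg₃⟩ := MemLp.exist_eLpNorm_sub_le (by norm_num) (by norm_num)
      (Lp.memLp G) hε
    refine ⟨(hg₁.toSchwartzMap hg₂).toLp 2 volume, h _ hg₁, ?_⟩
    have : (G : V → ℂ) - ((hg₁.toSchwartzMap hg₂).toLp 2 volume : V → ℂ) =ᵐ[volume]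
        (G : V → ℂ) - g := by
      filter_upwards [(hg₁.toSchwartzMap hg₂).coeFn_toLp 2 volume] with x hx
      simp [hx]
    rw [Metric.mem_closedBall', Lp.dist_def, eLpNorm_congr_ae this]
    exact ENNReal.toReal_le_of_le_ofReal hε.le hg₃
  have h1 : pairing V f (star f) = ((‖f‖ ^ 2 : ℝ) : ℂ) := by
    have := inner_self_eq_norm_sq_to_K (𝕜 := ℂ) f
    rw [L2.inner_def] at this
    rw [pairing_eq]
    refine (integral_congr_ae ?_).trans (this.trans (by simp))
    filter_upwards [Lp.coeFn_star f] with x hx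
    rw [hx]
    simp [Complex.mul_conj']
  have h2 := hall (star f)
  rw [h1, norm_star_L2, Complex.norm_real, Real.norm_of_nonneg (by positivity)] at h2
  rcases (norm_nonneg f).eq_or_lt with h0 | h0
  · rwa [← h0]
  · exact le_of_mul_le_mul_right (by linarith [sq ‖f‖]) h0

end

section

variable {d : ℕ}

/-- By compactness of the time interval, a solution is bounded. -/
theorem IsSolution.exists_bound {η : Fin d → ℝ} {ν : ℕ} {μ : ℝ} {φ : 𝓢(Space d, ℂ)} {T : ℝ}
    {ψ : ℝ → L2 d} (h : IsSolution η ν μ φ T ψ) :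
    ∃ M : ℝ, ∀ t ∈ Set.Icc 0 T, ∀ᵐ x, ‖(ψ t : Space d → ℂ) x‖ ≤ M := by
  have key : ∃ M : ℝ, ∀ t ∈ Set.Icc 0 T, eLpNorm (ψ t) ∞ volume ≤ ENNReal.ofReal M := by
    refine isCompact_Icc.induction_on
      (p := fun S => ∃ M : ℝ, ∀ t ∈ S, eLpNorm (ψ t) ∞ volume ≤ ENNReal.ofReal M) ?_ ?_ ?_ ?_
    · exact ⟨0, by simp⟩
    · rintro S S' hS ⟨M, hM⟩
      exact ⟨M, fun t ht => hM t (hS ht)⟩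
    · rintro S S' ⟨M, hM⟩ ⟨M', hM'⟩
      refine ⟨max M M', fun t ht => ?_⟩
      rcases ht with ht | ht
      · exact (hM t ht).trans (ENNReal.ofReal_le_ofReal (le_max_left _ _))
      · exact (hM' t ht).trans (ENNReal.ofReal_le_ofReal (le_max_right _ _))
    · intro t ht
      have h1 : ∀ᶠ r in 𝓝[Set.Icc 0 T] t,
          eLpNorm ((ψ r - ψ t : L2 d) : Space d → ℂ) ∞ volume < 1 :=
        (h.continuous_Linfty t ht).eventually (gt_mem_nhds one_pos)
      refine ⟨_, h1, (eLpNorm (ψ t) ∞ volume).toReal + 1, fun r hr => ?_⟩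
      have h2 : (ψ r : Space d → ℂ) =ᵐ[volume] fun x =>
          ((ψ r - ψ t : L2 d) : Space d → ℂ) x + ψ t x := by
        filter_upwards [Lp.coeFn_sub (ψ r) (ψ t)] with x hx
        rw [hx]; simp
      rw [eLpNorm_congr_ae h2, ENNReal.ofReal_add ENNReal.toReal_nonneg one_pos.le,
        ENNReal.ofReal_toReal (h.mem_Linfty t ht).2.ne, add_comm (eLpNorm (ψ t) ∞ volume)]
      refine (eLpNorm_add_le (Lp.aestronglyMeasurable _) (Lp.aestronglyMeasurable _) le_top).trans ?_
      gcongr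
      simpa using hr.le
  obtain ⟨M, hM⟩ := key
  refine ⟨max M 0, fun t ht => ?_⟩
  have := hM t ht
  rw [eLpNorm_exponent_top] at this
  filter_upwards [ae_le_eLpNormEssSup (f := (ψ t : Space d → ℂ)) (μ := volume)] with x hx
  have h3 := hx.trans (this.trans (ENNReal.ofReal_le_ofReal (le_max_left M 0)))
  rwa [← ofReal_norm, ENNReal.ofReal_le_ofReal_iff (le_max_right _ _)] at h3

/-- The Schwartz function `e^{i t Λ} g` for a compactly supported `g`. -/
def phaseSchwartz (η : Fin d → ℝ) (t : ℝ) (g : 𝓢(Space d, ℂ)) (hg : HasCompactSupport g) :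
    𝓢(Space d, ℂ) :=
  HasCompactSupport.toSchwartzMap
    (f := fun ζ => Complex.exp (Complex.I * ((t • symbol η) ζ : ℝ)) * g ζ) hg.mul_left (by
      have h1 : ContDiff ℝ (⊤ : ℕ∞) (fun ζ : Space d => 2 * Real.pi ^ 2 * ∑ j, η j * ζ j ^ 2) := by
        fun_prop
      have h2 : ContDiff ℝ (⊤ : ℕ∞) (fun ζ : Space d => (((t • symbol η) ζ : ℝ) : ℂ)) :=
        Complex.ofRealCLM.contDiff.comp (contDiff_const.mul h1)
      exact ((contDiff_const.mul h2).cexp).mul (g.smooth ⊤))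

theorem toLp_phaseSchwartz (η : Fin d → ℝ) (t : ℝ) (g : 𝓢(Space d, ℂ)) (hg : HasCompactSupport g) :
    (phaseSchwartz η t g hg).toLp 2 volume = phaseL2 (t • symbol η) (g.toLp 2 volume) := by
  apply Lp.ext
  filter_upwards [(phaseSchwartz η t g hg).coeFn_toLp 2 volume, g.coeFn_toLp 2 volume,
    coe_phaseL2 (t • symbol η) (g.toLp 2 volume)] with ζ h1 h2 h3
  rw [h1, h3, h2]
  rfl

/-- The operator `-½ Δ_η` on the Fourier side of the pairing. -/
theorem integral_mul_etaLaplacian (η : Fin d → ℝ) (f : L2 d) (θ g₁ : 𝓢(Space d, ℂ))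
    (h : ∀ ζ, g₁ ζ = symbol η ζ * (𝓕⁻ θ : 𝓢(Space d, ℂ)) ζ) :
    ∫ x, f x * etaLaplacian η θ x = -2 * pairing (Space d) (𝓕 f) (g₁.toLp 2 volume) := by
  have h1 := integral_fourierInv_mul (𝓕 f) (etaLaplacian η θ)
  rw [FourierTransform.fourierInv_fourier_eq] at h1
  rw [h1, pairing_toLp, ← integral_const_mul]
  congr 1
  funext ζ
  rw [fourierInv_etaLaplacian_apply, h]
  ring

/-- Parseval's identity for the bilinear pairing. -/
theorem integral_mul_eq_pairing_fourier (f : L2 d) (θ : 𝓢(Space d, ℂ)) :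
    ∫ x, f x * θ x = pairing (Space d) (𝓕 f) ((𝓕⁻ θ : 𝓢(Space d, ℂ)).toLp 2 volume) := by
  rw [pairing_toLp, ← integral_fourierInv_mul, FourierTransform.fourierInv_fourier_eq]

/-- `symbol η * g` as a Schwartz function; Schwartz regularity comes for free from the definition by
means of `Δ_η`. -/
def symbolMul (η : Fin d → ℝ) (g : 𝓢(Space d, ℂ)) : 𝓢(Space d, ℂ) :=
  (-1 / 2 : ℂ) • (𝓕⁻ (etaLaplacian η (𝓕 g)) : 𝓢(Space d, ℂ))

theorem symbolMul_apply (η : Fin d → ℝ) (g : 𝓢(Space d, ℂ)) (ζ : Space d) :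
    symbolMul η g ζ = symbol η ζ * g ζ := by
  rw [symbolMul, smul_apply, fourierInv_etaLaplacian_apply, FourierTransform.fourierInv_fourier_eq,
    smul_eq_mul]
  ring

theorem hasDerivAt_phaseL2_schwartz (η : Fin d → ℝ) (g : 𝓢(Space d, ℂ)) (t : ℝ) :
    HasDerivAt (fun r : ℝ => phaseL2 (r • symbol η) (g.toLp 2 volume))
      (Complex.I • phaseL2 (t • symbol η) ((symbolMul η g).toLp 2 volume)) t := by
  refine hasDerivAt_phaseL2 (g₂ := (symbolMul η (symbolMul η g)).toLp 2 volume) ?_ ?_ t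
  · filter_upwards [g.coeFn_toLp 2 volume, (symbolMul η g).coeFn_toLp 2 volume] with ζ h1 h2
    rw [h1, h2, symbolMul_apply]
  · filter_upwards [g.coeFn_toLp 2 volume, (symbolMul η (symbolMul η g)).coeFn_toLp 2 volume]
      with ζ h1 h2
    rw [h1, h2, symbolMul_apply, symbolMul_apply]
    ring

/-- Grönwall's inequality in integral form: a function whose norm is bounded by a multiple of its
own integral `B` vanishes. -/
theorem eq_zero_of_norm_le_mul_integral {E : Type*} [NormedAddCommGroup E] {z : ℝ → E} {T K : ℝ}
    (hz : ContinuousOn z (Set.Icc 0 T))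
    (h : ∀ B : ℝ → ℝ, B 0 = 0 → ContinuousOn B (Set.Icc 0 T) →
      (∀ t ∈ Set.Ico 0 T, HasDerivWithinAt B ‖z t‖ (Set.Ici t) t) →
      ∀ t ∈ Set.Icc 0 T, ‖z t‖ ≤ K * B t) :
    ∀ t ∈ Set.Icc 0 T, z t = 0 := by
  intro t ht
  have hT : 0 ≤ T := ht.1.trans ht.2
  set m : ℝ → ℝ := fun r => ‖z (Set.projIcc 0 T hT r)‖ with hm
  have hmc : Continuous m := by
    have h1 : Continuous ((Set.Icc 0 T).domRestrict z) :=
      continuousOn_iff_continuous_domRestrict.mp hz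
    exact (h1.comp continuous_projIcc).norm
  have hme : ∀ r ∈ Set.Icc 0 T, m r = ‖z r‖ := by
    intro r hr
    simp only [hm, Set.projIcc_of_mem hT hr]
  set B : ℝ → ℝ := fun r => ∫ s in (0 : ℝ)..r, m s with hB
  have hBd : ∀ r, HasDerivAt B (m r) r := fun r =>
    intervalIntegral.integral_hasDerivAt_right (hmc.intervalIntegrable _ _)
      (hmc.stronglyMeasurableAtFilter _ _) hmc.continuousAt
  have hBc : ContinuousOn B (Set.Icc 0 T) := fun r _ => (hBd r).continuousAt.continuousWithinAt
  have hbound := h B (by simp [hB]) hBc (fun r hr => by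
    rw [← hme r ⟨hr.1, hr.2.le⟩]; exact (hBd r).hasDerivWithinAt)
  have hgr := norm_le_gronwallBound_of_norm_deriv_right_le (f := B) (f' := m) (δ := 0) (K := |K|)
    (ε := 0) (a := 0) (b := T) hBc (fun r _ => (hBd r).hasDerivWithinAt) (by simp [hB]) (by
      intro r hr
      have h1 := hbound r ⟨hr.1, hr.2.le⟩
      rw [hme r ⟨hr.1, hr.2.le⟩, norm_norm, add_zero]
      refine h1.trans ((le_abs_self _).trans ?_)
      rw [abs_mul, Real.norm_eq_abs]) t ht
  have hB0 : B t = 0 := by simpa [gronwallBound_ε0] using hgr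
  have := hbound t ht
  rw [hB0, mul_zero] at this
  exact norm_le_zero_iff.mp this

/-- Testing a solution against the orbit `e^{i t Λ} g` on the Fourier side removes the dispersive
term of the equation. -/
theorem IsSolution.hasDerivWithinAt_pairing {η : Fin d → ℝ} {ν : ℕ} {μ : ℝ} {φ : 𝓢(Space d, ℂ)}
    {T : ℝ} {ψ : ℝ → L2 d} (h : IsSolution η ν μ φ T ψ) (g : 𝓢(Space d, ℂ))
    (hg : HasCompactSupport g) {r : ℝ} (hr : r ∈ Set.Icc 0 T) :
    HasDerivWithinAt
      (fun q => pairing (Space d) (𝓕 (ψ q)) (phaseL2 (q • symbol η) (g.toLp 2 volume)))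
      (-Complex.I * (μ : ℂ) * ∫ x, ((‖(ψ r : Space d → ℂ) x‖ ^ (2 * ν) : ℝ) : ℂ) *
        (ψ r : Space d → ℂ) x * (𝓕 (phaseSchwartz η r g hg) : 𝓢(Space d, ℂ)) x)
      (Set.Icc 0 T) r := by
  set gr := phaseSchwartz η r g hg with hgr
  set θ : 𝓢(Space d, ℂ) := 𝓕 gr with hθ
  have hθi : (𝓕⁻ θ : 𝓢(Space d, ℂ)) = gr := FourierTransform.fourierInv_fourier_eq gr
  have hgrL : gr.toLp 2 volume = phaseL2 (r • symbol η) (g.toLp 2 volume) :=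
    toLp_phaseSchwartz η r g hg
  set sg := phaseSchwartz η r (symbolMul η g) (by
    have : (symbolMul η g : Space d → ℂ) = fun ζ => (symbol η ζ : ℂ) * g ζ := by
      funext ζ; exact symbolMul_apply η g ζ
    rw [this]
    exact hg.mul_left) with hsg
  have hsgL : sg.toLp 2 volume = phaseL2 (r • symbol η) ((symbolMul η g).toLp 2 volume) :=
    toLp_phaseSchwartz ..
  have hsgθ : ∀ ζ, sg ζ = symbol η ζ * (𝓕⁻ θ : 𝓢(Space d, ℂ)) ζ := by
    intro ζ
    rw [hθi]
    change Complex.exp _ * symbolMul η g ζ = symbol η ζ * (Complex.exp _ * g ζ)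
    rw [symbolMul_apply]; ring
  have hyc : ContinuousOn (fun q => (𝓕 (ψ q) : L2 d)) (Set.Icc 0 T) :=
    (FourierTransform.fourierCLM ℂ (L2 d)).continuous.comp_continuousOn h.continuous_L2
  have hpair : ∀ q : ℝ, pairing (Space d) (𝓕 (ψ q)) (phaseL2 (r • symbol η) (g.toLp 2 volume))
      = ∫ x, (ψ q : Space d → ℂ) x * θ x := by
    intro q
    rw [integral_mul_eq_pairing_fourier, hθi, hgrL]
  have hd := (h.equation θ r hr).congr_of_eventuallyEq (Eventually.of_forall hpair) (hpair r)
  refine (hasDerivWithinAt_bilin _ (hyc r hr) (hasDerivAt_phaseL2_schwartz η g r) hd).congr_deriv ?_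
  rw [integral_mul_etaLaplacian η (ψ r) θ sg hsgθ, map_smul, smul_eq_mul, ← hsgL]
  have halg : ∀ a p : ℂ, Complex.I / 2 * (-2 * a) - Complex.I * (μ : ℂ) * p + Complex.I * a
      = -Complex.I * (μ : ℂ) * p := by
    intro a p; ring
  exact halg _ _

/-- The power nonlinearity is Lipschitz in `L²` on `L^∞`-bounded sets, in its weak form. -/
theorem norm_integral_power_sub_le (ν : ℕ) {f g : L2 d} {M : ℝ} (hf : ∀ᵐ x, ‖f x‖ ≤ M)
    (hg : ∀ᵐ x, ‖g x‖ ≤ M) (θ : 𝓢(Space d, ℂ)) :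
    ‖(∫ x, ((‖f x‖ ^ (2 * ν) : ℝ) : ℂ) * f x * θ x)
        - ∫ x, ((‖g x‖ ^ (2 * ν) : ℝ) : ℂ) * g x * θ x‖
      ≤ (2 * ν + 1) * M ^ (2 * ν) * ‖f - g‖ * ‖θ.toLp 2 volume‖ := by
  have m₁ := memLp_power_mul ν (Lp.memLp g) hg
  have m₂ := memLp_power_mul ν (Lp.memLp f) hf
  have e : ∀ {f : Space d → ℂ} (m : MemLp f 2 volume),
      ∫ x, f x * θ x = pairing (Space d) (m.toLp f) (θ.toLp 2 volume) := by
    intro f m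
    rw [pairing_toLp]
    refine integral_congr_ae ?_
    filter_upwards [m.coeFn_toLp] with x hx
    rw [hx]
  rw [e m₁, e m₂, ← pairing_sub_left]
  refine (norm_pairing_le _ _).trans ?_
  gcongr
  refine Lp.norm_le_mul_norm_of_ae_le_mul ?_
  filter_upwards [Lp.coeFn_sub (m₂.toLp _) (m₁.toLp _), m₁.coeFn_toLp, m₂.coeFn_toLp,
    Lp.coeFn_sub f g, hg, hf] with x e1 e2 e3 e4 b1 b2
  rw [e1, Pi.sub_apply, e2, e3, e4, Pi.sub_apply]
  exact norm_power_mul_sub_le ν b2 b1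

/-- Solutions in the class `C([0,T]; L² ∩ L^∞)` are unique: the difference of two solutions is
tested against `𝓕 (e^{i t Λ} g)`, which removes the dispersive term. -/
theorem IsSolution.unique {η : Fin d → ℝ} {ν : ℕ} {μ : ℝ} {φ : 𝓢(Space d, ℂ)} {T : ℝ}
    {ψ ψ' : ℝ → L2 d} (h : IsSolution η ν μ φ T ψ) (h' : IsSolution η ν μ φ T ψ') :
    Set.EqOn ψ' ψ (Set.Icc 0 T) := by
  obtain ⟨M₁, hM₁⟩ := h.exists_bound
  obtain ⟨M₂, hM₂⟩ := h'.exists_bound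
  set M := max M₁ M₂
  set K : ℝ := (2 * ν + 1) * M ^ (2 * ν)
  have hK : 0 ≤ K := by
    have : 0 ≤ M ^ (2 * ν) := (even_two_mul ν).pow_nonneg M
    positivity
  have hb₁ : ∀ t ∈ Set.Icc 0 T, ∀ᵐ x, ‖(ψ t : Space d → ℂ) x‖ ≤ M := fun t ht =>
    (hM₁ t ht).mono fun x hx => hx.trans (le_max_left _ _)
  have hb₂ : ∀ t ∈ Set.Icc 0 T, ∀ᵐ x, ‖(ψ' t : Space d → ℂ) x‖ ≤ M := fun t ht =>
    (hM₂ t ht).mono fun x hx => hx.trans (le_max_right _ _)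
  have hzc : ContinuousOn (fun t => ψ' t - ψ t) (Set.Icc 0 T) :=
    h'.continuous_L2.sub h.continuous_L2
  have hF : ∀ f : L2 d, ‖𝓕 f‖ = ‖f‖ := fun f => Lp.norm_fourier_eq f
  suffices hz : ∀ t ∈ Set.Icc 0 T, ψ' t - ψ t = 0 from fun t ht => sub_eq_zero.mp (hz t ht)
  refine eq_zero_of_norm_le_mul_integral (K := |μ| * K) hzc ?_
  intro B hB0 hBc hBd t ht
  -- `B` has the nonnegative derivative `‖ψ' - ψ‖`.
  have hBnn : 0 ≤ B t := by
    have := image_norm_le_of_norm_deriv_right_le_deriv_boundary' (f := fun _ : ℝ => (0 : ℝ))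
      (f' := fun _ => 0) (a := 0) (b := T) continuousOn_const
      (fun x _ => hasDerivWithinAt_const _ _ _) (B := B) (B' := fun t => ‖ψ' t - ψ t‖)
      (by simp [hB0]) hBc hBd (by simp) ht
    simpa using this
  rw [← hF, ← norm_phaseL2 (t • symbol η)]
  refine norm_le_of_pairing_le _ (by positivity) fun g hg => ?_
  rw [pairing_phaseL2]
  set G : ℝ → L2 d := fun r => phaseL2 (r • symbol η) (g.toLp 2 volume) with hG
  have hder : ∀ r ∈ Set.Icc 0 T, ∃ c : ℂ, ‖c‖ ≤ |μ| * K * ‖g.toLp 2 volume‖ * ‖ψ' r - ψ r‖ ∧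
      HasDerivWithinAt (fun q => pairing (Space d) (𝓕 (ψ' q)) (G q)
        - pairing (Space d) (𝓕 (ψ q)) (G q)) c (Set.Icc 0 T) r := by
    intro r hr
    refine ⟨_, ?_, (h'.hasDerivWithinAt_pairing g hg hr).sub (h.hasDerivWithinAt_pairing g hg hr)⟩
    have hθn : ‖(𝓕 (phaseSchwartz η r g hg) : 𝓢(Space d, ℂ)).toLp 2 volume‖
        = ‖g.toLp 2 volume‖ := by
      rw [← SchwartzMap.toLp_fourier_eq, Lp.norm_fourier_eq, toLp_phaseSchwartz, norm_phaseL2]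
    rw [← mul_sub, norm_mul, norm_mul, norm_neg, Complex.norm_I, one_mul, Complex.norm_real,
      Real.norm_eq_abs]
    refine (mul_le_mul_of_nonneg_left (norm_integral_power_sub_le ν (hb₂ r hr) (hb₁ r hr) _)
      (abs_nonneg μ)).trans_eq ?_
    rw [hθn]
    ring
  choose! c hc hcd using hder
  have hinit : pairing (Space d) (𝓕 (ψ' 0)) (G 0) - pairing (Space d) (𝓕 (ψ 0)) (G 0) = 0 := by
    rw [h.initial, h'.initial, sub_self]
  have key := image_norm_le_of_norm_deriv_right_le_deriv_boundary'
    (f := fun q => pairing (Space d) (𝓕 (ψ' q)) (G q) - pairing (Space d) (𝓕 (ψ q)) (G q))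
    (f' := c) (a := 0) (b := T) (fun r hr => (hcd r hr).continuousWithinAt)
    (fun r hr => (hcd r ⟨hr.1, hr.2.le⟩).mono_of_mem_nhdsWithin (Icc_mem_nhdsGE_of_mem hr))
    (B := fun r => |μ| * K * ‖g.toLp 2 volume‖ * B r)
    (B' := fun r => |μ| * K * ‖g.toLp 2 volume‖ * ‖ψ' r - ψ r‖)
    (by rw [hinit, hB0]; simp) (continuousOn_const.mul hBc)
    (fun r hr => (hBd r hr).const_mul _) (fun r hr => hc r ⟨hr.1, hr.2.le⟩) ht
  have hsub : (𝓕 (ψ' t - ψ t) : L2 d) = 𝓕 (ψ' t) - 𝓕 (ψ t) :=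
    map_sub (FourierTransform.fourierCLM ℂ (L2 d)) _ _
  rw [hsub, pairing_sub_left]
  refine key.trans_eq ?_
  ring

end

/-! ### Existence -/

/-- The Picard-Lindelöf theorem, together with the ball in which the solution stays. -/
theorem exists_hasDerivWithinAt_mem_closedBall {E : Type*} [NormedAddCommGroup E] [NormedSpace ℝ E]
    [CompleteSpace E] {f : ℝ → E → E} {tmin tmax : ℝ} {t₀ : Set.Icc tmin tmax} {x₀ : E}
    {a L K : NNReal} (hf : IsPicardLindelof f t₀ x₀ a 0 L K) :
    ∃ α : ℝ → E, α t₀ = x₀ ∧ ∀ t ∈ Set.Icc tmin tmax, α t ∈ Metric.closedBall x₀ a ∧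
      HasDerivWithinAt α (f t (α t)) (Set.Icc tmin tmax) t := by
  have hx : x₀ ∈ Metric.closedBall x₀ ((0 : NNReal) : ℝ) := Metric.mem_closedBall_self le_rfl
  obtain ⟨α, hα⟩ := ODE.FunSpace.exists_isFixedPt_next hf hx
  refine ⟨α.compProj, by rw [ODE.FunSpace.compProj_val, ← hα, ODE.FunSpace.next_apply₀],
    fun t ht ↦ ⟨α.compProj_mem_closedBall hf.mul_max_le, ?_⟩⟩
  apply ODE.hasDerivWithinAt_picard_Icc t₀.2 hf.continuousOn_uncurry
    α.continuous_compProj.continuousOn (fun _ ht' ↦ α.compProj_mem_closedBall hf.mul_max_le)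
    x₀ ht |>.congr_of_mem _ ht
  intro t' ht'
  nth_rw 1 [← hα]
  rw [ODE.FunSpace.compProj_of_mem ht', ODE.FunSpace.next_apply]

section General

variable {V : Type*} [NormedAddCommGroup V] [InnerProductSpace ℝ V] [FiniteDimensional ℝ V]
  [MeasurableSpace V] [BorelSpace V]

theorem L1L2.continuousOn_phase_smul (h : Symbol V) {c : ℝ → ℝ} {F : ℝ → L1L2 V} {s : Set ℝ}
    (hc : ContinuousOn c s) (hF : ContinuousOn F s) :
    ContinuousOn (fun t => L1L2.phase (c t • h) (F t)) s := by
  intro t₀ ht₀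
  have h1 : ContinuousWithinAt (fun t => L1L2.phase (c t • h) (F t₀)) s t₀ :=
    (L1L2.continuous_phase_smul h (F t₀)).continuousAt.comp_continuousWithinAt (hc t₀ ht₀)
  have h2 : Tendsto (fun t => dist (L1L2.phase (c t • h) (F t)) (L1L2.phase (c t • h) (F t₀)))
      (𝓝[s] t₀) (𝓝 0) := by
    simp_rw [L1L2.dist_phase_phase]
    exact tendsto_iff_dist_tendsto_zero.mp (hF t₀ ht₀)
  rw [ContinuousWithinAt, tendsto_iff_dist_tendsto_zero] at h1 ⊢
  refine squeeze_zero (fun _ => dist_nonneg)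
    (fun t => dist_triangle _ (L1L2.phase (c t • h) (F t₀)) _) ?_
  simpa using h2.add h1

/-- The vector field `-iμ e^{i t Λ} |u|^(2ν) u`, `u = e^{-i t Λ} v`, that governs the profile
`v = e^{i t Λ} ψ^` on the Fourier side. -/
def field (w : Weight V) (ν : ℕ) (μ : ℝ) (Λ : Symbol V) (t : ℝ) (F : L1L2 V) : L1L2 V :=
  (-Complex.I * (μ : ℂ)) • L1L2.phase (t • Λ) (w.pow ν (L1L2.phase ((-t) • Λ) F))

theorem norm_field_le (w : Weight V) (ν : ℕ) (μ : ℝ) (Λ : Symbol V) (t : ℝ) (F : L1L2 V) :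
    ‖field w ν μ Λ t F‖ ≤ |μ| * ‖F‖ ^ (2 * ν + 1) := by
  rw [field, norm_smul, norm_mul, norm_neg, Complex.norm_I, one_mul, Complex.norm_real,
    Real.norm_eq_abs, L1L2.norm_phase_apply]
  gcongr
  exact (w.norm_pow_le _ _).trans_eq (by rw [L1L2.norm_phase_apply])

theorem norm_field_sub_le (w : Weight V) (ν : ℕ) (μ : ℝ) (Λ : Symbol V) (t : ℝ) {F G : L1L2 V}
    {R : ℝ} (hF : ‖F‖ ≤ R) (hG : ‖G‖ ≤ R) :
    ‖field w ν μ Λ t F - field w ν μ Λ t G‖ ≤ |μ| * ((2 * ν + 1) * R ^ (2 * ν)) * ‖F - G‖ := by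
  have h : field w ν μ Λ t F - field w ν μ Λ t G = (-Complex.I * (μ : ℂ)) • L1L2.phase (t • Λ)
      (w.pow ν (L1L2.phase ((-t) • Λ) F) - w.pow ν (L1L2.phase ((-t) • Λ) G)) := by
    rw [L1L2.phase_sub]
    exact (smul_sub (-Complex.I * (μ : ℂ)) _ _).symm
  rw [h, norm_smul, norm_mul, norm_neg, Complex.norm_I,
    one_mul, Complex.norm_real, Real.norm_eq_abs, L1L2.norm_phase_apply, mul_assoc]
  gcongr
  refine (w.norm_pow_sub_pow_le ν (R := R) (by rw [L1L2.norm_phase_apply]; exact hF)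
    (by rw [L1L2.norm_phase_apply]; exact hG)).trans_eq ?_
  rw [← L1L2.phase_sub, L1L2.norm_phase_apply]

theorem continuous_pow (w : Weight V) (ν : ℕ) : Continuous (w.pow ν) := by
  rw [continuous_iff_continuousAt]
  intro F
  rw [ContinuousAt, tendsto_iff_norm_sub_tendsto_zero]
  have h1 : ∀ᶠ G in 𝓝 F, ‖G‖ ≤ ‖F‖ + 1 :=
    (continuous_norm.tendsto F).eventually (ge_mem_nhds (by linarith))
  have h2 : Tendsto (fun G => (2 * ν + 1) * (‖F‖ + 1) ^ (2 * ν) * ‖G - F‖) (𝓝 F) (𝓝 0) := by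
    have : Continuous fun G => (2 * ν + 1) * (‖F‖ + 1) ^ (2 * ν) * ‖G - F‖ := by fun_prop
    simpa using this.tendsto F
  refine squeeze_zero' (Eventually.of_forall fun _ => norm_nonneg _) ?_ h2
  filter_upwards [h1] with G hG
  exact w.norm_pow_sub_pow_le ν hG (by linarith)

theorem continuous_field (w : Weight V) (ν : ℕ) (μ : ℝ) (Λ : Symbol V) (F : L1L2 V) :
    Continuous fun t => field w ν μ Λ t F := by
  rw [← continuousOn_univ]
  refine ContinuousOn.const_smul (M := ℂ) ?_ _
  refine L1L2.continuousOn_phase_smul Λ continuousOn_id ?_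
  exact (continuous_pow w ν).comp_continuousOn
    (L1L2.continuousOn_phase_smul Λ continuousOn_id.neg continuousOn_const)

/-- The profile equation is solvable up to the time at which the nonlinear effect of data of size
`R` becomes of size `R`. -/
theorem exists_profile (w : Weight V) (ν : ℕ) (μ : ℝ) (Λ : Symbol V) {F₀ : L1L2 V} {R T : ℝ}
    (hF₀ : ‖F₀‖ ≤ R) (hT : 0 ≤ T) (hRT : |μ| * (2 * R) ^ (2 * ν + 1) * T ≤ R) :
    ∃ v : ℝ → L1L2 V, v 0 = F₀ ∧ ∀ t ∈ Set.Icc 0 T, ‖v t‖ ≤ 2 * R ∧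
      HasDerivWithinAt v (field w ν μ Λ t (v t)) (Set.Icc 0 T) t := by
  have hR : 0 ≤ R := (norm_nonneg _).trans hF₀
  have hball : ∀ x ∈ Metric.closedBall F₀ ((R.toNNReal : NNReal) : ℝ), ‖x‖ ≤ 2 * R := by
    intro x hx
    rw [Real.coe_toNNReal R hR, mem_closedBall_iff_norm] at hx
    calc ‖x‖ = ‖F₀ + (x - F₀)‖ := by rw [add_sub_cancel]
      _ ≤ ‖F₀‖ + ‖x - F₀‖ := norm_add_le _ _
      _ ≤ 2 * R := by linarith
  have hPL : IsPicardLindelof (field w ν μ Λ) (⟨0, le_rfl, hT⟩ : Set.Icc 0 T) F₀ R.toNNReal 0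
      (|μ| * (2 * R) ^ (2 * ν + 1)).toNNReal
      (|μ| * ((2 * ν + 1) * (2 * R) ^ (2 * ν))).toNNReal := by
    refine ⟨fun t _ => ?_, fun x _ => (continuous_field w ν μ Λ x).continuousOn, ?_, ?_⟩
    · refine LipschitzOnWith.of_dist_le_mul fun x hx y hy => ?_
      rw [Real.coe_toNNReal _ (by positivity), dist_eq_norm, dist_eq_norm]
      exact norm_field_sub_le w ν μ Λ t (hball x hx) (hball y hy)
    · intro t _ x hx
      rw [Real.coe_toNNReal _ (by positivity)]
      refine (norm_field_le w ν μ Λ t x).trans ?_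
      gcongr
      exact hball x hx
    · rw [Real.coe_toNNReal _ (by positivity), Real.coe_toNNReal _ hR]
      simpa [hT] using hRT
  obtain ⟨v, hv0, hv⟩ := exists_hasDerivWithinAt_mem_closedBall hPL
  exact ⟨v, hv0, fun t ht => ⟨hball _ (hv t ht).1, (hv t ht).2⟩⟩

/-- The `L²` class of `F / w`, as a function of `F`. -/
def baseLp (w : Weight V) (F : L1L2 V) : Lp (α := V) ℂ 2 (volume : Measure V) :=
  (w.memLp_base (L1L2.memLp_two F)).toLp _

theorem coe_baseLp (w : Weight V) (F : L1L2 V) : (baseLp w F : V → ℂ) =ᵐ[volume] w.base F :=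
  (w.memLp_base (L1L2.memLp_two F)).coeFn_toLp

theorem baseLp_add (w : Weight V) (F G : L1L2 V) :
    baseLp w (F + G) = baseLp w F + baseLp w G := by
  apply Lp.ext
  filter_upwards [coe_baseLp w (F + G), coe_baseLp w F, coe_baseLp w G,
    Lp.coeFn_add (baseLp w F) (baseLp w G), L1L2.coe_add F G] with x e1 e2 e3 e4 e5
  rw [e1, e4, Pi.add_apply, e2, e3, Weight.base, Weight.base, Weight.base, e5, mul_add]

theorem baseLp_smul (w : Weight V) (c : ℂ) (F : L1L2 V) :
    baseLp w (c • F) = c • baseLp w F := by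
  apply Lp.ext
  filter_upwards [coe_baseLp w (c • F), coe_baseLp w F, Lp.coeFn_smul c (baseLp w F),
    L1L2.coe_smul c F] with x e1 e2 e3 e4
  rw [e1, e3, Pi.smul_apply, e2, Weight.base, Weight.base, e4, smul_eq_mul]
  ring

theorem norm_baseLp_le (w : Weight V) (F : L1L2 V) : ‖baseLp w F‖ ≤ ‖F‖ := by
  rw [Lp.norm_def, eLpNorm_congr_ae (coe_baseLp w F)]
  refine ENNReal.toReal_le_of_le_ofReal (norm_nonneg _) (le_trans ?_ (L1L2.eLpNorm_two_le F))
  exact eLpNorm_mono fun x => w.norm_base_le F x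

/-- The `L²` class of `F / w`, as a continuous linear map. -/
def baseL2 (w : Weight V) : L1L2 V →L[ℂ] Lp (α := V) ℂ 2 (volume : Measure V) :=
  LinearMap.mkContinuous ⟨⟨baseLp w, baseLp_add w⟩, baseLp_smul w⟩ 1 fun F => by
    rw [one_mul]
    exact norm_baseLp_le w F

theorem coe_baseL2 (w : Weight V) (F : L1L2 V) : (baseL2 w F : V → ℂ) =ᵐ[volume] w.base F :=
  coe_baseLp w F

theorem baseL2_phase (w : Weight V) (h : Symbol V) (F : L1L2 V) :
    baseL2 w (L1L2.phase h F) = phaseL2 h (baseL2 w F) := by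
  apply Lp.ext
  filter_upwards [coe_baseL2 w (L1L2.phase h F), coe_phaseL2 h (baseL2 w F), coe_baseL2 w F,
    w.base_phase h F] with x e1 e2 e3 e4
  rw [e1, e2, e3, e4]

/-- The function whose Fourier transform is `F / w`. -/
def physical (w : Weight V) : L1L2 V →L[ℂ] Lp (α := V) ℂ 2 (volume : Measure V) :=
  (FourierTransform.fourierInvCLM ℂ (Lp (α := V) ℂ 2 (volume : Measure V))).comp (baseL2 w)

theorem physical_apply (w : Weight V) (F : L1L2 V) : physical w F = 𝓕⁻ (baseL2 w F) := rfl

theorem fourier_physical (w : Weight V) (F : L1L2 V) : 𝓕 (physical w F) = baseL2 w F :=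
  FourierTransform.fourier_fourierInv_eq _

theorem coe_physical (w : Weight V) (F : L1L2 V) :
    (physical w F : V → ℂ) =ᵐ[volume] 𝓕⁻ (w.base F) :=
  coe_fourierInv_toL2 (w.integrable_base F) (baseL2 w F) (coe_baseL2 w F)

/-- The norm of `L¹ ∩ L²` controls the `L^∞` norm on the physical side. -/
theorem ae_norm_physical_le (w : Weight V) (F : L1L2 V) : ∀ᵐ x, ‖physical w F x‖ ≤ ‖F‖ := by
  filter_upwards [coe_physical w F] with x hx
  rw [hx]
  refine (norm_fourierInv_le _ x).trans (le_trans ?_ (L1L2.integral_norm_le F))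
  exact integral_mono (w.integrable_base F).norm (L1L2.integrable F).norm
    fun x => w.norm_base_le F x

/-- The operator `w.pow k` is the nonlinearity `u ↦ |u|^(2k) u` on the physical side. -/
theorem coe_physical_pow (w : Weight V) (k : ℕ) (F : L1L2 V) :
    (physical w (w.pow k F) : V → ℂ) =ᵐ[volume]
      fun x => ((‖physical w F x‖ ^ (2 * k) : ℝ) : ℂ) * physical w F x := by
  have h : 𝓕⁻ (w.base (w.pow k F)) = 𝓕⁻ (powFun k (w.base F)) := by
    funext x
    rw [Real.fourierInv_eq, Real.fourierInv_eq]
    refine integral_congr_ae ?_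
    filter_upwards [w.base_pow k F] with v hv
    rw [hv]
  filter_upwards [coe_physical w (w.pow k F), coe_physical w F] with x e1 e2
  rw [e1, h, fourierInv_powFun (w.integrable_base F), e2]

end General

/-! ### From the profile equation to the Schrödinger equation -/

section

theorem hasDerivWithinAt_clm_apply {E F : Type*} [NormedAddCommGroup E] [NormedSpace ℂ E]
    [NormedAddCommGroup F] [NormedSpace ℂ F] (L : E →L[ℂ] F) {y : ℝ → E} {y' : E} {s : Set ℝ}
    {t : ℝ} (hy : HasDerivWithinAt y y' s t) :
    HasDerivWithinAt (fun r => L (y r)) (L y') s t :=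
  (L.restrictScalars ℝ).hasFDerivAt.comp_hasDerivWithinAt t hy

theorem hasDerivWithinAt_bilin_left {E F : Type*} [NormedAddCommGroup E] [NormedSpace ℂ E]
    [NormedAddCommGroup F] [NormedSpace ℂ F] (B : E →L[ℂ] F →L[ℂ] ℂ) {y : ℝ → E} {y' : E}
    {s : Set ℝ} {t : ℝ} (hy : HasDerivWithinAt y y' s t) (g : F) :
    HasDerivWithinAt (fun r => B (y r) g) (B y' g) s t :=
  hasDerivWithinAt_clm_apply (B.flip g) hy

section General

variable {V : Type*} [NormedAddCommGroup V] [InnerProductSpace ℝ V] [FiniteDimensional ℝ V]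
  [MeasurableSpace V] [BorelSpace V]

theorem baseL2_smul (w : Weight V) (c : ℂ) (F : L1L2 V) :
    baseL2 w (c • F) = c • baseL2 w F := baseLp_smul w c F

theorem pairing_smul_left (c : ℂ) (f g : Lp (α := V) ℂ 2 (volume : Measure V)) :
    pairing V (c • f) g = c * pairing V f g :=
  ContinuousLinearMap.map_smul₂ (pairing V) c f g

theorem pairing_neg_smul_right (c : ℂ) (f g : Lp (α := V) ℂ 2 (volume : Measure V)) :
    pairing V f (-(c • g)) = -(c * pairing V f g) := by
  rw [map_neg, map_smul, smul_eq_mul]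

theorem phase_neg_smul_field (w : Weight V) (ν : ℕ) (μ : ℝ) (Λ : Symbol V) (t : ℝ)
    (F : L1L2 V) : L1L2.phase ((-t) • Λ) (field w ν μ Λ t F)
      = (-Complex.I * (μ : ℂ)) • w.pow ν (L1L2.phase ((-t) • Λ) F) := by
  have h : (-t) • Λ + t • Λ = 0 := by rw [← add_smul, neg_add_cancel, zero_smul]
  generalize hG : w.pow ν (L1L2.phase ((-t) • Λ) F) = G
  have h1 : L1L2.phase ((-t) • Λ) (L1L2.phase (t • Λ) G) = G := by
    rw [L1L2.phase_phase, h, L1L2.phase_zero]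
  rw [field, hG, L1L2.phase_smul, h1]

/-- In the pairing with a free evolution, the phases of the vector field cancel. -/
theorem pairing_baseL2_field (w : Weight V) (ν : ℕ) (μ : ℝ) (Λ : Symbol V) (t : ℝ)
    (F : L1L2 V) (g : Lp (α := V) ℂ 2 (volume : Measure V)) :
    pairing V (baseL2 w (field w ν μ Λ t F)) (phaseL2 ((-t) • Λ) g)
      = -Complex.I * (μ : ℂ) *
        pairing V (baseL2 w (w.pow ν (L1L2.phase ((-t) • Λ) F))) g := by
  rw [← pairing_phaseL2, ← baseL2_phase, phase_neg_smul_field, baseL2_smul, pairing_smul_left]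

end General

variable {d : ℕ}

theorem integral_physical_phase_mul (w : Weight (Space d)) (h : Symbol (Space d))
    (F : L1L2 (Space d)) (θ : 𝓢(Space d, ℂ)) :
    ∫ x, (physical w (L1L2.phase h F) : Space d → ℂ) x * θ x
      = pairing (Space d) (baseL2 w F)
        (phaseL2 h ((𝓕⁻ θ : 𝓢(Space d, ℂ)).toLp 2 volume)) := by
  rw [integral_mul_eq_pairing_fourier, fourier_physical, baseL2_phase, pairing_phaseL2]

theorem integral_physical_phase_mul_etaLaplacian (w : Weight (Space d)) (η : Fin d → ℝ)
    (h : Symbol (Space d)) (F : L1L2 (Space d)) (θ : 𝓢(Space d, ℂ)) :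
    ∫ x, (physical w (L1L2.phase h F) : Space d → ℂ) x * etaLaplacian η θ x
      = -2 * pairing (Space d) (baseL2 w F)
        (phaseL2 h ((symbolMul η (𝓕⁻ θ)).toLp 2 volume)) := by
  rw [integral_mul_etaLaplacian η _ θ (symbolMul η (𝓕⁻ θ)) (fun ζ => symbolMul_apply η _ ζ),
    fourier_physical, baseL2_phase, pairing_phaseL2]

theorem integral_power_physical_mul (w : Weight (Space d)) (ν : ℕ) (F : L1L2 (Space d))
    (θ : 𝓢(Space d, ℂ)) :
    ∫ x, ((‖(physical w F : Space d → ℂ) x‖ ^ (2 * ν) : ℝ) : ℂ) *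
        (physical w F : Space d → ℂ) x * θ x
      = pairing (Space d) (baseL2 w (w.pow ν F)) ((𝓕⁻ θ : 𝓢(Space d, ℂ)).toLp 2 volume) := by
  rw [← fourier_physical, ← integral_mul_eq_pairing_fourier]
  refine integral_congr_ae ?_
  filter_upwards [coe_physical_pow w ν F] with x hx
  rw [hx]

theorem hasDerivAt_phaseL2_neg (η : Fin d → ℝ) (g : 𝓢(Space d, ℂ)) (t : ℝ) :
    HasDerivAt (fun r : ℝ => phaseL2 ((-r) • symbol η) (g.toLp 2 volume))
      (-(Complex.I • phaseL2 ((-t) • symbol η) ((symbolMul η g).toLp 2 volume))) t := by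
  have := (hasDerivAt_phaseL2_schwartz η g (-t)).scomp t (hasDerivAt_neg t)
  rw [neg_one_smul] at this
  exact this

/-- The product rule for the pairing of a differentiable profile with the free evolution of a
Schwartz function. -/
theorem hasDerivWithinAt_pairing_profile (w : Weight (Space d)) {η : Fin d → ℝ}
    {v : ℝ → L1L2 (Space d)} {v' : L1L2 (Space d)} {s : Set ℝ} {t : ℝ}
    (hv : HasDerivWithinAt v v' s t) (g : 𝓢(Space d, ℂ)) :
    HasDerivWithinAt (fun r => pairing (Space d) (baseL2 w (v r))
        (phaseL2 ((-r) • symbol η) (g.toLp 2 volume)))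
      (pairing (Space d) (baseL2 w v') (phaseL2 ((-t) • symbol η) (g.toLp 2 volume))
        + pairing (Space d) (baseL2 w (v t))
          (-(Complex.I • phaseL2 ((-t) • symbol η) ((symbolMul η g).toLp 2 volume)))) s t := by
  have hyd := hasDerivWithinAt_clm_apply (baseL2 w) hv
  exact hasDerivWithinAt_bilin (pairing (Space d)) hyd.continuousWithinAt
    (hasDerivAt_phaseL2_neg η g t) (hasDerivWithinAt_bilin_left (pairing (Space d)) hyd _)

/-- A solution of the profile equation gives a solution of the nonlinear Schrödinger equation. -/
theorem isSolution_of_profile (w : Weight (Space d)) {η : Fin d → ℝ} {ν : ℕ} {μ : ℝ}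
    {φ : 𝓢(Space d, ℂ)} {T : ℝ} {v : ℝ → L1L2 (Space d)}
    (hv0 : physical w (v 0) = φ.toLp 2 volume)
    (hv : ∀ t ∈ Set.Icc 0 T,
      HasDerivWithinAt v (field w ν μ (symbol η) t (v t)) (Set.Icc 0 T) t) :
    IsSolution η ν μ φ T (fun t => physical w (L1L2.phase ((-t) • symbol η) (v t))) := by
  have hvc : ContinuousOn v (Set.Icc 0 T) := fun t ht => (hv t ht).continuousWithinAt
  have hU : ContinuousOn (fun t => L1L2.phase ((-t) • symbol η) (v t)) (Set.Icc 0 T) :=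
    L1L2.continuousOn_phase_smul _ continuousOn_id.neg hvc
  refine ⟨(physical w).continuous.comp_continuousOn hU, fun t _ => ?_, fun t ht => ?_, ?_, ?_⟩
  · exact memLp_top_of_bound (Lp.aestronglyMeasurable _) _ (ae_norm_physical_le w _)
  · have h1 : Tendsto (fun r => ENNReal.ofReal ‖L1L2.phase ((-r) • symbol η) (v r)
        - L1L2.phase ((-t) • symbol η) (v t)‖) (𝓝[Set.Icc 0 T] t) (𝓝 0) := by
      have := (tendsto_iff_norm_sub_tendsto_zero.mp (hU t ht))
      have h2 := (ENNReal.continuous_ofReal.tendsto 0).comp this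
      rwa [ENNReal.ofReal_zero] at h2
    refine tendsto_of_tendsto_of_tendsto_of_le_of_le tendsto_const_nhds h1 (fun _ => zero_le)
      fun r => ?_
    have h3 := (physical w).map_sub (L1L2.phase ((-r) • symbol η) (v r))
      (L1L2.phase ((-t) • symbol η) (v t))
    rw [← h3, eLpNorm_exponent_top]
    exact eLpNormEssSup_le_of_ae_bound (ae_norm_physical_le w _)
  · simp only [neg_zero, zero_smul, L1L2.phase_zero]
    exact hv0
  · intro θ t ht
    have hmain := (hasDerivWithinAt_pairing_profile w (η := η) (hv t ht)
      (𝓕⁻ θ)).congr_of_eventuallyEq (Eventually.of_forall fun r =>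
        integral_physical_phase_mul w ((-r) • symbol η) (v r) θ)
      (integral_physical_phase_mul w ((-t) • symbol η) (v t) θ)
    refine hmain.congr_deriv ?_
    have halg : ∀ a p : ℂ, -Complex.I * (μ : ℂ) * p + -(Complex.I * a)
        = Complex.I / 2 * (-2 * a) - Complex.I * (μ : ℂ) * p := by
      intro a p; ring
    have e1 := pairing_baseL2_field w ν μ (symbol η) t (v t)
      ((𝓕⁻ θ : 𝓢(Space d, ℂ)).toLp 2 volume)
    have e2 := pairing_neg_smul_right Complex.I (baseL2 w (v t))
      (phaseL2 ((-t) • symbol η) ((symbolMul η (𝓕⁻ θ)).toLp 2 volume))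
    have e3 := integral_physical_phase_mul_etaLaplacian w η ((-t) • symbol η) (v t) θ
    have e4 := integral_power_physical_mul w ν (L1L2.phase ((-t) • symbol η) (v t)) θ
    exact (congrArg₂ (· + ·) e1 e2).trans ((halg _ _).trans (congrArg₂ (· - ·)
      (congrArg (Complex.I / 2 * ·) e3.symm) (congrArg (Complex.I * (μ : ℂ) * ·) e4.symm)))

end

/-! ### Low frequencies of the profile -/

section General

variable {V : Type*} [NormedAddCommGroup V] [InnerProductSpace ℝ V] [FiniteDimensional ℝ V]
  [MeasurableSpace V] [BorelSpace V]

/-- Galilean invariance: the nonlinearity commutes with the phases of additive symbols, so that the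
profile equation only sees the symbol up to an additive function. -/
theorem field_sub_additive (w : Weight V) (ν : ℕ) (μ : ℝ) (Λ : Symbol V) {b : Symbol V}
    (hb : ∀ x y, b (x + y) = b x + b y) (t : ℝ) (F : L1L2 V) :
    field w ν μ (Λ - b) t F = field w ν μ Λ t F := by
  have hb' : ∀ x y, ((-t) • b) (x + y) = ((-t) • b) x + ((-t) • b) y := by
    intro x y
    simp only [ContinuousMap.smul_apply, hb, smul_add]
  have h1 : (-t) • Λ = (-t) • b + (-t) • (Λ - b) := by rw [← smul_add, add_sub_cancel]
  have h2 : t • Λ + (-t) • b = t • (Λ - b) := by rw [neg_smul, ← sub_eq_add_neg, smul_sub]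
  have h3 : w.pow ν (L1L2.phase ((-t) • Λ) F)
      = L1L2.phase ((-t) • b) (w.pow ν (L1L2.phase ((-t) • (Λ - b)) F)) := by
    rw [h1, ← L1L2.phase_phase, w.pow_phase hb']
  rw [field, field, h3]
  generalize w.pow ν (L1L2.phase ((-t) • (Λ - b)) F) = G
  rw [L1L2.phase_phase, h2]

/-- The integral over `B` of `F / w`. -/
def localIntegral (w : Weight V) (B : Set V) : L1L2 V →L[ℂ] ℂ :=
  LinearMap.mkContinuous
    { toFun := fun F => ∫ x in B, w.base F x
      map_add' := fun F G => by
        rw [← integral_add (w.integrable_base F).integrableOn (w.integrable_base G).integrableOn]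
        refine integral_congr_ae (ae_restrict_of_ae ?_)
        filter_upwards [L1L2.coe_add F G] with x hx
        rw [Weight.base, hx, mul_add, Weight.base, Weight.base]
      map_smul' := fun c F => by
        rw [RingHom.id_apply, smul_eq_mul, ← integral_const_mul]
        refine integral_congr_ae (ae_restrict_of_ae ?_)
        filter_upwards [L1L2.coe_smul c F] with x hx
        rw [Weight.base, hx, Weight.base]
        ring } 1 fun F => by
    rw [one_mul]
    refine (norm_integral_le_integral_norm _).trans (le_trans ?_ (L1L2.integral_norm_le F))
    refine (setIntegral_le_integral (w.integrable_base F).norm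
      (Eventually.of_forall fun x => norm_nonneg _)).trans ?_
    exact integral_mono (w.integrable_base F).norm (L1L2.integrable F).norm
      fun x => w.norm_base_le F x

theorem localIntegral_apply (w : Weight V) (B : Set V) (F : L1L2 V) :
    localIntegral w B F = ∫ x in B, w.base F x := rfl

theorem norm_localIntegral_le (w : Weight V) (B : Set V) (F : L1L2 V) :
    ‖localIntegral w B F‖ ≤ ‖F‖ := by
  have h := (localIntegral w B).le_of_opNorm_le
    (LinearMap.mkContinuous_norm_le _ zero_le_one _) F
  rwa [one_mul] at h

/-- Phases move `F` by an amount that only depends on the size of the symbol on the support of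
`F`. -/
theorem norm_phase_smul_sub_le {Λ : Symbol V} {M : ℝ} (hM : 0 ≤ M) {F : L1L2 V}
    (hΛ : ∀ᵐ x, F x ≠ 0 → |Λ x| ≤ M) (t : ℝ) :
    ‖L1L2.phase (t • Λ) F - F‖ ≤ |t| * M * ‖F‖ := by
  refine L1L2.norm_le_of_ae_le (by positivity) ?_
  filter_upwards [L1L2.coe_sub (L1L2.phase (t • Λ) F) F, L1L2.coe_phase (t • Λ) F, hΛ]
    with x e1 e2 e3
  rw [e1, e2]
  by_cases h0 : F x = 0
  · simp [h0]
  · rw [← sub_one_mul, norm_mul]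
    gcongr
    refine (Real.norm_exp_I_mul_ofReal_sub_one_le).trans ?_
    rw [ContinuousMap.smul_apply, smul_eq_mul, Real.norm_eq_abs, abs_mul]
    gcongr
    exact e3 h0

theorem norm_localIntegral_phase_smul_sub_le (w : Weight V) {B : Set V} (hB : MeasurableSet B)
    {Λ : Symbol V} {M : ℝ} (hM : 0 ≤ M) (hΛ : ∀ x ∈ B, |Λ x| ≤ M) (F : L1L2 V) (t : ℝ) :
    ‖localIntegral w B (L1L2.phase (t • Λ) F) - localIntegral w B F‖ ≤ |t| * M * ‖F‖ := by
  rw [localIntegral_apply, localIntegral_apply,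
    ← integral_sub (w.integrable_base _).integrableOn (w.integrable_base _).integrableOn]
  have h1 : ∫ x in B, |t| * M * ‖F x‖ ≤ |t| * M * ‖F‖ := by
    rw [integral_const_mul]
    gcongr
    exact (setIntegral_le_integral (L1L2.integrable F).norm
      (Eventually.of_forall fun x => norm_nonneg _)).trans (L1L2.integral_norm_le F)
  refine (norm_integral_le_of_norm_le ((L1L2.integrable F).norm.integrableOn.const_mul _) ?_).trans
    h1
  filter_upwards [ae_restrict_of_ae (w.base_phase (t • Λ) F), ae_restrict_mem hB] with x e1 hx
  rw [e1, ← sub_one_mul, norm_mul]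
  gcongr
  · refine (Real.norm_exp_I_mul_ofReal_sub_one_le).trans ?_
    rw [ContinuousMap.smul_apply, smul_eq_mul, Real.norm_eq_abs, abs_mul]
    gcongr
    exact hΛ x hx
  · exact w.norm_base_le F x

/-- To first order in time, the mass that the nonlinearity transfers to `B` is the one which it
creates from the initial data. -/
theorem norm_localIntegral_profile_le (w : Weight V) (ν : ℕ) (μ : ℝ) {Λ : Symbol V} {B : Set V}
    (hB : MeasurableSet B) {M R T : ℝ} (hM : 0 ≤ M) (hT : 0 ≤ T) {v : ℝ → L1L2 V}
    (hΛB : ∀ x ∈ B, |Λ x| ≤ M) (hΛ : ∀ᵐ x, v 0 x ≠ 0 → |Λ x| ≤ M)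
    (hv : ∀ t ∈ Set.Icc 0 T, ‖v t‖ ≤ R ∧
      HasDerivWithinAt v (field w ν μ Λ t (v t)) (Set.Icc 0 T) t) :
    ‖localIntegral w B (v T) - localIntegral w B (v 0)
        + Complex.I * μ * T * localIntegral w B (w.pow ν (v 0))‖
      ≤ |μ| * R ^ (2 * ν + 1) * T * ((2 * ν + 2) * (T * (M + |μ| * R ^ (2 * ν)))) := by
  have h0 : (0 : ℝ) ∈ Set.Icc 0 T := ⟨le_rfl, hT⟩
  have hR : 0 ≤ R := (norm_nonneg _).trans (hv 0 h0).1
  have hconv : Convex ℝ (Set.Icc 0 T) := convex_Icc 0 T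
  set L := localIntegral w B with hL
  -- The profile moves at the speed of the nonlinearity.
  have hvt : ∀ t ∈ Set.Icc 0 T, ‖v t - v 0‖ ≤ |μ| * R ^ (2 * ν + 1) * t := by
    intro t ht
    have := hconv.norm_image_sub_le_of_norm_hasDerivWithin_le (C := |μ| * R ^ (2 * ν + 1))
      (fun x hx => (hv x hx).2) (fun x hx => ?_) h0 ht
    · simpa [abs_of_nonneg ht.1] using this
    · refine (norm_field_le w ν μ Λ x (v x)).trans ?_
      gcongr
      exact (hv x hx).1
  have hder : ∀ t ∈ Set.Icc 0 T, HasDerivWithinAt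
      (fun r : ℝ => L (v r) + Complex.I * μ * r * L (w.pow ν (v 0)))
      (L (field w ν μ Λ t (v t)) + Complex.I * μ * L (w.pow ν (v 0))) (Set.Icc 0 T) t := by
    intro t ht
    refine (hasDerivWithinAt_clm_apply L (hv t ht).2).add ?_
    have := ((Complex.ofRealCLM.hasDerivWithinAt (s := Set.Icc 0 T) (x := t)).const_mul
      (Complex.I * μ)).mul_const (L (w.pow ν (v 0)))
    simpa using this
  have hbound : ∀ t ∈ Set.Icc 0 T,
      ‖L (field w ν μ Λ t (v t)) + Complex.I * μ * L (w.pow ν (v 0))‖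
        ≤ |μ| * R ^ (2 * ν + 1) * ((2 * ν + 2) * (T * (M + |μ| * R ^ (2 * ν)))) := by
    intro t ht
    set G := L1L2.phase ((-t) • Λ) (v t) with hG
    have hGn : ‖G‖ ≤ R := by rw [hG, L1L2.norm_phase_apply]; exact (hv t ht).1
    -- The two sources of error: the phase which acts after the nonlinearity, on `B`, and the
    -- difference between the argument of the nonlinearity and the initial data.
    have hsplit : L (field w ν μ Λ t (v t)) + Complex.I * μ * L (w.pow ν (v 0))
        = -Complex.I * μ * ((L (L1L2.phase (t • Λ) (w.pow ν G)) - L (w.pow ν G))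
          + (L (w.pow ν G - w.pow ν (v 0)))) := by
      have : L (field w ν μ Λ t (v t)) = -Complex.I * μ * L (L1L2.phase (t • Λ) (w.pow ν G)) :=
        L.map_smul _ _
      rw [this, map_sub]
      ring
    have hP : ‖w.pow ν G‖ ≤ R ^ (2 * ν + 1) :=
      (w.norm_pow_le ν G).trans (by gcongr)
    have h1 : ‖L (L1L2.phase (t • Λ) (w.pow ν G)) - L (w.pow ν G)‖ ≤ T * M * R ^ (2 * ν + 1) := by
      refine (norm_localIntegral_phase_smul_sub_le w hB hM hΛB _ t).trans ?_
      rw [abs_of_nonneg ht.1]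
      have := ht.2
      gcongr
    have hGv : ‖G - v 0‖ ≤ T * (M + |μ| * R ^ (2 * ν)) * R := by
      have e : G - v 0 = L1L2.phase ((-t) • Λ) (v t - v 0)
          + (L1L2.phase ((-t) • Λ) (v 0) - v 0) := by
        rw [L1L2.phase_sub, hG]; abel
      rw [e]
      refine (norm_add_le _ _).trans ?_
      have e1 : ‖L1L2.phase ((-t) • Λ) (v t - v 0)‖ ≤ |μ| * R ^ (2 * ν + 1) * T := by
        rw [L1L2.norm_phase_apply]
        exact (hvt t ht).trans (by gcongr; exact ht.2)
      have e2 : ‖L1L2.phase ((-t) • Λ) (v 0) - v 0‖ ≤ T * M * R := by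
        refine (norm_phase_smul_sub_le hM hΛ (-t)).trans ?_
        rw [abs_neg, abs_of_nonneg ht.1]
        have := ht.2
        have := (hv 0 h0).1
        gcongr
      refine (add_le_add e1 e2).trans_eq ?_
      ring
    have h2 : ‖L (w.pow ν G - w.pow ν (v 0))‖
        ≤ (2 * ν + 1) * R ^ (2 * ν) * (T * (M + |μ| * R ^ (2 * ν)) * R) := by
      refine (norm_localIntegral_le w B _).trans ?_
      refine (w.norm_pow_sub_pow_le ν hGn (hv 0 h0).1).trans ?_
      gcongr
    rw [hsplit, norm_mul, norm_mul, norm_neg, Complex.norm_I, one_mul, Complex.norm_real,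
      Real.norm_eq_abs]
    have h3 := (norm_add_le (L (L1L2.phase (t • Λ) (w.pow ν G)) - L (w.pow ν G))
      (L (w.pow ν G - w.pow ν (v 0)))).trans (add_le_add h1 h2)
    rw [mul_assoc]
    refine mul_le_mul_of_nonneg_left (h3.trans ?_) (abs_nonneg μ)
    have h4 : T * M * R ^ (2 * ν + 1) ≤ T * (M + |μ| * R ^ (2 * ν)) * R ^ (2 * ν + 1) := by
      gcongr
      exact le_add_of_nonneg_right (by positivity)
    refine (add_le_add_left h4 _).trans_eq ?_
    ring
  have := hconv.norm_image_sub_le_of_norm_hasDerivWithin_le hder hbound h0 ⟨hT, le_rfl⟩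
  simp only [sub_zero, Real.norm_eq_abs, abs_of_nonneg hT, Complex.ofReal_zero, mul_zero,
    zero_mul, add_zero] at this
  have e : L (v T) - L (v 0) + Complex.I * μ * T * L (w.pow ν (v 0))
      = L (v T) + Complex.I * μ * T * L (w.pow ν (v 0)) - L (v 0) := by ring
  rw [e]
  refine this.trans_eq ?_
  ring

end General

/-! ### Convolution powers of nonnegative functions -/

section Positive

variable {V : Type*} [NormedAddCommGroup V] [InnerProductSpace ℝ V] [FiniteDimensional ℝ V]
  [MeasurableSpace V] [BorelSpace V]

/-- Continuous nonnegative functions of compact support. -/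
structure IsBump (f : V → ℝ) : Prop where
  continuous : Continuous f
  hasCompactSupport : HasCompactSupport f
  nonneg : ∀ x, 0 ≤ f x

/-- The convolution `∫ f(t) g(x - t) dt` of real functions. -/
def rconv (f g : V → ℝ) : V → ℝ := f ⋆[ContinuousLinearMap.mul ℝ ℝ, volume] g

theorem rconv_apply (f g : V → ℝ) (x : V) : rconv f g x = ∫ t, f t * g (x - t) := rfl

theorem cconv_ofReal (f g : V → ℝ) :
    cconv (fun x => (f x : ℂ)) (fun x => (g x : ℂ)) = fun x => (rconv f g x : ℂ) := by
  funext x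
  rw [cconv_apply, rconv_apply, ← integral_complex_ofReal]
  simp only [Complex.ofReal_mul]

/-- The convolution of two translates is a translate of the convolution. -/
theorem rconv_sub (f g : V → ℝ) (a b x : V) :
    rconv (fun y => f (y - a)) (fun y => g (y - b)) x = rconv f g (x - (a + b)) := by
  rw [rconv_apply, rconv_apply,
    ← integral_sub_right_eq_self (fun t => f t * g (x - (a + b) - t)) a]
  refine integral_congr_ae (Eventually.of_forall fun t => ?_)
  change f (t - a) * g (x - t - b) = f (t - a) * g (x - (a + b) - (t - a))
  congr 2
  abel

theorem rconv_const_mul (A B : ℝ) (f g : V → ℝ) :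
    rconv (fun y => A * f y) (fun y => B * g y) = fun x => A * B * rconv f g x := by
  funext x
  rw [rconv_apply, rconv_apply, ← integral_const_mul]
  refine integral_congr_ae (Eventually.of_forall fun t => ?_)
  change A * f t * (B * g (x - t)) = A * B * (f t * g (x - t))
  ring

namespace IsBump

variable {f f' g g' χ : V → ℝ}

theorem comp_neg (hf : IsBump f) : IsBump fun x => f (-x) :=
  ⟨hf.continuous.comp continuous_neg, hf.hasCompactSupport.comp_homeomorph (Homeomorph.neg V),
    fun x => hf.nonneg (-x)⟩

theorem comp_sub (hf : IsBump f) (a : V) : IsBump fun x => f (x - a) :=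
  ⟨hf.continuous.comp (continuous_id.sub continuous_const),
    hf.hasCompactSupport.comp_homeomorph (Homeomorph.subRight a), fun x => hf.nonneg (x - a)⟩

theorem add (hf : IsBump f) (hg : IsBump g) : IsBump fun x => f x + g x :=
  ⟨hf.continuous.add hg.continuous, hf.hasCompactSupport.add hg.hasCompactSupport,
    fun x => add_nonneg (hf.nonneg x) (hg.nonneg x)⟩

theorem continuous_mul_sub (hf : IsBump f) (hg : IsBump g) (x : V) :
    Continuous fun t => f t * g (x - t) :=
  hf.continuous.mul (hg.continuous.comp (continuous_const.sub continuous_id))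

theorem hasCompactSupport_mul_sub (hf : IsBump f) (g : V → ℝ) (x : V) :
    HasCompactSupport fun t => f t * g (x - t) :=
  hf.hasCompactSupport.mul_right

theorem integrable_mul_sub (hf : IsBump f) (hg : IsBump g) (x : V) :
    Integrable fun t => f t * g (x - t) :=
  (hf.continuous_mul_sub hg x).integrable_of_hasCompactSupport (hf.hasCompactSupport_mul_sub g x)

theorem rconv (hf : IsBump f) (hg : IsBump g) : IsBump (rconv f g) :=
  ⟨hg.hasCompactSupport.continuous_convolution_right _ hf.continuous.locallyIntegrable
      hg.continuous,
    hf.hasCompactSupport.convolution _ hg.hasCompactSupport,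
    fun x => integral_nonneg fun t => mul_nonneg (hf.nonneg t) (hg.nonneg (x - t))⟩

theorem rconv_mono (hf : IsBump f) (hf' : IsBump f') (hg : IsBump g) (hg' : IsBump g')
    (h1 : ∀ x, f x ≤ f' x) (h2 : ∀ x, g x ≤ g' x) (x : V) : NLS.rconv f g x ≤ NLS.rconv f' g' x :=
  integral_mono (hf.integrable_mul_sub hg x) (hf'.integrable_mul_sub hg' x) fun t =>
    mul_le_mul (h1 t) (h2 (x - t)) (hg.nonneg (x - t)) (hf'.nonneg t)

theorem rconv_pos (hf : IsBump f) (hg : IsBump g) (hf0 : 0 < f 0) (hg0 : 0 < g 0) :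
    0 < NLS.rconv f g 0 := by
  refine (hf.continuous_mul_sub hg 0).integral_pos_of_hasCompactSupport_nonneg_nonzero
    (hf.hasCompactSupport_mul_sub g 0) (fun t => mul_nonneg (hf.nonneg t) (hg.nonneg (0 - t)))
    (x := 0) ?_
  simp only [sub_zero]
  exact (mul_pos hf0 hg0).ne'

end IsBump

/-- The real counterpart of `powFun`. -/
def realPow : ℕ → (V → ℝ) → V → ℝ
  | 0, f => f
  | k + 1, f => rconv (rconv f fun x => f (-x)) (realPow k f)

theorem powFun_ofReal (k : ℕ) (f : V → ℝ) :
    powFun k (fun x => (f x : ℂ)) = fun x => (realPow k f x : ℂ) := by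
  induction k with
  | zero => rfl
  | succ k ih =>
    have : conjNeg (fun x => (f x : ℂ)) = fun x => (f (-x) : ℂ) := by
      funext x
      exact Complex.conj_ofReal _
    rw [powFun, ih, this, cconv_ofReal f, cconv_ofReal, realPow]

theorem realPow_const_mul (k : ℕ) (A : ℝ) (f : V → ℝ) :
    realPow k (fun x => A * f x) = fun x => A ^ (2 * k + 1) * realPow k f x := by
  induction k with
  | zero => simp [realPow]
  | succ k ih =>
    rw [realPow, ih, rconv_const_mul A A f fun x => f (-x), rconv_const_mul, realPow]
    funext x
    ring

namespace IsBump

variable {f χ : V → ℝ}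

theorem realPow (hf : IsBump f) (k : ℕ) : IsBump (realPow k f) := by
  induction k with
  | zero => exact hf
  | succ k ih => exact (hf.rconv hf.comp_neg).rconv ih

theorem realPow_pos (hf : IsBump f) (h0 : 0 < f 0) (k : ℕ) : 0 < NLS.realPow k f 0 := by
  induction k with
  | zero => exact h0
  | succ k ih =>
    exact (hf.rconv hf.comp_neg).rconv_pos (hf.realPow k)
      (hf.rconv_pos hf.comp_neg h0 (by rwa [neg_zero])) ih

/-- A function which dominates translates of `χ` to three vertices `a`, `a + c`, `c` of a
parallelogram whose fourth vertex is the origin has convolution powers which dominate those of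
`χ`: the nonlinearity fills in the missing vertex. -/
theorem realPow_le_realPow_succ (hf : IsBump f) (hχ : IsBump χ) {a c : V}
    (h1 : ∀ x, χ (x - a) ≤ f x) (h2 : ∀ x, χ (x - (a + c)) ≤ f x) (h3 : ∀ x, χ (x - c) ≤ f x)
    (k : ℕ) (x : V) : NLS.realPow (k + 1) χ x ≤ NLS.realPow (k + 1) f x := by
  induction k generalizing x with
  | zero =>
    -- The frequencies `a`, `-(a + c)` and `c` add up to `0`.
    have e : ∀ y, NLS.rconv χ (fun z => χ (-z)) (y - (a + -(a + c)))
        ≤ NLS.rconv f (fun z => f (-z)) y := by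
      intro y
      rw [← rconv_sub]
      refine rconv_mono (hχ.comp_sub a) hf (hχ.comp_neg.comp_sub _) hf.comp_neg h1
        (fun z => ?_) y
      refine le_of_eq_of_le ?_ (h2 (-z))
      congr 1
      abel
    have e2 := rconv_mono ((hχ.rconv hχ.comp_neg).comp_sub (a + -(a + c)))
      (hf.rconv hf.comp_neg) (hχ.comp_sub c) hf e h3 x
    rw [rconv_sub] at e2
    refine le_of_eq_of_le ?_ e2
    have : x - (a + -(a + c) + c) = x := by abel
    rw [this]
    rfl
  | succ k ih =>
    -- The further factors contribute the frequencies `a` and `-a`.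
    have e : ∀ y, NLS.rconv χ (fun z => χ (-z)) y ≤ NLS.rconv f (fun z => f (-z)) y := by
      intro y
      have h := rconv_mono (hχ.comp_sub a) hf (hχ.comp_neg.comp_sub (-a)) hf.comp_neg h1
        (fun z => ?_) y
      · have e' := rconv_sub χ (fun z => χ (-z)) a (-a) y
        rw [add_neg_cancel, sub_zero] at e'
        exact e'.symm.le.trans h
      · refine le_of_eq_of_le ?_ (h1 (-z))
        congr 1
        abel
    exact rconv_mono (hχ.rconv hχ.comp_neg) (hf.rconv hf.comp_neg) (hχ.realPow (k + 1))
      (hf.realPow (k + 1)) e ih x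

theorem setIntegral_pos (hf : IsBump f) (h0 : 0 < f 0) {r : ℝ} (hr : 0 < r) :
    0 < ∫ x in Metric.ball 0 r, f x := by
  have hi : IntegrableOn f (Metric.ball 0 r) :=
    (hf.continuous.integrable_of_hasCompactSupport hf.hasCompactSupport).integrableOn
  rw [setIntegral_pos_iff_support_of_nonneg_ae (Eventually.of_forall hf.nonneg) hi]
  exact (hf.continuous.isOpen_support.inter Metric.isOpen_ball).measure_pos volume
    ⟨0, h0.ne', Metric.mem_ball_self hr⟩

end IsBump

theorem powFun_congr {f g : V → ℂ} (h : f =ᵐ[volume] g) (k : ℕ) :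
    powFun k f =ᵐ[volume] powFun k g := by
  induction k with
  | zero => exact h
  | succ k ih =>
    have h2 : conjNeg f =ᵐ[volume] conjNeg g := by
      filter_upwards [L1L2.ae_neg h] with x hx
      rw [conjNeg, conjNeg, hx]
    rw [powFun, powFun, cconv_congr h h2, cconv_congr EventuallyEq.rfl ih]

/-- A lower bound for the mass which the nonlinearity creates in `B`, when `F / w` dominates three
bumps of height `A` on a parallelogram. -/
theorem le_localIntegral_pow (w : Weight V) {f χ : V → ℝ} (hf : IsBump f) (hχ : IsBump χ) {a c : V}
    (h1 : ∀ x, χ (x - a) ≤ f x) (h2 : ∀ x, χ (x - (a + c)) ≤ f x) (h3 : ∀ x, χ (x - c) ≤ f x)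
    {k : ℕ} (hk : 1 ≤ k) {A : ℝ} (hA : 0 ≤ A) {F : L1L2 V}
    (hF : w.base F =ᵐ[volume] fun x => ((A * f x : ℝ) : ℂ)) (B : Set V) :
    A ^ (2 * k + 1) * ∫ x in B, realPow k χ x ≤ ‖localIntegral w B (w.pow k F)‖ := by
  obtain ⟨k, rfl⟩ := Nat.exists_eq_add_of_le' hk
  have e : localIntegral w B (w.pow (k + 1) F)
      = ((A ^ (2 * (k + 1) + 1) * ∫ x in B, realPow (k + 1) f x : ℝ) : ℂ) := by
    rw [localIntegral_apply, ← integral_const_mul, ← integral_complex_ofReal]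
    refine integral_congr_ae (ae_restrict_of_ae ?_)
    filter_upwards [w.base_pow (k + 1) F, powFun_congr hF (k + 1)] with x e1 e2
    rw [e1, e2, powFun_ofReal, realPow_const_mul]
  have hi : ∀ {g : V → ℝ}, IsBump g → IntegrableOn g B := fun hg =>
    (hg.continuous.integrable_of_hasCompactSupport hg.hasCompactSupport).integrableOn
  rw [e, Complex.norm_real]
  refine le_trans ?_ (le_abs_self _)
  refine mul_le_mul_of_nonneg_left ?_ (by positivity)
  exact integral_mono (hi (hχ.realPow _)) (hi (hf.realPow _))
    (hf.realPow_le_realPow_succ hχ h1 h2 h3 k)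

end Positive

/-! ### Exponential weights -/

section General

variable {V : Type*} [NormedAddCommGroup V] [InnerProductSpace ℝ V] [FiniteDimensional ℝ V]
  [MeasurableSpace V] [BorelSpace V]

/-- The weight `e^{ε|x|}`. -/
def expWeight {ε : ℝ} (hε : 0 ≤ ε) : Weight V where
  toFun x := Real.exp (ε * ‖x‖)
  continuous' := by fun_prop
  one_le x := Real.one_le_exp (by positivity)
  add_le x y := by
    rw [← Real.exp_add, ← mul_add]
    gcongr
    exact norm_add_le x y
  neg x := by rw [norm_neg]

theorem expWeight_apply {ε : ℝ} (hε : 0 ≤ ε) (x : V) :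
    expWeight hε x = Real.exp (ε * ‖x‖) := rfl

/-- The powers of `⟨2πx⟩` are dominated by every growing exponential. -/
theorem exists_bracket_rpow_le_exp (σ : ℝ) {ε : ℝ} (hε : 0 < ε) :
    ∃ C : ℝ, 0 ≤ C ∧ ∀ x : V,
      (1 + ‖(2 * Real.pi) • x‖ ^ 2) ^ (σ / 2) ≤ C * Real.exp (ε * ‖x‖) := by
  set k := ⌈σ⌉₊ with hk
  have hpi := Real.pi_pos
  refine ⟨(2 * Real.pi / ε) ^ k * (k.factorial * Real.exp (ε / (2 * Real.pi))), by positivity,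
    fun x => ?_⟩
  have h1 : (1 + ‖(2 * Real.pi) • x‖ ^ 2) ^ (σ / 2) ≤ (1 + 2 * Real.pi * ‖x‖) ^ k := by
    rw [norm_smul, Real.norm_of_nonneg (by positivity : 0 ≤ 2 * Real.pi)]
    have hy : 0 ≤ 2 * Real.pi * ‖x‖ := by positivity
    calc (1 + (2 * Real.pi * ‖x‖) ^ 2) ^ (σ / 2)
        ≤ (1 + (2 * Real.pi * ‖x‖) ^ 2) ^ ((k : ℝ) / 2) :=
          Real.rpow_le_rpow_of_exponent_le (by nlinarith)
            (div_le_div_of_nonneg_right (Nat.le_ceil σ) two_pos.le)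
      _ ≤ ((1 + 2 * Real.pi * ‖x‖) ^ 2) ^ ((k : ℝ) / 2) :=
          Real.rpow_le_rpow (by positivity) (by nlinarith) (by positivity)
      _ = (1 + 2 * Real.pi * ‖x‖) ^ k := by
          rw [← Real.rpow_natCast _ 2, ← Real.rpow_mul (by positivity), ← Real.rpow_natCast _ k]
          congr 1
          push_cast
          ring
  refine h1.trans ?_
  have h2 : 1 + 2 * Real.pi * ‖x‖ = 2 * Real.pi / ε * (ε / (2 * Real.pi) + ε * ‖x‖) := by
    field_simp
  have h3 := Real.pow_div_factorial_le_exp (ε / (2 * Real.pi) + ε * ‖x‖) (by positivity) k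
  rw [div_le_iff₀ (by positivity), Real.exp_add] at h3
  rw [h2, mul_pow]
  calc (2 * Real.pi / ε) ^ k * (ε / (2 * Real.pi) + ε * ‖x‖) ^ k
      ≤ (2 * Real.pi / ε) ^ k *
        (Real.exp (ε / (2 * Real.pi)) * Real.exp (ε * ‖x‖) * k.factorial) := by gcongr
    _ = _ := by ring

/-! ### Sums of three bumps -/

/-- The element `w f` of `L¹ ∩ L²`, which stands for the continuous function `f` of compact
support. -/
def ofBump (w : Weight V) {f : V → ℝ} (hf : IsBump f) : L1L2 V :=
  have hc : Continuous fun x => ((w x * f x : ℝ) : ℂ) :=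
    Complex.continuous_ofReal.comp (w.cont.mul hf.continuous)
  have hs : HasCompactSupport fun x => ((w x * f x : ℝ) : ℂ) :=
    (hf.hasCompactSupport.mul_left (f := w)).comp_left Complex.ofReal_zero
  L1L2.ofFun _ (hc.memLp_of_hasCompactSupport hs) (hc.memLp_of_hasCompactSupport hs)

theorem coe_ofBump (w : Weight V) {f : V → ℝ} (hf : IsBump f) :
    (ofBump w hf : V → ℂ) =ᵐ[volume] fun x => ((w x * f x : ℝ) : ℂ) := L1L2.coe_ofFun ..

theorem base_ofBump (w : Weight V) {f : V → ℝ} (hf : IsBump f) :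
    w.base (ofBump w hf) =ᵐ[volume] fun x => (f x : ℂ) := by
  refine (w.base_congr (coe_ofBump w hf)).trans (Eventually.of_forall fun x => ?_)
  have := (w.pos x).ne'
  rw [Weight.base, ← Complex.ofReal_mul, inv_mul_cancel_left₀ this]

/-- The sum of the translates of `χ` by `a`, `a + c` and `c`. -/
def threeBumps (χ : V → ℝ) (a c : V) : V → ℝ := fun x => χ (x - a) + χ (x - (a + c)) + χ (x - c)

theorem IsBump.threeBumps {χ : V → ℝ} (hχ : IsBump χ) (a c : V) : IsBump (threeBumps χ a c) :=
  ((hχ.comp_sub a).add (hχ.comp_sub (a + c))).add (hχ.comp_sub c)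

theorem eLpNorm_threeBumps_le {χ : V → ℝ} (hχ : IsBump χ) (a c : V) {p : ℝ≥0∞} (hp : 1 ≤ p) :
    eLpNorm (threeBumps χ a c) p volume ≤ 3 * eLpNorm χ p volume := by
  have hm : ∀ b : V, AEStronglyMeasurable (fun x => χ (x - b)) volume := fun b =>
    (hχ.comp_sub b).continuous.aestronglyMeasurable
  have he : ∀ b : V, eLpNorm (fun x => χ (x - b)) p volume = eLpNorm χ p volume := fun b =>
    eLpNorm_comp_measurePreserving hχ.continuous.aestronglyMeasurable
      (measurePreserving_sub_right volume b)
  refine (eLpNorm_add_le ((hm a).add (hm (a + c))) (hm c) hp).trans ?_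
  refine (add_le_add_left (eLpNorm_add_le (hm a) (hm (a + c)) hp) _).trans_eq ?_
  rw [he, he, he]
  ring

theorem norm_ofBump_threeBumps_le (w : Weight V) {χ : V → ℝ} (hχ : IsBump χ) (a c : V) {K X : ℝ}
    (hK : 0 ≤ K) (hX : 0 ≤ X) (hX1 : eLpNorm χ 1 volume ≤ ENNReal.ofReal X)
    (hX2 : eLpNorm χ 2 volume ≤ ENNReal.ofReal X)
    (hw : ∀ x, threeBumps χ a c x ≠ 0 → w x ≤ K) :
    ‖ofBump w (hχ.threeBumps a c)‖ ≤ K * (3 * X) := by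
  have hp : ∀ p : ℝ≥0∞, 1 ≤ p → eLpNorm χ p volume ≤ ENNReal.ofReal X →
      eLpNorm (ofBump w (hχ.threeBumps a c)) p volume ≤ ENNReal.ofReal (K * (3 * X)) := by
    intro p h1 hXp
    have h2 : eLpNorm (ofBump w (hχ.threeBumps a c)) p volume
        ≤ ENNReal.ofReal K * eLpNorm (threeBumps χ a c) p volume := by
      refine eLpNorm_le_mul_eLpNorm_of_ae_le_mul ?_ p
      filter_upwards [coe_ofBump w (hχ.threeBumps a c)] with x hx
      rw [hx, Complex.norm_real, norm_mul, Real.norm_of_nonneg (w.pos x).le]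
      by_cases h0 : threeBumps χ a c x = 0
      · simp [h0]
      · gcongr
        exact hw x h0
    refine h2.trans ?_
    rw [ENNReal.ofReal_mul hK, ENNReal.ofReal_mul (by norm_num), ENNReal.ofReal_ofNat]
    gcongr
    exact (eLpNorm_threeBumps_le hχ a c h1).trans (by gcongr)
  exact L1L2.norm_le_of_eLpNorm_le (by positivity) (hp 1 le_rfl hX1) (hp 2 (by norm_num) hX2)

/-- Smooth data of compact support on the Fourier side are Schwartz functions on the physical
side. -/
theorem exists_toLp_eq_physical (w : Weight V) {F : L1L2 V} {g : V → ℂ}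
    (hg : ContDiff ℝ (⊤ : ℕ∞) g) (hs : HasCompactSupport g) (hF : w.base F =ᵐ[volume] g) :
    ∃ φ : 𝓢(V, ℂ), physical w F = φ.toLp 2 volume := by
  refine ⟨𝓕⁻ (hs.toSchwartzMap hg), ?_⟩
  rw [← SchwartzMap.toLp_fourierInv_eq, physical_apply]
  congr 1
  apply Lp.ext
  filter_upwards [coe_baseL2 w F, hF, (hs.toSchwartzMap hg).coeFn_toLp 2 volume] with x e1 e2 e3
  rw [e1, e2, e3]
  rfl

end General

/-! ### Sobolev norms -/

section Sobolev

variable {d : ℕ}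

theorem sobolevNorm_physical (w : Weight (Space d)) (σ : ℝ) (F : L1L2 (Space d)) :
    sobolevNorm σ (physical w F) = eLpNorm (fun ζ : Space d =>
      (((1 + ‖(2 * Real.pi) • ζ‖ ^ 2) ^ (σ / 2) : ℝ) : ℂ) * baseL2 w F ζ) 2 volume := by
  rw [sobolevNorm, fourier_physical]

theorem norm_bracket_rpow_mul (σ : ℝ) (ζ : Space d) (z : ℂ) :
    ‖(((1 + ‖(2 * Real.pi) • ζ‖ ^ 2) ^ (σ / 2) : ℝ) : ℂ) * z‖
      = (1 + ‖(2 * Real.pi) • ζ‖ ^ 2) ^ (σ / 2) * ‖z‖ := by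
  rw [norm_mul, Complex.norm_real, Real.norm_of_nonneg (by positivity)]

/-- The exponential weight puts the functions `physical (expWeight _) F` into all Sobolev spaces. -/
theorem sobolevNorm_physical_lt_top {ε : ℝ} (hε : 0 < ε) (σ : ℝ) (F : L1L2 (Space d)) :
    sobolevNorm σ (physical (expWeight hε.le) F) < ∞ := by
  obtain ⟨C, hC, h⟩ := exists_bracket_rpow_le_exp (V := Space d) σ hε
  rw [sobolevNorm_physical]
  refine lt_of_le_of_lt (eLpNorm_le_mul_eLpNorm_of_ae_le_mul (g := F) (c := C) ?_ 2)
    (ENNReal.mul_lt_top ENNReal.ofReal_lt_top (L1L2.memLp_two F).2)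
  filter_upwards [coe_baseL2 (expWeight hε.le) F] with ζ hζ
  rw [norm_bracket_rpow_mul, hζ, Weight.base, norm_mul, Complex.norm_real,
    Real.norm_of_nonneg (inv_nonneg.mpr (Weight.pos _ ζ).le), ← mul_assoc, expWeight_apply]
  gcongr
  rw [← div_eq_mul_inv, div_le_iff₀ (Real.exp_pos _)]
  exact h ζ

/-- Functions of high frequency are small in Sobolev spaces of negative order. -/
theorem sobolevNorm_physical_le (w : Weight (Space d)) {s : ℝ} (hs : s ≤ 0) {N : ℝ} (hN : 0 < N)
    {F : L1L2 (Space d)} (hF : ∀ᵐ ζ, w.base F ζ ≠ 0 → N ≤ ‖(2 * Real.pi) • ζ‖) :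
    sobolevNorm s (physical w F) ≤ ENNReal.ofReal (N ^ s * ‖F‖) := by
  rw [sobolevNorm_physical, ENNReal.ofReal_mul (by positivity)]
  refine (eLpNorm_le_mul_eLpNorm_of_ae_le_mul (g := F) (c := N ^ s) ?_ 2).trans
    (by gcongr; exact L1L2.eLpNorm_two_le F)
  filter_upwards [coe_baseL2 w F, hF] with ζ hζ h
  rw [norm_bracket_rpow_mul, hζ]
  by_cases h0 : w.base F ζ = 0
  · rw [h0]
    simp only [norm_zero, mul_zero]
    positivity
  · gcongr
    · have h1 : N ^ 2 ≤ 1 + ‖(2 * Real.pi) • ζ‖ ^ 2 := by nlinarith [h h0]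
      refine (Real.rpow_le_rpow_of_nonpos (by positivity) h1 (by linarith)).trans_eq ?_
      rw [← Real.rpow_natCast N 2, ← Real.rpow_mul hN.le]
      congr 1
      push_cast
      ring
    · exact w.norm_base_le F ζ

/-- Sobolev norms of every order control the low frequencies. -/
theorem exists_enorm_localIntegral_le (σ : ℝ) : ∃ K : ℝ≥0∞, K ≠ ∞ ∧
    ∀ (w : Weight (Space d)) (h : Symbol (Space d)) (F : L1L2 (Space d)),
      ‖localIntegral w (Metric.ball 0 1) F‖ₑ
        ≤ K * sobolevNorm σ (physical w (L1L2.phase h F)) := by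
  set B : Set (Space d) := Metric.ball 0 1
  set C : ℝ := (1 + (2 * Real.pi) ^ 2) ^ (|σ| / 2) with hC
  have hBfin : (volume.restrict B) Set.univ ≠ ∞ := by
    rw [Measure.restrict_apply_univ]
    exact measure_ball_lt_top.ne
  refine ⟨ENNReal.ofReal C * (volume.restrict B) Set.univ ^
      (1 / (1 : ℝ≥0∞).toReal - 1 / (2 : ℝ≥0∞).toReal), ?_, fun w h F => ?_⟩
  · refine ENNReal.mul_ne_top ENNReal.ofReal_ne_top (ENNReal.rpow_ne_top_of_nonneg ?_ hBfin)
    norm_num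
  set g := baseL2 w (L1L2.phase h F) with hg
  have h1 : ‖localIntegral w B F‖ₑ ≤ eLpNorm g 1 (volume.restrict B) := by
    rw [localIntegral_apply, eLpNorm_one_eq_lintegral_enorm]
    refine (enorm_integral_le_lintegral_enorm _).trans_eq ?_
    refine lintegral_congr_ae (ae_restrict_of_ae ?_)
    filter_upwards [coe_baseL2 w (L1L2.phase h F), w.base_phase h F] with x e1 e2
    have : ‖w.base F x‖ = ‖g x‖ := by rw [hg, e1, e2, norm_mul, L1L2.norm_phase, one_mul]
    rw [← ofReal_norm, ← ofReal_norm, this]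
  have h2 := eLpNorm_le_eLpNorm_mul_rpow_measure_univ (p := 1) (q := 2) (μ := volume.restrict B)
    (f := g) (by norm_num) (Lp.aestronglyMeasurable g).restrict
  have h3 : eLpNorm g 2 (volume.restrict B)
      ≤ ENNReal.ofReal C * sobolevNorm σ (physical w (L1L2.phase h F)) := by
    rw [sobolevNorm_physical]
    refine (eLpNorm_le_mul_eLpNorm_of_ae_le_mul (c := C) ?_ 2).trans
      (by gcongr; exact Measure.restrict_le_self)
    filter_upwards [ae_restrict_mem measurableSet_ball] with x hx
    rw [norm_bracket_rpow_mul, ← mul_assoc]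
    have hx1 : ‖x‖ ≤ 1 := (mem_ball_zero_iff.mp hx).le
    have hY : 1 + ‖(2 * Real.pi) • x‖ ^ 2 ≤ 1 + (2 * Real.pi) ^ 2 := by
      rw [norm_smul, Real.norm_of_nonneg (by positivity)]
      have := mul_le_of_le_one_right (by positivity : 0 ≤ 2 * Real.pi) hx1
      gcongr
    have hb : 1 ≤ 1 + ‖(2 * Real.pi) • x‖ ^ 2 := le_add_of_nonneg_right (by positivity)
    have hinv : 1 ≤ C * (1 + ‖(2 * Real.pi) • x‖ ^ 2) ^ (σ / 2) := by
      calc (1 : ℝ) ≤ (1 + ‖(2 * Real.pi) • x‖ ^ 2) ^ (|σ| / 2 + σ / 2) :=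
            Real.one_le_rpow hb (by linarith [neg_abs_le σ])
        _ = (1 + ‖(2 * Real.pi) • x‖ ^ 2) ^ (|σ| / 2)
            * (1 + ‖(2 * Real.pi) • x‖ ^ 2) ^ (σ / 2) := Real.rpow_add (by linarith) _ _
        _ ≤ _ := by
          rw [hC]
          gcongr
    exact le_mul_of_one_le_left (norm_nonneg _) hinv
  refine h1.trans (h2.trans ?_)
  rw [mul_right_comm]
  gcongr

end Sobolev

/-! ### The transfer of mass -/

/-- The mass which a solution of the profile equation transfers to `B`, when the initial
data are supported away from `B` and the symbol is, up to an additive function, of size `M` on `B`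
and on the support of the initial data. -/
theorem le_norm_localIntegral_profile {V : Type*} [NormedAddCommGroup V] [InnerProductSpace ℝ V]
    [FiniteDimensional ℝ V] [MeasurableSpace V] [BorelSpace V] (w : Weight V) {ν : ℕ} (hν : 1 ≤ ν)
    (μ : ℝ) {Λ b : Symbol V} (hb : ∀ x y, b (x + y) = b x + b y) {B : Set V}
    (hB : MeasurableSet B) {M R A T : ℝ} (hM : 0 ≤ M) (hA : 0 ≤ A) (hT : 0 ≤ T) {χ : V → ℝ}
    (hχ : IsBump χ) {a c : V} {v : ℝ → L1L2 V}
    (hv0 : w.base (v 0) =ᵐ[volume] fun x => ((A * threeBumps χ a c x : ℝ) : ℂ))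
    (hΛB : ∀ x ∈ B, |(Λ - b) x| ≤ M) (hΛ : ∀ x, threeBumps χ a c x ≠ 0 → |(Λ - b) x| ≤ M)
    (hdisj : ∀ x ∈ B, threeBumps χ a c x = 0)
    (hv : ∀ t ∈ Set.Icc 0 T, ‖v t‖ ≤ R ∧
      HasDerivWithinAt v (field w ν μ Λ t (v t)) (Set.Icc 0 T) t) :
    |μ| * T * (A ^ (2 * ν + 1) * ∫ x in B, realPow ν χ x)
        - |μ| * R ^ (2 * ν + 1) * T * ((2 * ν + 2) * (T * (M + |μ| * R ^ (2 * ν))))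
      ≤ ‖localIntegral w B (v T)‖ := by
  have hv' : ∀ t ∈ Set.Icc 0 T, ‖v t‖ ≤ R ∧
      HasDerivWithinAt v (field w ν μ (Λ - b) t (v t)) (Set.Icc 0 T) t := by
    intro t ht
    rw [field_sub_additive w ν μ Λ hb]
    exact hv t ht
  have hΛF : ∀ᵐ x, v 0 x ≠ 0 → |(Λ - b) x| ≤ M := by
    filter_upwards [hv0] with x hx h0
    refine hΛ x fun h1 => ?_
    rw [h1, mul_zero, Complex.ofReal_zero, Weight.base] at hx
    exact mul_ne_zero (Complex.ofReal_ne_zero.mpr (inv_ne_zero (w.pos x).ne')) h0 hx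
  have key := norm_localIntegral_profile_le w ν μ hB hM hT hΛB hΛF hv'
  have hzero : localIntegral w B (v 0) = 0 := by
    rw [localIntegral_apply]
    refine integral_eq_zero_of_ae ?_
    filter_upwards [ae_restrict_of_ae hv0, ae_restrict_mem hB] with x hx hxB
    rw [hx, hdisj x hxB, mul_zero, Complex.ofReal_zero, Pi.zero_apply]
  rw [hzero, sub_zero] at key
  have hlow : A ^ (2 * ν + 1) * ∫ x in B, realPow ν χ x
      ≤ ‖localIntegral w B (w.pow ν (v 0))‖ := by
    have h1 : ∀ x, 0 ≤ χ (x - a) := fun x => hχ.nonneg _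
    have h2 : ∀ x, 0 ≤ χ (x - (a + c)) := fun x => hχ.nonneg _
    have h3 : ∀ x, 0 ≤ χ (x - c) := fun x => hχ.nonneg _
    refine le_localIntegral_pow w (hχ.threeBumps a c) hχ (a := a) (c := c) ?_ ?_ ?_ hν hA hv0 B <;>
      intro x <;> simp only [threeBumps] <;> linarith [h1 x, h2 x, h3 x]
  have hmain : |μ| * T * (A ^ (2 * ν + 1) * ∫ x in B, realPow ν χ x)
      ≤ ‖Complex.I * μ * T * localIntegral w B (w.pow ν (v 0))‖ := by
    rw [norm_mul, norm_mul, norm_mul, Complex.norm_I, one_mul, Complex.norm_real,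
      Complex.norm_real, Real.norm_of_nonneg hT, Real.norm_eq_abs]
    gcongr
  have htri := norm_sub_le (localIntegral w B (v T)
    + Complex.I * μ * T * localIntegral w B (w.pow ν (v 0))) (localIntegral w B (v T))
  rw [add_sub_cancel_left] at htri
  linarith

/-! ### Three bumps on a resonant rectangle -/

section Rectangle

variable {d : ℕ}

/-- The additive symbol `ζ ↦ 2π² ∑ η_j p_j ζ_j`.  The symbol `Λ - driftSymbol η p`, where `Λ` is the
symbol of `-½ Δ_η`, vanishes at all points with coordinates `0` or `p_j`. -/
def driftSymbol (η : Fin d → ℝ) (p : Space d) : Symbol (Space d) :=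
  ⟨fun ζ => 2 * Real.pi ^ 2 * ∑ j, η j * (p j * ζ j), by fun_prop⟩

theorem driftSymbol_add (η : Fin d → ℝ) (p x y : Space d) :
    driftSymbol η p (x + y) = driftSymbol η p x + driftSymbol η p y := by
  change 2 * Real.pi ^ 2 * ∑ j, η j * (p j * (x j + y j))
    = 2 * Real.pi ^ 2 * ∑ j, η j * (p j * x j) + 2 * Real.pi ^ 2 * ∑ j, η j * (p j * y j)
  rw [← mul_add, ← Finset.sum_add_distrib]
  congr 1
  exact Finset.sum_congr rfl fun j _ => by ring

/-- Once the drift is removed, the symbol is of the size of `p`, rather than of its square, near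
all points `a` whose coordinates are those of `0` or of `p`. -/
theorem abs_symbol_sub_driftSymbol_le {η : Fin d → ℝ} (hη : ∀ j, η j = 1 ∨ η j = -1) {p : Space d}
    {N : ℝ} (hp : ∀ j, |p j| ≤ N) {x : Space d} (hx : ∀ j, |x j| ≤ 1 ∨ |x j - p j| ≤ 1) :
    |(symbol η - driftSymbol η p) x| ≤ 2 * Real.pi ^ 2 * (d * (1 + N)) := by
  have e : (symbol η - driftSymbol η p) x
      = 2 * Real.pi ^ 2 * ∑ j, η j * (x j * (x j - p j)) := by
    change 2 * Real.pi ^ 2 * ∑ j, η j * x j ^ 2 - 2 * Real.pi ^ 2 * ∑ j, η j * (p j * x j) = _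
    rw [← mul_sub, ← Finset.sum_sub_distrib]
    congr 1
    exact Finset.sum_congr rfl fun j _ => by ring
  rw [e, abs_mul, abs_of_nonneg (by positivity)]
  gcongr
  refine (Finset.abs_sum_le_sum_abs _ _).trans ?_
  calc ∑ j, |η j * (x j * (x j - p j))| ≤ ∑ _j : Fin d, (1 + N) := by
        refine Finset.sum_le_sum fun j _ => ?_
        have hηj : |η j| = 1 := by rcases hη j with h | h <;> simp [h]
        have hN : 0 ≤ N := (abs_nonneg _).trans (hp j)
        rw [abs_mul, abs_mul, hηj, one_mul]
        rcases hx j with h | h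
        · have h2 : |x j - p j| ≤ 1 + N := (abs_sub _ _).trans (add_le_add h (hp j))
          calc |x j| * |x j - p j| ≤ 1 * (1 + N) := by gcongr
            _ = 1 + N := one_mul _
        · have h2 : |x j| ≤ 1 + N := by
            have e2 : x j = (x j - p j) + p j := by ring
            rw [e2]
            exact (abs_add_le _ _).trans (add_le_add h (hp j))
          calc |x j| * |x j - p j| ≤ (1 + N) * 1 := by gcongr
            _ = 1 + N := mul_one _
    _ = d * (1 + N) := by rw [Finset.sum_const, Finset.card_fin, nsmul_eq_mul]

theorem abs_apply_le_norm (x : Space d) (j : Fin d) : |x j| ≤ ‖x‖ := PiLp.norm_apply_le x j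

/-- A smooth bump supported in the ball of radius `1 / 2`. -/
def unitBump (d : ℕ) : ContDiffBump (0 : Space d) := ⟨1 / 4, 1 / 2, by norm_num, by norm_num⟩

theorem isBump_unitBump (d : ℕ) : IsBump (unitBump d : Space d → ℝ) :=
  ⟨(unitBump d).continuous, (unitBump d).hasCompactSupport, fun _ => (unitBump d).nonneg⟩

theorem unitBump_zero_pos (d : ℕ) : 0 < unitBump d 0 :=
  (unitBump d).pos_of_mem_ball (Metric.mem_ball_self (unitBump d).rOut_pos)

theorem norm_lt_of_unitBump_ne_zero {x : Space d} (h : unitBump d x ≠ 0) : ‖x‖ < 1 / 2 := by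
  have : x ∈ Metric.ball (0 : Space d) (unitBump d).rOut := by
    rw [← (unitBump d).support_eq]
    exact h
  exact mem_ball_zero_iff.mp this

theorem contDiff_threeBumps (a c : Space d) :
    ContDiff ℝ (⊤ : ℕ∞) (threeBumps (unitBump d) a c) := by
  have h : ∀ b : Space d, ContDiff ℝ (⊤ : ℕ∞) fun x => unitBump d (x - b) := fun b =>
    (unitBump d).contDiff.comp (contDiff_id.sub contDiff_const)
  exact ((h a).add (h (a + c))).add (h c)

theorem contDiff_ofReal_mul_threeBumps (A : ℝ) (a c : Space d) :
    ContDiff ℝ (⊤ : ℕ∞) fun x => ((A * threeBumps (unitBump d) a c x : ℝ) : ℂ) := by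
  have h : ContDiff ℝ (⊤ : ℕ∞) fun x => A * threeBumps (unitBump d) a c x :=
    contDiff_const.mul (contDiff_threeBumps a c)
  exact Complex.ofRealCLM.contDiff.comp h

theorem exists_of_threeBumps_ne_zero {a c x : Space d}
    (h : threeBumps (unitBump d) a c x ≠ 0) :
    ∃ b, (b = a ∨ b = a + c ∨ b = c) ∧ ‖x - b‖ < 1 / 2 := by
  by_cases h1 : unitBump d (x - a) = 0
  · by_cases h2 : unitBump d (x - (a + c)) = 0
    · by_cases h3 : unitBump d (x - c) = 0
      · exact absurd (by simp only [threeBumps, h1, h2, h3, add_zero]) h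
      · exact ⟨c, by simp, norm_lt_of_unitBump_ne_zero h3⟩
    · exact ⟨a + c, by simp, norm_lt_of_unitBump_ne_zero h2⟩
  · exact ⟨a, by simp, norm_lt_of_unitBump_ne_zero h1⟩

/-- The geometry of the support of the initial data: the frequencies are of size `N`, and close to
points with coordinates in `{0, N}`. -/
theorem rectangle_bounds {i k : Fin d} (hik : i ≠ k) {N : ℝ} (hN : 2 ≤ N) {x : Space d}
    (h : threeBumps (unitBump d) (EuclideanSpace.single i N) (EuclideanSpace.single k N) x ≠ 0) :
    1 ≤ ‖x‖ ∧ N ≤ 2 * ‖x‖ ∧ ‖x‖ ≤ 3 * N ∧ ∀ j, |x j| ≤ 1 ∨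
      |x j - (EuclideanSpace.single i N + EuclideanSpace.single k N : Space d) j| ≤ 1 := by
  obtain ⟨b, hb, hxb⟩ := exists_of_threeBumps_ne_zero h
  have hsn : ∀ l : Fin d, ‖(EuclideanSpace.single l N : Space d)‖ = N := fun l => by
    rw [PiLp.norm_single, Real.norm_of_nonneg (by linarith)]
  have hbN : N ≤ ‖b‖ ∧ ‖b‖ ≤ 2 * N := by
    rcases hb with rfl | rfl | rfl
    · rw [hsn]; constructor <;> linarith
    · constructor
      · have := abs_apply_le_norm
          (EuclideanSpace.single i N + EuclideanSpace.single k N : Space d) i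
        simp only [PiLp.add_apply, PiLp.single_apply, if_true, hik, if_false, add_zero] at this
        exact (le_abs_self N).trans this
      · refine (norm_add_le _ _).trans ?_
        rw [hsn, hsn]; linarith
    · rw [hsn]; constructor <;> linarith
  have h1 : ‖b‖ - ‖x‖ ≤ ‖x - b‖ := by
    rw [norm_sub_rev]; exact norm_sub_norm_le b x
  have h2 : ‖x‖ - ‖b‖ ≤ ‖x - b‖ := norm_sub_norm_le x b
  refine ⟨by linarith, by linarith, by linarith, fun j => ?_⟩
  have h3 : |x j - b j| ≤ 1 := by
    have := abs_apply_le_norm (x - b) j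
    rw [PiLp.sub_apply] at this
    linarith
  rcases hb with rfl | rfl | rfl
  · by_cases hj : j = k
    · left
      subst hj
      simpa [PiLp.single_apply, hik.symm] using h3
    · right
      simpa [PiLp.single_apply, hj] using h3
  · right
    exact h3
  · by_cases hj : j = i
    · left
      subst hj
      simpa [PiLp.single_apply, hik] using h3
    · right
      simpa [PiLp.single_apply, hj] using h3

theorem abs_single_add_single_le {i k : Fin d} (hik : i ≠ k) {N : ℝ} (hN : 0 ≤ N) (j : Fin d) :
    |(EuclideanSpace.single i N + EuclideanSpace.single k N : Space d) j| ≤ N := by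
  have hj : ¬ (j = i ∧ j = k) := fun h => hik (h.1.symm.trans h.2)
  simp only [PiLp.add_apply, PiLp.single_apply]
  by_cases h1 : j = i
  · have h2 : ¬ j = k := fun h2 => hj ⟨h1, h2⟩
    simp only [if_pos h1, if_neg h2, add_zero, abs_of_nonneg hN, le_refl]
  · by_cases h2 : j = k
    · simp only [if_neg h1, if_pos h2, zero_add, abs_of_nonneg hN, le_refl]
    · simp only [if_neg h1, if_neg h2, add_zero, abs_zero, hN]

end Rectangle

/-! ### Norm inflation -/

section Inflation

variable {d : ℕ}

/-- Three bumps of height `A`, as an element of `L¹ ∩ L²` and as the Fourier transform of a Schwartz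
function. -/
theorem exists_initial_data (w : Weight (Space d)) (a c : Space d) {A K X : ℝ} (hA : 0 ≤ A)
    (hK : 0 ≤ K) (hX : 0 ≤ X) (hX1 : eLpNorm (unitBump d) 1 volume ≤ ENNReal.ofReal X)
    (hX2 : eLpNorm (unitBump d) 2 volume ≤ ENNReal.ofReal X)
    (hw : ∀ x, threeBumps (unitBump d) a c x ≠ 0 → w x ≤ K) :
    ∃ (F : L1L2 (Space d)) (φ : 𝓢(Space d, ℂ)), ‖F‖ ≤ K * (3 * X) * A ∧
      w.base F =ᵐ[volume] (fun x => ((A * threeBumps (unitBump d) a c x : ℝ) : ℂ)) ∧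
      physical w F = φ.toLp 2 volume := by
  have hfb := (isBump_unitBump d).threeBumps a c
  have hbase : w.base ((A : ℂ) • ofBump w hfb : L1L2 (Space d)) =ᵐ[volume]
      fun x => ((A * threeBumps (unitBump d) a c x : ℝ) : ℂ) := by
    filter_upwards [L1L2.coe_smul (A : ℂ) (ofBump w hfb), base_ofBump w hfb] with x e1 e2
    rw [Weight.base] at e2 ⊢
    rw [e1, mul_left_comm, e2, Complex.ofReal_mul]
  obtain ⟨φ, hφ⟩ := exists_toLp_eq_physical w (contDiff_ofReal_mul_threeBumps A a c)
    (hfb.hasCompactSupport.comp_left (g := fun y : ℝ => ((A * y : ℝ) : ℂ))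
      (by rw [mul_zero, Complex.ofReal_zero])) hbase
  refine ⟨(A : ℂ) • ofBump w hfb, φ, ?_, hbase, hφ⟩
  rw [norm_smul, Complex.norm_real, Real.norm_of_nonneg hA, mul_comm]
  gcongr
  exact norm_ofBump_threeBumps_le w (isBump_unitBump d) a c hK hX hX1 hX2 hw

/-- Norm inflation with all parameters explicit: data of amplitude `A` at frequencies of size `N`,
over a time `T`. -/
theorem exists_solution_with_low_frequencies (hd : 2 ≤ d) (ν : ℕ) (hν : 1 ≤ ν) (μ : ℝ)
    (η : Fin d → ℝ) (hη : ∀ j, η j = 1 ∨ η j = -1) :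
    ∃ (C c : ℝ) (K : ℝ → ℝ≥0∞), 0 < C ∧ 0 < c ∧ (∀ σ, K σ ≠ ∞) ∧
      ∀ N A T : ℝ, 2 ≤ N → 0 ≤ A → 0 ≤ T → |μ| * (2 * (C * A)) ^ (2 * ν + 1) * T ≤ C * A →
      ∃ (φ : 𝓢(Space d, ℂ)) (ψ : ℝ → L2 d), IsSolution η ν μ φ T ψ ∧
        (∀ s ≤ 0, sobolevNorm s (φ.toLp 2 volume) ≤ ENNReal.ofReal (N ^ s * (C * A))) ∧
        (∀ σ, sobolevNorm σ (ψ T) < ∞) ∧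
        ∀ σ, ENNReal.ofReal (|μ| * T * (A ^ (2 * ν + 1) * c)
            - |μ| * (2 * (C * A)) ^ (2 * ν + 1) * T * ((2 * ν + 2) *
              (T * (2 * Real.pi ^ 2 * (d * (1 + N)) + |μ| * (2 * (C * A)) ^ (2 * ν)))))
          ≤ K σ * sobolevNorm σ (ψ T) := by
  have hχ := isBump_unitBump d
  set χ : Space d → ℝ := fun x => unitBump d x with hχdef
  obtain ⟨X, hX0, hX1, hX2⟩ : ∃ X : ℝ, 0 < X ∧ eLpNorm χ 1 volume ≤ ENNReal.ofReal X ∧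
      eLpNorm χ 2 volume ≤ ENNReal.ofReal X := by
    have h : ∀ p : ℝ≥0∞, eLpNorm χ p volume ≠ ∞ := fun p =>
      (hχ.continuous.memLp_of_hasCompactSupport hχ.hasCompactSupport).2.ne
    refine ⟨1 + (eLpNorm χ 1 volume).toReal + (eLpNorm χ 2 volume).toReal, by positivity, ?_, ?_⟩
    · refine (ENNReal.le_ofReal_iff_toReal_le (h 1) (by positivity)).mpr ?_
      have : 0 ≤ (eLpNorm χ 2 volume).toReal := ENNReal.toReal_nonneg
      linarith
    · refine (ENNReal.le_ofReal_iff_toReal_le (h 2) (by positivity)).mpr ?_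
      have : 0 ≤ (eLpNorm χ 1 volume).toReal := ENNReal.toReal_nonneg
      linarith
  choose K hK hKle using fun σ => exists_enorm_localIntegral_le (d := d) σ
  set B : Set (Space d) := Metric.ball 0 1 with hB
  have hc : 0 < ∫ x in B, realPow ν χ x :=
    (hχ.realPow ν).setIntegral_pos (hχ.realPow_pos (unitBump_zero_pos d) ν) one_pos
  refine ⟨Real.exp 3 * (3 * X), ∫ x in B, realPow ν χ x, K, by positivity, hc, hK,
    fun N A T hN hA hT hsmall => ?_⟩
  set R : ℝ := Real.exp 3 * (3 * X) * A with hR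
  have hN0 : 0 < N := by linarith
  -- This weight is at most `e³` on the support of the data, where `|ζ| ≤ 3N`.
  set w : Weight (Space d) := expWeight (inv_pos.mpr hN0).le with hw
  obtain ⟨i, k, hik⟩ : ∃ i k : Fin d, i ≠ k :=
    ⟨⟨0, by omega⟩, ⟨1, by omega⟩, by simp⟩
  set a : Space d := EuclideanSpace.single i N with ha
  set b : Space d := EuclideanSpace.single k N with hb
  have hgeom : ∀ x, threeBumps χ a b x ≠ 0 → 1 ≤ ‖x‖ ∧ N ≤ 2 * ‖x‖ ∧ ‖x‖ ≤ 3 * N ∧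
      ∀ j, |x j| ≤ 1 ∨ |x j - (a + b) j| ≤ 1 := fun x hx => rectangle_bounds hik hN hx
  set f := threeBumps χ a b with hf
  obtain ⟨F₀, φ, hF₀n, hbase, hφ⟩ := exists_initial_data w a b hA (Real.exp_pos 3).le hX0.le hX1
    hX2 fun x hx => by
      rw [hw, expWeight_apply]
      refine Real.exp_le_exp.mpr ?_
      rw [inv_mul_le_iff₀ hN0, mul_comm]
      exact (hgeom x hx).2.2.1
  have hsupp : ∀ᵐ x, w.base F₀ x ≠ 0 → f x ≠ 0 := by
    filter_upwards [hbase] with x hx h0 h1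
    rw [hx, ← hf, h1, mul_zero] at h0
    exact h0 Complex.ofReal_zero
  have hfin : ∀ σ F, sobolevNorm σ (physical w F) < ∞ := fun σ F =>
    sobolevNorm_physical_lt_top (inv_pos.mpr hN0) σ F
  clear_value w
  have hRT : |μ| * (2 * R) ^ (2 * ν + 1) * T ≤ R := hsmall
  obtain ⟨v, hv0, hv⟩ := exists_profile w ν μ (symbol η) hF₀n hT hRT
  rw [← hv0] at hφ hbase hF₀n hsupp
  refine ⟨φ, fun t => physical w (L1L2.phase ((-t) • symbol η) (v t)),
    isSolution_of_profile w hφ fun t ht => (hv t ht).2,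
    fun s hs => ?_, fun σ => hfin σ _, fun σ => ?_⟩
  · rw [← hφ]
    refine (sobolevNorm_physical_le w hs hN0 ?_).trans (ENNReal.ofReal_le_ofReal (by gcongr))
    filter_upwards [hsupp] with x hx h0
    rw [norm_smul, Real.norm_of_nonneg (by positivity)]
    refine (hgeom x (hx h0)).2.1.trans (mul_le_mul_of_nonneg_right ?_ (norm_nonneg x))
    linarith [Real.pi_gt_three]
  · have hp := abs_single_add_single_le hik hN0.le
    refine le_trans (ENNReal.ofReal_le_ofReal ?_)
      ((ofReal_norm _).le.trans (hKle σ w ((-T) • symbol η) (v T)))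
    refine le_norm_localIntegral_profile w hν μ (driftSymbol_add η (a + b)) measurableSet_ball
      (by positivity) hA hT hχ hbase (fun x hx => ?_) (fun x hx => ?_)
      (fun x hx => ?_) hv
    · exact abs_symbol_sub_driftSymbol_le hη hp fun j =>
        Or.inl ((abs_apply_le_norm x j).trans (mem_ball_zero_iff.mp hx).le)
    · exact abs_symbol_sub_driftSymbol_le hη hp (hgeom x hx).2.2.2
    · by_contra h0
      have := (hgeom x h0).1
      have := mem_ball_zero_iff.mp hx
      linarith

end Inflation

/-! ### Choice of the parameters -/

section Parameters

theorem tendsto_rpow_atTop_zero {e : ℝ} (he : e < 0) :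
    Tendsto (fun x : ℝ => x ^ e) atTop (𝓝 0) := by
  have := tendsto_rpow_neg_atTop (neg_pos.mpr he)
  rwa [neg_neg] at this

theorem rpow_pow_mul_rpow {x : ℝ} (hx : 0 < x) (a b : ℝ) (k : ℕ) :
    (x ^ a) ^ k * x ^ b = x ^ (a * k + b) := by
  rw [Real.rpow_add hx, Real.rpow_mul_natCast hx.le]

/-- For data of amplitude `N^a` over times `N^{-b}`, the nonlinear transfer to low frequencies
dominates its error terms. -/
theorem tendsto_growth (d ν : ℕ) {μ : ℝ} (hμ : μ ≠ 0) {a b : ℝ} {c : ℝ} (hc : 0 < c) (C : ℝ)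
    (h1 : b < (2 * ν + 1) * a) (h2 : 1 < b) (h3 : 2 * ν * a < b) :
    Tendsto (fun x : ℝ => |μ| * x ^ (-b) * ((x ^ a) ^ (2 * ν + 1) * c)
        - |μ| * (2 * (C * x ^ a)) ^ (2 * ν + 1) * x ^ (-b) * ((2 * ν + 2) *
          (x ^ (-b) * (2 * Real.pi ^ 2 * (d * (1 + x)) + |μ| * (2 * (C * x ^ a)) ^ (2 * ν)))))
      atTop atTop := by
  have l1 : Tendsto (fun x : ℝ => x ^ (a * (2 * ν + 1 : ℕ) + -b)) atTop atTop :=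
    tendsto_rpow_atTop (by push_cast; linarith)
  have l2 : Tendsto (fun x : ℝ => x ^ (-b)) atTop (𝓝 0) := tendsto_rpow_atTop_zero (by linarith)
  have l3 : Tendsto (fun x : ℝ => x ^ (1 + -b)) atTop (𝓝 0) :=
    tendsto_rpow_atTop_zero (by linarith)
  have l4 : Tendsto (fun x : ℝ => x ^ (a * (2 * ν : ℕ) + -b)) atTop (𝓝 0) :=
    tendsto_rpow_atTop_zero (by push_cast; linarith)
  have l5 : Tendsto (fun x : ℝ => c - (2 * C) ^ (2 * ν + 1) * (2 * ν + 2) *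
      (2 * Real.pi ^ 2 * d * (x ^ (-b) + x ^ (1 + -b))
        + |μ| * (2 * C) ^ (2 * ν) * x ^ (a * (2 * ν : ℕ) + -b))) atTop (𝓝 c) := by
    have := (((l2.add l3).const_mul (2 * Real.pi ^ 2 * d)).add
      (l4.const_mul (|μ| * (2 * C) ^ (2 * ν)))).const_mul ((2 * C) ^ (2 * ν + 1) * (2 * ν + 2))
    simpa using this.const_sub c
  refine ((l1.const_mul_atTop (abs_pos.mpr hμ)).atTop_mul_pos hc l5).congr' ?_
  filter_upwards [eventually_gt_atTop 0] with x hx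
  rw [← rpow_pow_mul_rpow hx, ← rpow_pow_mul_rpow hx, Real.rpow_add hx, Real.rpow_one]
  ring

/-- The growth of the transferred mass asks for `1 / (2ν + 1) < a`, the smallness of the data for
`a < -s`.  The choice `a < 1 / (2ν)` makes the nonlinear error smaller than the dispersive one. -/
theorem exists_exponent {ν : ℕ} (hν : 1 ≤ ν) {s : ℝ} (hs : s < -1 / (1 + 2 * (ν : ℝ))) :
    ∃ a b : ℝ, b < (2 * ν + 1) * a ∧ 1 < b ∧ 2 * ν * a < b ∧ a + s < 0 := by
  have hν0 : (0 : ℝ) < ν := by exact_mod_cast hν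
  have h1 : 1 / (1 + 2 * (ν : ℝ)) < -s := by
    rw [neg_div] at hs
    linarith
  have h2 : 1 / (1 + 2 * (ν : ℝ)) < 1 / (2 * ν) :=
    one_div_lt_one_div_of_lt (by positivity) (by linarith)
  obtain ⟨a, ha1, ha2⟩ := exists_between (lt_min h1 h2)
  obtain ⟨ha3, ha4⟩ := lt_min_iff.mp ha2
  rw [div_lt_iff₀ (by positivity)] at ha1
  rw [lt_div_iff₀ (by positivity)] at ha4
  refine ⟨a, (1 + (2 * ν + 1) * a) / 2, ?_, ?_, ?_, ?_⟩ <;> linarith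

end Parameters

end NLS

end

theorem theorem1p4 (d : ℕ) (hd : 2 ≤ d) (ν : ℕ) (hν : 1 ≤ ν) (μ : ℝ) (hμ : μ ≠ 0)
    (η : Fin d → ℝ) (hη : ∀ j, η j = 1 ∨ η j = -1)
    (s : ℝ) (hs : s < -1 / (1 + 2 * (ν : ℝ))) :
    ∃ (φ : ℕ → 𝓢(NLS.Space d, ℂ)) (t : ℕ → ℝ) (ψ : ℕ → ℝ → NLS.L2 d),
      Tendsto (fun n => NLS.sobolevNorm s ((φ n).toLp 2 volume)) atTop (𝓝 0) ∧
      (∀ n, 0 < t n) ∧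
      Tendsto t atTop (𝓝 0) ∧
      (∀ n, NLS.IsSolution η ν μ (φ n) (t n) (ψ n)) ∧
      (∀ n, ∀ ψ' : ℝ → NLS.L2 d, NLS.IsSolution η ν μ (φ n) (t n) ψ' →
        Set.EqOn ψ' (ψ n) (Set.Icc 0 (t n))) ∧
      (∀ n, ∀ σ : ℝ, NLS.sobolevNorm σ (ψ n (t n)) < ∞) ∧
      (∀ σ : ℝ, Tendsto (fun n => NLS.sobolevNorm σ (ψ n (t n))) atTop (𝓝 ∞)) := by
  obtain ⟨C, c, K, hC, hc, hK, H⟩ :=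
    NLS.exists_solution_with_low_frequencies hd ν hν μ η hη
  obtain ⟨a, b, h1, h2, h3, h4⟩ := NLS.exists_exponent hν hs
  have hs0 : s ≤ 0 := hs.le.trans (div_nonpos_of_nonpos_of_nonneg (by norm_num) (by positivity))
  -- For large frequencies the profile equation is solvable up to the chosen time.
  have hsmall : ∀ᶠ x : ℝ in atTop, 2 ≤ x ∧
      |μ| * (2 * (C * x ^ a)) ^ (2 * ν + 1) * x ^ (-b) ≤ C * x ^ a := by
    have l : Tendsto (fun x : ℝ => |μ| * (2 * C) ^ (2 * ν + 1) * x ^ (a * (2 * ν : ℕ) + -b)) atTop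
        (𝓝 0) := by
      have := (NLS.tendsto_rpow_atTop_zero (e := a * (2 * ν : ℕ) + -b)
        (by push_cast; linarith)).const_mul (|μ| * (2 * C) ^ (2 * ν + 1))
      rwa [mul_zero] at this
    filter_upwards [l.eventually (gt_mem_nhds hC), eventually_ge_atTop 2] with x hx hx2
    have hx0 : 0 < x := by linarith
    refine ⟨hx2, ?_⟩
    rw [← NLS.rpow_pow_mul_rpow hx0] at hx
    calc |μ| * (2 * (C * x ^ a)) ^ (2 * ν + 1) * x ^ (-b)
        = |μ| * (2 * C) ^ (2 * ν + 1) * ((x ^ a) ^ (2 * ν) * x ^ (-b)) * x ^ a := by ring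
      _ ≤ C * x ^ a := by gcongr
  obtain ⟨x₀, hx₀⟩ := eventually_atTop.mp hsmall
  have hN : Tendsto (fun n : ℕ => x₀ + n) atTop atTop :=
    tendsto_atTop_add_const_left _ _ tendsto_natCast_atTop_atTop
  have hle : ∀ n : ℕ, x₀ ≤ x₀ + n := fun n => le_add_of_nonneg_right n.cast_nonneg
  have hpos : ∀ n : ℕ, 0 < x₀ + n := fun n => two_pos.trans_le (hx₀ _ (hle n)).1
  choose φ ψ hsol hinit hfin hgrow using fun n : ℕ => H (x₀ + n) ((x₀ + n) ^ a) ((x₀ + n) ^ (-b))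
    (hx₀ _ (hle n)).1 (Real.rpow_nonneg (hpos n).le _) (Real.rpow_nonneg (hpos n).le _)
    (hx₀ _ (hle n)).2
  refine ⟨φ, fun n => (x₀ + n) ^ (-b), ψ, ?_, fun n => Real.rpow_pos_of_pos (hpos n) _,
    (NLS.tendsto_rpow_atTop_zero (by linarith)).comp hN, hsol,
    fun n ψ' h => (hsol n).unique h, hfin, fun σ => ?_⟩
  · have l : Tendsto (fun x : ℝ => x ^ s * (C * x ^ a)) atTop (𝓝 0) := by
      have := (NLS.tendsto_rpow_atTop_zero h4).const_mul C
      rw [mul_zero] at this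
      refine this.congr' ?_
      filter_upwards [eventually_gt_atTop 0] with x hx
      rw [Real.rpow_add hx]
      ring
    have l2 := ENNReal.tendsto_ofReal (l.comp hN)
    rw [ENNReal.ofReal_zero] at l2
    exact tendsto_of_tendsto_of_tendsto_of_le_of_le tendsto_const_nhds l2 (fun _ => zero_le)
      fun n => hinit n s hs0
  · have l := ENNReal.tendsto_ofReal_atTop.comp ((NLS.tendsto_growth d ν hμ hc C h1 h2 h3).comp hN)
    have l2 := ENNReal.Tendsto.mul_const l (b := (K σ)⁻¹) (Or.inl ENNReal.top_ne_zero)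
    rw [ENNReal.top_mul (ENNReal.inv_ne_zero.mpr (hK σ))] at l2
    refine tendsto_of_tendsto_of_tendsto_of_le_of_le l2 tendsto_const_nhds (fun n => ?_)
      fun _ => le_top
    exact ENNReal.div_le_of_le_mul' (hgrow n σ)
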